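/- **Energy estimate for hybrid (cell- and face-centred) finite volume methods.** *Continuous problem.* Let $\Omega\subset\mathbb R^d$, $d\ge 1$, be an open bounded connected polytopal domain (an open polytope is a bounded set that is the interior of a finite union of convex polyhedra), let $K:\Omega\to\mathbb R^{d\times d}$ be a symmetric, uniformly elliptic diffusion field which is constant on each element of a finite partition of $\Omega$ into polytopes, and let $f\in L^2(\Omega)$. Let $u\in H^1_0(\Omega)$ satisfy $\int_\Omega K\nabla u\cdot\nabla v=\int_\Omega fv$ for all $v\in H^1_0(\Omega)$. *Mesh.* Let $(\mathcal T_h,\mathcal F_h)$ be a polytopal mesh of $\Omega$ such that each cell is contained in one element of the partition. That is, $\mathcal T_h$ is a finite family of non-empty, disjoint open polytopes $T\subset\Omega$ with $\overline\Omega=\bigcup_T\overline T$; $\mathcal F_h$ is a finite family of non-empty, disjoint, relatively open polytopes $F$ contained in hyperplanes; $\mathcal F_T$ denotes the set of faces contained in $\partial T$, and $\partial T=\bigcup_{F\in\mathcal F_T}\overline F$; each face is either an internal face, contained in $\Omega$ and shared by exactly two cells, or a boundary face, contained in $\partial\Omega$ and belonging to exactly one cell; and each cell $T$ lies locally on one side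 of each of its faces $F\in\mathcal F_T$, with $n_{TF}$ the unit normal to $F$ pointing out of $T$. Let $K_T$ be the constant value of $K$ in $T$, and $\underline\lambda_T>0$ its smallest eigenvalue. Fix points $x_T\in T$ for each cell and $x_F\in\overline F$ for each face, let $|F|$ be the $(d-1)$-dimensional measure of $F$, and assume that the orthogonal distance $d_{TF}$ from $x_T$ to the hyperplane containing $F$ is positive whenever $F\in\mathcal F_T$. *Discrete problem.* Let $X_h$ be the space of families $v_h=((v_T)_{T\in\mathcal T_h},(v_F)_{F\in\mathcal F_h})$ of real numbers with $v_F=0$ for all boundary faces $F$, and set $$\|v_h\|_{1,\mathcal T_h}=\Big(\sum_{T\in\mathcal T_h}\underline\lambda_T\sum_{F\in\mathcal F_T}|F|\,d_{TF}\Big(\frac{v_T-v_F}{d_{TF}}\Big)^2\Big)^{1/2}.$$ For $T\in\mathcal T_h$ and $F\in\mathcal F_T$ let $F_{TF}:X_h\to\mathbb R$ be a linear numerical flux, and assume that, for some $\gamma>0$, $$\sum_{T\in\mathcal T_h}\sum_{F\in\mathcal F_T}F_{TF}(v_h)(v_T-v_F)\ge\gamma\|v_h\|_{1,\mathcal T_h}^2\qquad\forall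 v_h\in X_h.$$ Let $u_h\in X_h$ be a solution to the finite volume scheme: $F_{TF}(u_h)+F_{T'F}(u_h)=0$ for all internal faces $F$ shared by two cells $T\neq T'$, and $\sum_{F\in\mathcal F_T}F_{TF}(u_h)=\int_T f$ for all $T\in\mathcal T_h$. *Claim.* If $u\in C(\overline\Omega)$ and $u_{|T}\in H^2(T)$ for all $T\in\mathcal T_h$, then, with $I_hu=((u(x_T))_{T\in\mathcal T_h},(u(x_F))_{F\in\mathcal F_h})\in X_h$ (where $u(x_F)=0$ for boundary faces, since $u$ vanishes on $\partial\Omega$), $$\|u_h-I_hu\|_{1,\mathcal T_h}\le\gamma^{-1}\Big(\sum_{T\in\mathcal T_h}\underline\lambda_T^{-1}\sum_{F\in\mathcal F_T}\frac{d_{TF}}{|F|}\Big[\int_F K_T\nabla u_{|T}\cdot n_{TF}+F_{TF}(I_hu)\Big]^2\Big)^{1/2},$$ where $\nabla u_{|T}$ on $F$ is understood in the sense of traces. -/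

import Mathlib

open MeasureTheory Filter Topology Set
open scoped ENNReal ContDiff RealInnerProductSpace

noncomputable section

namespace HybridFV

/-- The Euclidean space `ℝ^d`. -/
abbrev E (d : ℕ) := EuclideanSpace ℝ (Fin d)

/-! ### Polytopes and meshes -/

/-- A convex polyhedron: a finite intersection of closed half-spaces. -/
def IsPolyhedron {d : ℕ} (P : Set (E d)) : Prop :=
  ∃ s : Finset (E d × ℝ), P = {x | ∀ p ∈ s, ⟪p.1, x⟫ ≤ p.2}

/-- An open polytope (not necessarily convex): a bounded set which is the interior of a finite
union of convex polyhedra. Such a set has no cracks. -/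
def IsPolytope {d : ℕ} (S : Set (E d)) : Prop :=
  Bornology.IsBounded S ∧
    ∃ Q : Set (Set (E d)), Q.Finite ∧ (∀ P ∈ Q, IsPolyhedron P) ∧ S = interior (⋃₀ Q)

/-- A hyperplanar (relatively open) polytope: a bounded subset of a hyperplane `H` which is the
interior relative to `H` of a finite union of convex polyhedra. -/
def IsHyperplanarPolytope {d : ℕ} (F : Set (E d)) : Prop :=
  Bornology.IsBounded F ∧
    ∃ (a : E d) (c : ℝ) (Q : Set (Set (E d))), ‖a‖ = 1 ∧ Q.Finite ∧
      (∀ P ∈ Q, IsPolyhedron P) ∧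
      F = {x | ⟪a, x⟫ = c ∧ ⋃₀ Q ∈ 𝓝[{y | ⟪a, y⟫ = c}] x}

/-- A family of non-empty, pairwise disjoint open polytopes contained in `Ω`, whose closures
cover the closure of `Ω`. -/
structure IsPolytopalPartition {d : ℕ} (Ω : Set (E d)) {ι : Type*} (P : ι → Set (E d)) :
    Prop where
  polytope : ∀ i, IsPolytope (P i)
  nonempty : ∀ i, (P i).Nonempty
  subset : ∀ i, P i ⊆ Ω
  disjoint : Pairwise fun i j => Disjoint (P i) (P j)
  closure_eq : closure Ω = ⋃ i, closure (P i)

/-- A polytopal mesh of `Ω`, with cells indexed by `𝒯` and faces indexed by `ℱ`. A face `F` is a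
face of the cell `T` when it lies on the boundary of `T`; `normal T F` is then the unit vector
normal to `F` pointing out of `T` (for other pairs `(T, F)` its value is irrelevant). -/
structure PolytopalMesh {d : ℕ} (Ω : Set (E d)) (𝒯 ℱ : Type*) where
  /-- the cells -/
  cell : 𝒯 → Set (E d)
  /-- the faces -/
  face : ℱ → Set (E d)
  /-- the outward unit normals -/
  normal : 𝒯 → ℱ → E d
  cells : IsPolytopalPartition Ω cell
  face_polytope : ∀ F, IsHyperplanarPolytope (face F)
  face_nonempty : ∀ F, (face F).Nonempty
  face_disjoint : Pairwise fun F F' => Disjoint (face F) (face F')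
  /-- the boundary of a cell is covered by the closures of its faces -/
  frontier_cell : ∀ T, frontier (cell T) =
    ⋃ F ∈ {F | face F ⊆ frontier (cell T)}, closure (face F)
  /-- a face is either an internal face, shared by exactly two cells, or a boundary face, which
  belongs to exactly one cell -/
  internal_or_boundary : ∀ F,
    (face F ⊆ Ω ∧ ∃ T T', T ≠ T' ∧ ∀ S, face F ⊆ frontier (cell S) ↔ S = T ∨ S = T') ∨
    (face F ⊆ frontier Ω ∧ ∃! T, face F ⊆ frontier (cell T))
  norm_normal : ∀ T F, face F ⊆ frontier (cell T) → ‖normal T F‖ = 1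
  /-- around each point of its face `F`, the cell `T` is the half-space which is on the side of
  `F` opposite to the normal; so `normal T F` is normal to `F` and points out of `T` -/
  normal_outward : ∀ T F, face F ⊆ frontier (cell T) → ∀ x ∈ face F, ∃ r > 0,
    ∀ y ∈ Metric.ball x r, y ∈ cell T ↔ ⟪normal T F, y - x⟫ < 0

namespace PolytopalMesh

variable {d : ℕ} {Ω : Set (E d)} {𝒯 ℱ : Type*} [Fintype 𝒯] [Fintype ℱ]

open Classical in
/-- The set of the faces of the cell `T`. -/
def facesOf (M : PolytopalMesh Ω 𝒯 ℱ) (T : 𝒯) : Finset ℱ :=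
  Finset.univ.filter fun F => M.face F ⊆ frontier (M.cell T)

/-- `F` is a boundary face. -/
def IsBoundary (M : PolytopalMesh Ω 𝒯 ℱ) (F : ℱ) : Prop := M.face F ⊆ frontier Ω

/-- The `(d-1)`-dimensional measure `|F|` of the face `F`. -/
def faceMeasure (M : PolytopalMesh Ω 𝒯 ℱ) (F : ℱ) : ℝ := (μHE[d - 1] (M.face F)).toReal

/-- The orthogonal distance `d_{TF}` between the point `x_T` and (the hyperplane spanned by) the
face `F`. -/
def orthDist (M : PolytopalMesh Ω 𝒯 ℱ) (xT : 𝒯 → E d) (T : 𝒯) (F : ℱ) : ℝ :=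
  Metric.infDist (xT T) (affineSpan ℝ (M.face F) : Set (E d))

end PolytopalMesh

/-! ### Sobolev spaces -/

/-- Smooth functions with compact support contained in `S`. -/
def IsTestFunction {d : ℕ} (S : Set (E d)) (φ : E d → ℝ) : Prop :=
  ContDiff ℝ ∞ φ ∧ HasCompactSupport φ ∧ tsupport φ ⊆ S

/-- `G` is a weak gradient of `w` in the open set `S`. -/
def HasWeakGradient {d : ℕ} (S : Set (E d)) (w : E d → ℝ) (G : E d → E d) : Prop :=
  LocallyIntegrableOn w S ∧ LocallyIntegrableOn G S ∧
    ∀ φ, IsTestFunction S φ → ∫ x in S, w x • gradient φ x = - ∫ x in S, φ x • G x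

open Classical in
/-- The weak gradient of `w` in `S` (unique up to a null subset of `S` when it exists). -/
def weakGrad {d : ℕ} (S : Set (E d)) (w : E d → ℝ) : E d → E d :=
  if h : ∃ G, HasWeakGradient S w G then h.choose else 0

/-- `w ∈ H¹(S)`. -/
def MemH1 {d : ℕ} (S : Set (E d)) (w : E d → ℝ) : Prop :=
  MemLp w 2 (volume.restrict S) ∧
    ∃ G, HasWeakGradient S w G ∧ MemLp G 2 (volume.restrict S)

/-- `w ∈ H²(S)`: `w ∈ H¹(S)` and the components of its weak gradient are in `H¹(S)`. -/
def MemH2 {d : ℕ} (S : Set (E d)) (w : E d → ℝ) : Prop :=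
  MemH1 S w ∧ ∀ i, MemH1 S fun x => weakGrad S w x i

/-- Convergence in `H¹(S)` of the differentiable functions `φ k` towards the function `w`, whose
weak gradient in `S` is `G`. -/
def TendstoH1 {d : ℕ} (S : Set (E d)) (φ : ℕ → E d → ℝ) (w : E d → ℝ) (G : E d → E d) : Prop :=
  Tendsto (fun k => eLpNorm (fun x => φ k x - w x) 2 (volume.restrict S)) atTop (𝓝 0) ∧
  Tendsto (fun k => eLpNorm (fun x => gradient (φ k) x - G x) 2 (volume.restrict S))
    atTop (𝓝 0)

/-- `w ∈ H¹₀(Ω)`, the closure of the test functions in `H¹(Ω)`. -/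
def MemH10 {d : ℕ} (Ω : Set (E d)) (w : E d → ℝ) : Prop :=
  MemH1 Ω w ∧ ∃ φ : ℕ → E d → ℝ, (∀ k, IsTestFunction Ω (φ k)) ∧
    TendstoH1 Ω φ w (weakGrad Ω w)

/-- `g ∈ L²(F)` is the trace on the flat boundary part `F` of `w ∈ H¹(S)`. Traces being local, it
is required that around each point of `F` there is a sequence of smooth functions which converges
to `w` in `H¹` on the side of `S` and whose restrictions to `F` converge to `g` in `L²`. -/
structure IsTrace {d : ℕ} (S F : Set (E d)) (w g : E d → ℝ) : Prop where
  memLp : MemLp g 2 ((μHE[d - 1] : Measure (E d)).restrict F)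
  approx : ∀ x ∈ F, ∃ r > 0, ∃ φ : ℕ → E d → ℝ, (∀ k, ContDiff ℝ ∞ (φ k)) ∧
    TendstoH1 (S ∩ Metric.ball x r) φ w (weakGrad S w) ∧
    Tendsto (fun k => eLpNorm (fun y => φ k y - g y) 2
      ((μHE[d - 1] : Measure (E d)).restrict (F ∩ Metric.ball x r))) atTop (𝓝 0)

open Classical in
/-- The trace on `F` of `w ∈ H¹(S)` (unique up to a null subset of `F`). -/
def trace {d : ℕ} (S F : Set (E d)) (w : E d → ℝ) : E d → ℝ :=
  if h : ∃ g, IsTrace S F w g then h.choose else 0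

/-! ### The continuous problem -/

/-- A symmetric, uniformly elliptic diffusion field on `Ω`, constant on each `P i`. -/
structure IsDiffusionField {d : ℕ} (Ω : Set (E d)) {ι : Type*} (P : ι → Set (E d))
    (K : E d → Matrix (Fin d) (Fin d) ℝ) : Prop where
  symm : ∀ x ∈ Ω, (K x).IsSymm
  elliptic : ∃ a > 0, ∃ b, ∀ x ∈ Ω, ∀ ξ : E d,
    a * ‖ξ‖ ^ 2 ≤ ⟪Matrix.toEuclideanLin (K x) ξ, ξ⟫ ∧
      ⟪Matrix.toEuclideanLin (K x) ξ, ξ⟫ ≤ b * ‖ξ‖ ^ 2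
  const : ∀ i, ∀ x ∈ P i, ∀ y ∈ P i, K x = K y

/-- `u` is the weak solution of `-div (K ∇u) = f` in `Ω`, `u = 0` on `∂Ω`. -/
def IsWeakSolution {d : ℕ} (Ω : Set (E d)) (K : E d → Matrix (Fin d) (Fin d) ℝ) (f : E d → ℝ)
    (u : E d → ℝ) : Prop :=
  MemH10 Ω u ∧ ∀ v, MemH10 Ω v →
    ∫ x in Ω, ⟪Matrix.toEuclideanLin (K x) (weakGrad Ω u x), weakGrad Ω v x⟫
      = ∫ x in Ω, f x * v x

/-- The smallest eigenvalue of a symmetric matrix. -/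
def minEigenvalue {d : ℕ} (A : Matrix (Fin d) (Fin d) ℝ) : ℝ := sInf (spectrum ℝ A)

/-! ### The discrete problem -/

namespace PolytopalMesh

variable {d : ℕ} {Ω : Set (E d)} {𝒯 ℱ : Type*} [Fintype 𝒯] [Fintype ℱ]

/-- The space of cell and face unknowns which vanish on the boundary faces. -/
def X (M : PolytopalMesh Ω 𝒯 ℱ) : Submodule ℝ ((𝒯 → ℝ) × (ℱ → ℝ)) where
  carrier := {v | ∀ F, M.IsBoundary F → v.2 F = 0}
  add_mem' := fun ha hb F hF => by simp [ha F hF, hb F hF]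
  zero_mem' := fun _ _ => rfl
  smul_mem' := fun c v hv F hF => by simp [hv F hF]

variable {M : PolytopalMesh Ω 𝒯 ℱ}

/-- The cell unknown `v_T`. -/
def cellVal (v : M.X) (T : 𝒯) : ℝ := v.1.1 T

/-- The face unknown `v_F`. -/
def faceVal (v : M.X) (F : ℱ) : ℝ := v.1.2 F

open Classical in
/-- The interpolant of a function `u` which is continuous on the closure of `Ω` and vanishes on
the boundary of `Ω`: its components are the values of `u` at the points `x_T` and `x_F`. (The
value at `x_F ∈ ∂Ω` for a boundary face is written as `0`, so that the interpolant is an element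
of `M.X` by construction.) -/
def interp (M : PolytopalMesh Ω 𝒯 ℱ) (xT : 𝒯 → E d) (xF : ℱ → E d) (u : E d → ℝ) : M.X :=
  ⟨(fun T => u (xT T), fun F => if M.IsBoundary F then 0 else u (xF F)),
    fun F hF => by simp [hF]⟩

/-- The square of the local discrete `H¹` seminorm. -/
def seminormSq (M : PolytopalMesh Ω 𝒯 ℱ) (xT : 𝒯 → E d) (T : 𝒯) (v : M.X) : ℝ :=
  ∑ F ∈ M.facesOf T, M.faceMeasure F * M.orthDist xT T F *
    ((cellVal v T - faceVal v F) / M.orthDist xT T F) ^ 2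

/-- The discrete `H¹₀` norm weighted by the diffusion. -/
def discNorm (M : PolytopalMesh Ω 𝒯 ℱ) (xT : 𝒯 → E d)
    (KT : 𝒯 → Matrix (Fin d) (Fin d) ℝ) (v : M.X) : ℝ :=
  Real.sqrt (∑ T, minEigenvalue (KT T) * M.seminormSq xT T v)

/-- The coercivity of the numerical fluxes, with constant `γ`. -/
def IsCoercive (M : PolytopalMesh Ω 𝒯 ℱ) (xT : 𝒯 → E d)
    (KT : 𝒯 → Matrix (Fin d) (Fin d) ℝ) (Fl : 𝒯 → ℱ → M.X →ₗ[ℝ] ℝ) (γ : ℝ) : Prop :=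
  ∀ v : M.X, γ * M.discNorm xT KT v ^ 2 ≤
    ∑ T, ∑ F ∈ M.facesOf T, Fl T F v * (cellVal v T - faceVal v F)

/-- `uh` is a solution of the finite volume scheme: conservativity of the fluxes across the
internal faces and balance of the fluxes in each cell. -/
structure IsFVSolution (M : PolytopalMesh Ω 𝒯 ℱ) (Fl : 𝒯 → ℱ → M.X →ₗ[ℝ] ℝ) (f : E d → ℝ)
    (uh : M.X) : Prop where
  conservative : ∀ F T T', T ≠ T' → F ∈ M.facesOf T → F ∈ M.facesOf T' →
    Fl T F uh + Fl T' F uh = 0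
  balance : ∀ T, ∑ F ∈ M.facesOf T, Fl T F uh = ∫ x in M.cell T, f x

/-- The integral over the face `F` of `K_T ∇u_{|T} · n_{TF}`, where the components of the weak
gradient in `T` are replaced by their traces on `F`. -/
def diffusiveFlux (M : PolytopalMesh Ω 𝒯 ℱ) (KT : 𝒯 → Matrix (Fin d) (Fin d) ℝ)
    (u : E d → ℝ) (T : 𝒯) (F : ℱ) : ℝ :=
  ∫ x in M.face F, ⟪Matrix.toEuclideanLin (KT T)
      (WithLp.toLp 2 fun i =>
        trace (M.cell T) (M.face F) (fun y => weakGrad (M.cell T) u y i) x),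
    M.normal T F⟫ ∂μHE[d - 1]

end PolytopalMesh

end HybridFV

end

open HybridFV

namespace HybridFV

/-! ### Surface measure on hyperplanes -/

/-- The affine hyperplane `{y | ⟪n, y⟫ = c}`. -/
def hyperplane {d : ℕ} (n : E d) (c : ℝ) : Set (E d) := {y | ⟪n, y⟫ = c}

theorem measurableSet_hyperplane {d : ℕ} (n : E d) (c : ℝ) : MeasurableSet (hyperplane n c) :=
  measurableSet_eq_fun (by fun_prop) measurable_const

theorem hyperplane_eq_mk' {d : ℕ} (n p : E d) :
    hyperplane n ⟪n, p⟫ = (AffineSubspace.mk' p (ℝ ∙ n)ᗮ : Set (E d)) := by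
  ext y
  simp [hyperplane, AffineSubspace.mem_mk', Submodule.mem_orthogonal_singleton_iff_inner_right,
    inner_sub_right, sub_eq_zero]

theorem volume_eq_lintegral_hyperplane {d : ℕ} {n : E d} (hn : ‖n‖ = 1) {t : Set (E d)}
    (ht : MeasurableSet t) :
    volume t = ∫⁻ x : ℝ, μHE[d - 1] (t ∩ hyperplane n x) := by
  have h0 : n ≠ 0 := by rintro rfl; simp at hn
  have h := EuclideanGeometry.euclideanHausdorffMeasure_eq_lintegral (0 : E d) h0 ht
  simp only [finrank_euclideanSpace_fin, EuclideanSpace.euclideanHausdorffMeasure_eq_volume] at h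
  rw [h, ← ofReal_norm, hn]
  simp only [ENNReal.ofReal_one, one_mul]
  congr 1 with x
  rw [← hyperplane_eq_mk']
  simp [inner_smul_right, hn]

/-- The measure `μHE[d - 1]` is not σ-finite on the whole space, but on a hyperplane it is the
isometric image of the Lebesgue measure of a (d-1)-dimensional space. This is what makes Tonelli and
Fubini available below. -/
instance sigmaFinite_hyperplane {d : ℕ} (n : E d) (c : ℝ) [hn : Fact (‖n‖ = 1)] :
    SFinite ((μHE[d - 1] : Measure (E d)).restrict (hyperplane n c)) := by
  have h0 : n ≠ 0 := by rintro rfl; simpa using hn.out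
  have hp : c = ⟪n, c • n⟫ := by simp [inner_smul_right, hn.out]
  have hr : Module.finrank ℝ ((ℝ ∙ n)ᗮ : Submodule ℝ (E d)) = d - 1 := by
    have := (ℝ ∙ n).finrank_add_finrank_orthogonal
    rw [finrank_span_singleton h0, finrank_euclideanSpace_fin] at this
    omega
  have hi : Isometry (fun y : ((ℝ ∙ n)ᗮ : Submodule ℝ (E d)) => (y : E d) + c • n) :=
    (IsometryEquiv.addRight (c • n)).isometry.comp isometry_subtype_coe
  have hrange : Set.range (fun y : ((ℝ ∙ n)ᗮ : Submodule ℝ (E d)) => (y : E d) + c • n)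
      = hyperplane n c := by
    ext y
    nth_rewrite 2 [hp]
    rw [hyperplane_eq_mk']
    simp only [mem_range, Subtype.exists, SetLike.mem_coe, AffineSubspace.mem_mk']
    constructor
    · rintro ⟨a, ha, rfl⟩; simpa using ha
    · intro h; exact ⟨y - c • n, by simpa using h, by simp⟩
  rw [← hrange, ← hi.map_euclideanHausdorffMeasure, ← hr]
  infer_instance

/-- Slanted coordinates y + s v have Jacobian |⟪n, v⟫|. The section of the preimage of `t` at time s
is a translate of the slice of `t` at level ⟪n, v⟫ s + c, so the slicing formula for the volume and
an affine change of variable in s give the identity. -/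
theorem map_add_smul_hyperplane {d : ℕ} {n : E d} (hn : ‖n‖ = 1) (c : ℝ) {v : E d}
    (hv : ⟪n, v⟫ ≠ 0) :
    (((μHE[d - 1] : Measure (E d)).restrict (hyperplane n c)).prod (volume : Measure ℝ)).map
      (fun p => p.1 + p.2 • v) = ENNReal.ofReal |⟪n, v⟫|⁻¹ • volume := by
  have := Fact.mk hn
  ext t ht
  have hm : Measurable (fun p : E d × ℝ => p.1 + p.2 • v) := by fun_prop
  rw [Measure.map_apply hm ht, Measure.prod_apply_symm (hm ht), Measure.smul_apply,
    volume_eq_lintegral_hyperplane hn ht]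
  have key : ∀ s : ℝ, ((μHE[d - 1] : Measure (E d)).restrict (hyperplane n c))
      ((fun y => (y, s)) ⁻¹' ((fun p : E d × ℝ => p.1 + p.2 • v) ⁻¹' t))
      = μHE[d - 1] (t ∩ hyperplane n (⟪n, v⟫ * s + c)) := by
    intro s
    rw [Measure.restrict_apply (by exact (hm ht).preimage (by fun_prop))]
    rw [← measure_preimage_add_right (μHE[d - 1] : Measure (E d)) (s • v)
      (t ∩ hyperplane n (⟪n, v⟫ * s + c))]
    congr 1
    ext y
    simp only [hyperplane, mem_inter_iff, mem_preimage, mem_ofPred_eq, inner_add_right,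
      inner_smul_right]
    exact and_congr_right fun _ => ⟨fun h => by linarith, fun h => by linarith⟩
  simp_rw [key]
  -- Slices are not sections of a product, but translating each one back to the hyperplane through
  -- the origin makes them so; measurability is then that of sections.
  have hF : Measurable fun x : ℝ => (μHE[d - 1] : Measure (E d)) (t ∩ hyperplane n x) := by
    have h1 : Measurable fun s : ℝ => ((μHE[d - 1] : Measure (E d)).restrict (hyperplane n 0))
      ((fun y => (y, s)) ⁻¹' ((fun p : E d × ℝ => p.1 + p.2 • n) ⁻¹' t)) :=
      measurable_measure_prodMk_right ((by fun_prop : Measurable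
        (fun p : E d × ℝ => p.1 + p.2 • n)) ht)
    convert h1 using 2 with s
    rw [Measure.restrict_apply (((by fun_prop : Measurable
        (fun p : E d × ℝ => p.1 + p.2 • n)) ht).preimage (by fun_prop)),
      ← measure_preimage_add_right (μHE[d - 1] : Measure (E d)) (s • n)
        (t ∩ hyperplane n s)]
    congr 1
    ext y
    simp [hyperplane, inner_add_right, inner_smul_right, hn]
  have hmul := Real.map_volume_mul_left hv
  calc _ = ∫⁻ x, μHE[d - 1] (t ∩ hyperplane n (x + c)) ∂(volume.map (⟪n, v⟫ * ·)) :=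
        (lintegral_map (by exact hF.comp (measurable_add_const c)) (by fun_prop)).symm
    _ = _ := by
      rw [hmul, lintegral_smul_measure,
        lintegral_add_right_eq_self (fun x => μHE[d - 1] (t ∩ hyperplane n x)) c, abs_inv]

theorem lintegral_hyperplane_strip {d : ℕ} {n : E d} (hn : ‖n‖ = 1) (c : ℝ) {v : E d}
    (hv : ⟪n, v⟫ ≠ 0) {f : E d → ℝ≥0∞} (hf : Measurable f) :
    ∫⁻ y in hyperplane n c, (∫⁻ s : ℝ, f (y + s • v)) ∂μHE[d - 1]
      = ENNReal.ofReal |⟪n, v⟫|⁻¹ * ∫⁻ x, f x := by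
  have := Fact.mk hn
  have hm : Measurable (fun p : E d × ℝ => p.1 + p.2 • v) := by fun_prop
  rw [← smul_eq_mul, ← lintegral_smul_measure, ← map_add_smul_hyperplane hn c hv,
    lintegral_map hf hm]
  exact (lintegral_prod _ (hf.comp hm).aemeasurable).symm

/-- Thicken the bounded set by the normal segments s ∈ [-1, 1]: the result stays in a ball of radius
R + 1, of finite volume, and every segment has length at least one. -/
theorem euclideanHausdorffMeasure_hyperplane_lt_top {d : ℕ} {n : E d} (hn : ‖n‖ = 1) (c : ℝ)
    {A : Set (E d)} (hA : Bornology.IsBounded A) (hAH : A ⊆ hyperplane n c) :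
    μHE[d - 1] A < ⊤ := by
  have := Fact.mk hn
  obtain ⟨R, hR⟩ := hA.subset_closedBall 0
  set B := hyperplane n c ∩ Metric.closedBall 0 R
  have hB : MeasurableSet B := (measurableSet_hyperplane n c).inter measurableSet_closedBall
  refine (measure_mono (subset_inter hAH hR)).trans_lt ?_
  have h := lintegral_hyperplane_strip hn c (v := n) (by simp [hn])
    (f := (Metric.closedBall (0 : E d) (R + 1)).indicator 1)
    (measurable_one.indicator measurableSet_closedBall)
  rw [lintegral_indicator_one measurableSet_closedBall] at h
  have h2 : (μHE[d - 1] : Measure (E d)) B * volume (Icc (-1 : ℝ) 1) ≤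
      ∫⁻ y in hyperplane n c, (∫⁻ s : ℝ, (Metric.closedBall (0 : E d) (R + 1)).indicator 1
        (y + s • n)) ∂μHE[d - 1] := by
    calc _ = ∫⁻ y in B, (∫⁻ s in Icc (-1 : ℝ) 1, 1) ∂μHE[d - 1] := by
            simp [mul_comm]
      _ ≤ ∫⁻ y in B, (∫⁻ s : ℝ, (Metric.closedBall (0 : E d) (R + 1)).indicator 1
        (y + s • n)) ∂μHE[d - 1] := by
            refine setLIntegral_mono' hB fun y hy => ?_
            rw [← lintegral_indicator measurableSet_Icc]
            refine lintegral_mono fun s => ?_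
            by_cases hs : s ∈ Icc (-1 : ℝ) 1
            · rw [indicator_of_mem hs, indicator_of_mem]
              · simp
              · have h1 := hy.2
                rw [mem_closedBall_zero_iff] at h1 ⊢
                refine (norm_add_le _ _).trans (add_le_add h1 ?_)
                rw [norm_smul, hn, mul_one]
                exact abs_le.2 hs
            · simp [indicator_of_notMem hs]
      _ ≤ _ := lintegral_mono_set inter_subset_left
  rw [h] at h2
  have h3 : (ENNReal.ofReal |⟪n, n⟫|⁻¹ * volume (Metric.closedBall (0 : E d) (R + 1))) < ⊤ :=
    ENNReal.mul_lt_top ENNReal.ofReal_lt_top measure_closedBall_lt_top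
  refine lt_of_le_of_lt ?_ (h2.trans_lt h3)
  refine le_mul_of_one_le_right' ?_
  rw [Real.volume_Icc]
  norm_num

/-- Orthogonal projection maps the ball into the disc, so the ball lies in the cylinder over the
disc. If the disc were null, the ball would have zero volume. -/
theorem euclideanHausdorffMeasure_hyperplane_pos {d : ℕ} {n x : E d} (hn : ‖n‖ = 1) {r : ℝ}
    (hr : 0 < r) : 0 < μHE[d - 1] (hyperplane n ⟪n, x⟫ ∩ Metric.ball x r) := by
  have := Fact.mk hn
  rw [pos_iff_ne_zero]
  intro h0
  have h := lintegral_hyperplane_strip hn ⟪n, x⟫ (v := n) (by simp [hn])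
    (f := (Metric.ball x r).indicator 1) (measurable_one.indicator measurableSet_ball)
  rw [lintegral_indicator_one measurableSet_ball] at h
  have h1 : (0 : ℝ≥0∞) < ENNReal.ofReal |⟪n, n⟫|⁻¹ * volume (Metric.ball x r) := by
    have := Metric.measure_ball_pos (volume : Measure (E d)) x hr
    simp [hn, this]
  rw [← h] at h1
  refine h1.ne' ?_
  have h2 : ∀ᵐ y ∂((μHE[d - 1] : Measure (E d)).restrict (hyperplane n ⟪n, x⟫)),
      y ∉ Metric.ball x r := by
    rw [← compl_compl (Metric.ball x r), inter_comm] at h0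
    have := (ae_restrict_iff' (μ := (μHE[d - 1] : Measure (E d)))
      (p := fun y => y ∉ Metric.ball x r) (measurableSet_hyperplane n ⟪n, x⟫)).2
    refine this (measure_mono_null (fun y hy => ?_) h0)
    simp only [mem_compl_iff, mem_ofPred_eq, not_forall] at hy
    obtain ⟨h1, h2⟩ := hy
    exact ⟨by simpa using! h2, h1⟩
  rw [← lintegral_zero (μ := (μHE[d - 1] : Measure (E d)).restrict (hyperplane n ⟪n, x⟫))]
  refine lintegral_congr_ae ?_
  filter_upwards [h2, ae_restrict_mem (measurableSet_hyperplane _ _)] with y hy hyH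
  have hyp : ⟪n, y - x⟫ = 0 := by simpa [inner_sub_right, sub_eq_zero] using! hyH
  rw [← lintegral_zero (μ := (volume : Measure ℝ))]
  refine lintegral_congr fun s => indicator_of_notMem (fun hs => hy ?_) _
  rw [mem_ball_iff_norm] at hs ⊢
  refine lt_of_le_of_lt ?_ hs
  have e : y + s • n - x = (y - x) + s • n := by abel
  have h4 : ⟪y - x, s • n⟫ = 0 := by rw [inner_smul_right, real_inner_comm, hyp, mul_zero]
  have := norm_add_sq_eq_norm_sq_add_norm_sq_of_inner_eq_zero _ _ h4
  rw [e]
  nlinarith [norm_nonneg (y - x), norm_nonneg (y - x + s • n), norm_nonneg (s • n)]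

theorem volume_hyperplane {d : ℕ} {n : E d} (hn : ‖n‖ = 1) (c : ℝ) :
    volume (hyperplane n c) = 0 := by
  rw [volume_eq_lintegral_hyperplane hn (measurableSet_hyperplane n c)]
  rw [lintegral_eq_zero_iff' ?_]
  · have : ∀ᵐ x : ℝ, x ≠ c := by simp [ae_iff]
    filter_upwards [this] with x hx
    have : hyperplane n c ∩ hyperplane n x = ∅ := by
      ext y
      simp only [hyperplane, mem_inter_iff, mem_ofPred_eq, mem_empty_iff_false, iff_false, not_and]
      rintro rfl h
      exact hx h.symm
    simp [this]
  · refine (measurable_const.indicator (measurableSet_singleton c) :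
      Measurable (({c} : Set ℝ).indicator fun _ => μHE[d - 1] (hyperplane n c))).aemeasurable.congr
      (Eventually.of_forall fun x => ?_)
    by_cases hx : x = c
    · simp [hx]
    · have : hyperplane n c ∩ hyperplane n x = ∅ := by
        ext y
        simp only [hyperplane, mem_inter_iff, mem_ofPred_eq, mem_empty_iff_false, iff_false, not_and]
        rintro rfl h
        exact hx h.symm
      simp [hx, this]

/-- The cylinder in direction n over this codimension-two set is the whole of `hyperplane b e`,
which has zero volume, whereas each generating line has infinite length. -/
theorem euclideanHausdorffMeasure_inter_hyperplane {d : ℕ} {n b : E d} (hn : ‖n‖ = 1)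
    (hb : ‖b‖ = 1) (hnb : ⟪n, b⟫ = 0) (c e : ℝ) :
    μHE[d - 1] (hyperplane n c ∩ hyperplane b e) = 0 := by
  have h := lintegral_hyperplane_strip hn c (v := n) (by simp [hn])
    (f := (hyperplane b e).indicator 1) (measurable_one.indicator (measurableSet_hyperplane b e))
  rw [lintegral_indicator_one (measurableSet_hyperplane b e), volume_hyperplane hb, mul_zero] at h
  have h2 : ∀ y : E d, ∫⁻ s : ℝ, (hyperplane b e).indicator 1 (y + s • n) =
      (hyperplane b e).indicator (fun _ => (⊤ : ℝ≥0∞)) y := by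
    intro y
    have : ∀ s : ℝ, (y + s • n ∈ hyperplane b e ↔ y ∈ hyperplane b e) := by
      intro s
      simp [hyperplane, inner_add_right, inner_smul_right, real_inner_comm b n ▸ hnb]
    by_cases hy : y ∈ hyperplane b e
    · simp [indicator, this, hy]
    · simp [indicator, this, hy]
  simp_rw [h2] at h
  rw [lintegral_indicator (measurableSet_hyperplane b e)] at h
  rw [lintegral_const, Measure.restrict_restrict (measurableSet_hyperplane b e)] at h
  rw [inter_comm]
  simpa using h

/-! ### Square integrals and the trace inequality for smooth functions -/

theorem sq_lintegral_le {α : Type*} [MeasurableSpace α] (μ : Measure α) {f : α → ℝ≥0∞}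
    (hf : AEMeasurable f μ) : (∫⁻ x, f x ∂μ) ^ 2 ≤ μ univ * ∫⁻ x, f x ^ 2 ∂μ := by
  have h := ENNReal.lintegral_mul_le_Lp_mul_Lq μ Real.HolderConjugate.two_two hf
    (aemeasurable_const (b := (1 : ℝ≥0∞)))
  simp only [Pi.mul_apply, mul_one, ENNReal.one_rpow, lintegral_const, one_mul] at h
  calc _ ≤ ((∫⁻ x, f x ^ (2 : ℝ) ∂μ) ^ (1 / 2 : ℝ) * (μ univ) ^ (1 / 2 : ℝ)) ^ 2 := by gcongr
    _ = _ := by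
      rw [mul_pow, ← ENNReal.rpow_natCast, ← ENNReal.rpow_natCast, ← ENNReal.rpow_mul,
        ← ENNReal.rpow_mul]
      norm_num [mul_comm]

theorem ennreal_add_sq_le (a b : ℝ≥0∞) : (a + b) ^ 2 ≤ 2 * a ^ 2 + 2 * b ^ 2 := by
  wlog h : a ≤ b generalizing a b
  · rw [add_comm a b, add_comm (2 * a ^ 2)]
    exact this b a (le_of_not_ge h)
  obtain ⟨c, rfl⟩ := exists_add_of_le h
  calc (a + (a + c)) ^ 2 ≤ (a + (a + c)) ^ 2 + c ^ 2 := le_self_add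
    _ = _ := by ring

theorem eLpNorm_two_sq {α F : Type*} [MeasurableSpace α] [NormedAddCommGroup F] (μ : Measure α)
    (f : α → F) : eLpNorm f 2 μ ^ 2 = ∫⁻ x, ‖f x‖ₑ ^ 2 ∂μ := by
  have := eLpNorm_nnreal_pow_eq_lintegral (μ := μ) (f := f) (p := 2) (by norm_num)
  simpa using this

theorem tendsto_eLpNorm_two_iff {α F : Type*} [MeasurableSpace α] [NormedAddCommGroup F]
    {μ : Measure α} {ι : Type*} {l : Filter ι} {f : ι → α → F} :
    Tendsto (fun i => eLpNorm (f i) 2 μ) l (𝓝 0) ↔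
      Tendsto (fun i => ∫⁻ x, ‖f i x‖ₑ ^ 2 ∂μ) l (𝓝 0) := by
  simp_rw [← eLpNorm_two_sq]
  constructor
  · intro h
    simpa [Function.comp_def] using (ENNReal.continuous_pow 2).continuousAt.tendsto.comp h
  · intro h
    have h2 := (ENNReal.continuous_rpow_const (y := 1 / 2)).continuousAt.tendsto.comp h
    simp only [Function.comp_def, ← ENNReal.rpow_natCast, ← ENNReal.rpow_mul] at h2
    norm_num at h2
    exact h2

theorem enorm_gradient {d : ℕ} (φ : E d → ℝ) (x : E d) : ‖gradient φ x‖ₑ = ‖fderiv ℝ φ x‖ₑ := by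
  rw [gradient]
  exact (InnerProductSpace.toDual ℝ (E d)).symm.enorm_map _

theorem continuous_gradient {d : ℕ} {φ : E d → ℝ} (hφ : ContDiff ℝ 1 φ) :
    Continuous (gradient φ) :=
  (InnerProductSpace.toDual ℝ (E d)).symm.continuous.comp (hφ.continuous_fderiv one_ne_zero)

theorem inner_gradient {d : ℕ} (φ : E d → ℝ) (x e : E d) :
    ⟪gradient φ x, e⟫ = fderiv ℝ φ x e := by
  simp [gradient]

theorem hasDerivAt_comp_line {d : ℕ} {φ : E d → ℝ} (hφ : ContDiff ℝ 1 φ) (y v : E d) (t : ℝ) :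
    HasDerivAt (fun s : ℝ => φ (y + s • v)) (fderiv ℝ φ (y + t • v) v) t := by
  have h1 : HasDerivAt (fun s : ℝ => y + s • v) v t := by
    simpa using ((hasDerivAt_id t).smul_const v).const_add y
  exact ((hφ.differentiable one_ne_zero (y + t • v)).hasFDerivAt).comp_hasDerivAt t h1

/-- The fundamental theorem of calculus on [0, s], with the gradient integral enlarged to (0, δ) so
that it does not depend on s and the inequality can be averaged over s. -/
theorem enorm_le_enorm_add_lintegral_line {d : ℕ} {φ : E d → ℝ} (hφ : ContDiff ℝ 1 φ)
    (y v : E d) {δ s : ℝ} (hs : s ∈ Ioo 0 δ) :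
    ‖φ y‖ₑ ≤ ‖φ (y + s • v)‖ₑ + ‖v‖ₑ * ∫⁻ t in Ioo 0 δ, ‖gradient φ (y + t • v)‖ₑ := by
  have hc : Continuous fun t : ℝ => fderiv ℝ φ (y + t • v) v := by
    have := hφ.continuous_fderiv one_ne_zero
    fun_prop
  have h := intervalIntegral.integral_eq_sub_of_hasDerivAt
    (fun t _ => hasDerivAt_comp_line hφ y v t) (hc.intervalIntegrable 0 s)
  simp only [zero_smul, add_zero] at h
  have h1 : φ y = φ (y + s • v) - ∫ t in (0 : ℝ)..s, fderiv ℝ φ (y + t • v) v := by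
    rw [h]; ring
  rw [h1]
  refine (enorm_sub_le).trans (add_le_add le_rfl ?_)
  rw [intervalIntegral.integral_of_le hs.1.le, ← lintegral_const_mul' _ _ (by simp)]
  refine (enorm_integral_le_lintegral_enorm _).trans ?_
  refine (lintegral_mono fun t => ?_).trans (lintegral_mono_set (t := Ioo 0 δ)
    (fun t ht => ⟨ht.1, ht.2.trans_lt hs.2⟩))
  rw [enorm_gradient, mul_comm]
  exact ContinuousLinearMap.le_opENorm _ _

/-- Square the previous bound, average it over s ∈ (0, δ), then integrate over `A` with
`lintegral_hyperplane_strip`: the segments issued from `A` sweep a subset of `W` with constant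
Jacobian. The constant depends only on n, v and δ, which is what allows comparison of arbitrary
approximating sequences. -/
theorem exists_lintegral_trace_le {d : ℕ} {n v : E d} (hn : ‖n‖ = 1) (hv : ⟪n, v⟫ ≠ 0) {δ : ℝ}
    (hδ : 0 < δ) : ∃ C : ℝ≥0∞, C ≠ ⊤ ∧ ∀ (c : ℝ) (φ : E d → ℝ) (A W : Set (E d)),
      ContDiff ℝ 1 φ → MeasurableSet A → MeasurableSet W → A ⊆ hyperplane n c →
      (∀ y ∈ A, ∀ s ∈ Ioo 0 δ, y + s • v ∈ W) →
      ∫⁻ y in A, ‖φ y‖ₑ ^ 2 ∂μHE[d - 1] ≤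
        C * ((∫⁻ x in W, ‖φ x‖ₑ ^ 2) + ∫⁻ x in W, ‖gradient φ x‖ₑ ^ 2) := by
  have := Fact.mk hn
  set D : ℝ≥0∞ := ENNReal.ofReal δ with hD
  have hD0 : D ≠ 0 := by simpa [hD] using hδ
  have hDt : D ≠ ⊤ := ENNReal.ofReal_ne_top
  set C1 : ℝ≥0∞ := 2 + 2 * (‖v‖ₑ ^ 2 * D) * D
  refine ⟨D⁻¹ * (C1 * ENNReal.ofReal |⟪n, v⟫|⁻¹), ?_, ?_⟩
  · refine ENNReal.mul_ne_top (by simpa using hD0) (ENNReal.mul_ne_top ?_ ENNReal.ofReal_ne_top)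
    finiteness
  intro c φ A W hφ hA hW hAH hAW
  have hgc := continuous_gradient hφ
  have hφc := hφ.continuous
  set f : E d → ℝ≥0∞ := W.indicator fun x => ‖φ x‖ₑ ^ 2 + ‖gradient φ x‖ₑ ^ 2 with hf
  have hfm : Measurable f :=
    Measurable.indicator (by fun_prop) hW
  have hpt : ∀ y ∈ A, D * ‖φ y‖ₑ ^ 2 ≤ C1 * ∫⁻ s : ℝ, f (y + s • v) := by
    intro y hy
    have hm1 : Measurable fun t : ℝ => ‖gradient φ (y + t • v)‖ₑ :=
      (hgc.comp (by fun_prop)).enorm.measurable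
    have hm2 : Measurable fun t : ℝ => ‖φ (y + t • v)‖ₑ ^ 2 :=
      (hφc.comp (by fun_prop)).enorm.measurable.pow_const 2
    set I2 := ∫⁻ t in Ioo 0 δ, ‖gradient φ (y + t • v)‖ₑ ^ 2
    have hI := sq_lintegral_le (volume.restrict (Ioo 0 δ)) hm1.aemeasurable
    simp only [MeasurableSet.univ, Measure.restrict_apply, univ_inter, Real.volume_Ioo,
      sub_zero, ← hD] at hI
    have hs : ∀ s ∈ Ioo 0 δ, ‖φ y‖ₑ ^ 2 ≤ 2 * ‖φ (y + s • v)‖ₑ ^ 2 +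
        2 * (‖v‖ₑ ^ 2 * D) * I2 := by
      intro s hs
      refine (pow_le_pow_left' (enorm_le_enorm_add_lintegral_line hφ y v hs) 2).trans ?_
      refine (ennreal_add_sq_le _ _).trans (add_le_add le_rfl ?_)
      rw [mul_pow, mul_assoc, mul_assoc]
      gcongr
    have h1 : D * ‖φ y‖ₑ ^ 2 ≤ ∫⁻ s in Ioo 0 δ, (2 * ‖φ (y + s • v)‖ₑ ^ 2 +
        2 * (‖v‖ₑ ^ 2 * D) * I2) := by
      refine le_trans (le_of_eq ?_) (setLIntegral_mono' measurableSet_Ioo hs)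
      simp [hD, mul_comm]
    refine h1.trans ?_
    rw [lintegral_add_right _ measurable_const, lintegral_const_mul _ hm2]
    simp only [lintegral_const, MeasurableSet.univ, Measure.restrict_apply, univ_inter,
      Real.volume_Ioo, sub_zero, ← hD]
    have hle : ∀ g : E d → ℝ≥0∞, (∀ x ∈ W, g x ≤ f x) →
        ∫⁻ s in Ioo 0 δ, g (y + s • v) ≤ ∫⁻ s : ℝ, f (y + s • v) := fun g hg =>
      (setLIntegral_mono' measurableSet_Ioo fun s hs => hg _ (hAW y hy s hs)).trans
        (setLIntegral_le_lintegral _ _)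
    have hle1 := hle (fun x => ‖φ x‖ₑ ^ 2) fun x hx => by simp [hf, hx]
    have hle2 : I2 ≤ _ := hle (fun x => ‖gradient φ x‖ₑ ^ 2) fun x hx => by simp [hf, hx]
    calc _ ≤ 2 * (∫⁻ s : ℝ, f (y + s • v)) +
          2 * (‖v‖ₑ ^ 2 * D) * (∫⁻ s : ℝ, f (y + s • v)) * D := by gcongr
      _ = _ := by ring
  have h2 : D * ∫⁻ y in A, ‖φ y‖ₑ ^ 2 ∂μHE[d - 1] ≤ C1 * (ENNReal.ofReal |⟪n, v⟫|⁻¹ *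
      ∫⁻ x, f x) := by
    rw [← lintegral_hyperplane_strip hn c hv hfm, ← lintegral_const_mul' _ _ hDt,
      ← lintegral_const_mul' _ _ (by finiteness)]
    exact (setLIntegral_mono' hA hpt).trans (lintegral_mono_set hAH)
  rw [hf, lintegral_indicator hW, lintegral_add_left (by fun_prop)] at h2
  rw [mul_assoc, ← ENNReal.div_eq_inv_mul, ENNReal.le_div_iff_mul_le (Or.inl hD0) (Or.inl hDt),
    mul_comm]
  simpa [mul_assoc] using h2

/-! ### Divergence theorem on a half-space -/

/-- In the coordinates y + s e, with y on the hyperplane, the half-space is s < 0, and the integral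
of the derivative along each half-line is χ(y) because of the compact support. -/
theorem integral_halfSpace_fderiv_of_pos {d : ℕ} {n e : E d} (hn : ‖n‖ = 1) (he : 0 < ⟪n, e⟫)
    (c : ℝ) {χ : E d → ℝ} (hχ : ContDiff ℝ 1 χ) (hχc : HasCompactSupport χ) :
    ∫ x in {x | ⟪n, x⟫ < c}, fderiv ℝ χ x e =
      ⟪n, e⟫ * ∫ x in hyperplane n c, χ x ∂μHE[d - 1] := by
  have := Fact.mk hn
  have hS : MeasurableSet {x : E d | ⟪n, x⟫ < c} :=
    measurableSet_lt (by fun_prop) measurable_const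
  have hd : Continuous fun x => fderiv ℝ χ x e := by
    have := hχ.continuous_fderiv one_ne_zero
    fun_prop
  have hint : Integrable fun x => fderiv ℝ χ x e :=
    hd.integrable_of_hasCompactSupport (hχc.fderiv_apply (𝕜 := ℝ) e)
  have hm : Measurable (fun p : E d × ℝ => p.1 + p.2 • e) := by fun_prop
  set g : E d → ℝ := {x | ⟪n, x⟫ < c}.indicator fun x => fderiv ℝ χ x e with hg
  have hgi : Integrable g := hint.indicator hS
  have hmap := map_add_smul_hyperplane hn c he.ne'
  have hgi2 : Integrable g (ENNReal.ofReal |⟪n, e⟫|⁻¹ • volume) :=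
    hgi.smul_measure ENNReal.ofReal_ne_top
  have h1 : ∫ x, g x ∂(ENNReal.ofReal |⟪n, e⟫|⁻¹ • volume) = ⟪n, e⟫⁻¹ * ∫ x, g x := by
    rw [integral_smul_measure, abs_of_pos he, ENNReal.toReal_ofReal (by positivity), smul_eq_mul]
  rw [← hmap] at h1 hgi2
  rw [integral_map hm.aemeasurable hgi2.1] at h1
  rw [integrable_map_measure hgi2.1 hm.aemeasurable] at hgi2
  have h2 := integral_prod _ hgi2
  simp only [Function.comp_def] at h2
  rw [h2] at h1
  rw [← integral_indicator hS, ← hg]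
  have h3 : ∫ y in hyperplane n c, (∫ s : ℝ, g (y + s • e)) ∂μHE[d - 1] =
      ∫ y in hyperplane n c, χ y ∂μHE[d - 1] := by
    refine setIntegral_congr_fun (measurableSet_hyperplane n c) fun y hy => ?_
    have h4 : (fun s : ℝ => g (y + s • e)) =
        (Iio 0).indicator fun s => deriv (fun s : ℝ => χ (y + s • e)) s := by
      ext s
      have hy' : ⟪n, y⟫ = c := hy
      have : (y + s • e ∈ {x : E d | ⟪n, x⟫ < c}) ↔ s ∈ Iio 0 := by
        simp [inner_add_right, inner_smul_right, hy', mul_neg_iff, he, not_lt.2 he.le]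
      by_cases hs : s ∈ Iio (0 : ℝ)
      · rw [hg, indicator_of_mem hs, indicator_of_mem (this.2 hs),
          (hasDerivAt_comp_line hχ y e s).deriv]
      · rw [hg, indicator_of_notMem hs, indicator_of_notMem (mt this.1 hs)]
    simp only [h4]
    rw [integral_indicator measurableSet_Iio, ← integral_Iic_eq_integral_Iio]
    have he0 : e ≠ 0 := by rintro rfl; simp at he
    have hcs : HasCompactSupport fun s : ℝ => χ (y + s • e) := by
      refine hχc.comp_isClosedEmbedding (g := fun s : ℝ => y + s • e) ?_
      exact (Homeomorph.addLeft y).isClosedEmbedding.comp (isClosedEmbedding_smul_left he0)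
    have := hcs.integral_Iic_deriv_eq (by fun_prop) 0
    simpa using this
  rw [h3] at h1
  rw [h1]
  field_simp

theorem integral_halfSpace_fderiv {d : ℕ} {n : E d} (hn : ‖n‖ = 1) (c : ℝ) {χ : E d → ℝ}
    (hχ : ContDiff ℝ 1 χ) (hχc : HasCompactSupport χ) (e : E d) :
    ∫ x in {x | ⟪n, x⟫ < c}, fderiv ℝ χ x e =
      ⟪n, e⟫ * ∫ x in hyperplane n c, χ x ∂μHE[d - 1] := by
  have hint : ∀ e, Integrable fun x => fderiv ℝ χ x e := fun e => by
    have hd : Continuous fun x => fderiv ℝ χ x e := by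
      have := hχ.continuous_fderiv one_ne_zero
      fun_prop
    exact hd.integrable_of_hasCompactSupport (hχc.fderiv_apply (𝕜 := ℝ) e)
  -- With this t both t n and e + t n point strictly out of the half-space; the formula for e is the
  -- difference of theirs.
  set t : ℝ := |⟪n, e⟫| + 1
  have hnn : ⟪n, n⟫ = 1 := by simp [hn]
  have ht : 0 < t := by positivity
  have h1 := integral_halfSpace_fderiv_of_pos hn (e := t • n)
    (by simp [inner_smul_right, hn, ht]) c hχ hχc
  have h2 := integral_halfSpace_fderiv_of_pos hn (e := e + t • n) (by
    rw [inner_add_right, inner_smul_right, hnn]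
    linarith [neg_abs_le ⟪n, e⟫]) c hχ hχc
  simp_rw [map_add] at h2
  rw [integral_add (hint _).integrableOn (hint _).integrableOn, h1, inner_add_right] at h2
  linarith

/-! ### Mollification and smooth approximation in H¹ -/

section Mollification

open scoped Convolution

theorem tendsto_lintegral_translate {d : ℕ} {V : Type*} [NormedAddCommGroup V]
    {h : E d → V} (hh : MemLp h 2 volume) :
    Tendsto (fun z => ∫⁻ x, ‖h (x - z) - h x‖ₑ ^ 2) (𝓝 0) (𝓝 0) := by
  rw [← tendsto_eLpNorm_two_iff]
  have : Fact ((2 : ℝ≥0∞) ≠ ⊤) := ⟨by simp⟩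
  have h1 : Continuous fun z : E d => (DomAddAct.mk (-z)) +ᵥ hh.toLp h :=
    (continuous_vadd.comp (Continuous.prodMk
      (DomAddAct.continuous_mk.comp continuous_neg) continuous_const))
  have h2 := h1.tendsto 0
  simp only [neg_zero, DomAddAct.mk_vadd_toLp, zero_vadd] at h2
  have h3 := (Lp.tendsto_Lp_iff_tendsto_eLpNorm'' _ _ _ _).1 h2
  refine h3.congr fun z => ?_
  congr 1
  ext x
  simp [vadd_eq_add, sub_eq_neg_add]

variable {d : ℕ} {V : Type*} [NormedAddCommGroup V] [NormedSpace ℝ V] [CompleteSpace V]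

/-- The convolution error is the average, for the probability density κ, of the translation errors.
Convexity of the square and Tonelli bound its squared L² norm by the largest translation error over
the support of κ. -/
theorem lintegral_convolution_sub_le {κ : E d → ℝ} (hκ : Continuous κ) (hκc : HasCompactSupport κ)
    (hκ0 : ∀ x, 0 ≤ κ x) (hκ1 : ∫ x, κ x = 1) {h : E d → V} (hh : MemLp h 2 volume) {η : ℝ≥0∞}
    (hη : ∀ t ∈ Function.support κ, ∫⁻ x, ‖h (x - t) - h x‖ₑ ^ 2 ≤ η) :
    ∫⁻ y, ‖(κ ⋆[ContinuousLinearMap.lsmul ℝ ℝ, volume] h) y - h y‖ₑ ^ 2 ≤ η := by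
  have hκi : Integrable κ := hκ.integrable_of_hasCompactSupport hκc
  have hloc : LocallyIntegrable h volume := hh.locallyIntegrable (by norm_num)
  set D : E d → ℝ≥0∞ := fun t => ENNReal.ofReal (κ t) with hD
  have hDm : Measurable D := by fun_prop
  have hD1 : ∫⁻ t, D t = 1 := by
    rw [← ofReal_integral_eq_lintegral_ofReal hκi (Eventually.of_forall hκ0), hκ1,
      ENNReal.ofReal_one]
  have hprod : AEStronglyMeasurable (fun p : E d × E d => h (p.1 - p.2) - h p.1)
      (volume.prod volume) :=
    (hh.1.comp_quasiMeasurePreserving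
      (quasiMeasurePreserving_sub_of_right_invariant volume volume)).sub hh.1.comp_fst
  have hsec : ∀ y : E d, AEStronglyMeasurable (fun t => h (y - t) - h y) volume := fun y =>
    (hh.1.comp_quasiMeasurePreserving
      (quasiMeasurePreserving_sub_left_of_right_invariant volume y)).sub aestronglyMeasurable_const
  have hpt : ∀ y : E d, ‖(κ ⋆[ContinuousLinearMap.lsmul ℝ ℝ, volume] h) y - h y‖ₑ ^ 2 ≤
      ∫⁻ t, D t * ‖h (y - t) - h y‖ₑ ^ 2 := by
    intro y
    have hex : Integrable fun t => κ t • h (y - t) :=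
      hκc.convolutionExists_left (ContinuousLinearMap.lsmul ℝ ℝ) hκ hloc y
    have e1 : (κ ⋆[ContinuousLinearMap.lsmul ℝ ℝ, volume] h) y - h y =
        ∫ t, κ t • (h (y - t) - h y) := by
      simp_rw [smul_sub]
      rw [integral_sub hex (hκi.smul_const _), integral_smul_const, hκ1, one_smul]
      rfl
    rw [e1]
    have e2 : ‖∫ t, κ t • (h (y - t) - h y)‖ₑ ≤
        ∫⁻ t, ‖h (y - t) - h y‖ₑ ∂(volume.withDensity D) := by
      rw [lintegral_withDensity_eq_lintegral_mul₀ hDm.aemeasurable (hsec y).enorm]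
      refine (enorm_integral_le_lintegral_enorm _).trans (le_of_eq (lintegral_congr fun t => ?_))
      rw [enorm_smul, Pi.mul_apply, hD, Real.enorm_of_nonneg (hκ0 t)]
    refine (pow_le_pow_left' e2 2).trans ?_
    refine (sq_lintegral_le _ ((hsec y).enorm.mono_ac
      (withDensity_absolutelyContinuous _ _))).trans ?_
    rw [withDensity_apply _ MeasurableSet.univ, Measure.restrict_univ, hD1, one_mul,
      lintegral_withDensity_eq_lintegral_mul₀ hDm.aemeasurable ((hsec y).enorm.pow_const 2)]
    rfl
  refine (lintegral_mono hpt).trans ?_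
  rw [lintegral_lintegral_swap
    ((hDm.comp measurable_snd).aemeasurable.mul (hprod.enorm.pow_const 2))]
  calc _ ≤ ∫⁻ t, D t * η := by
        refine lintegral_mono fun t => ?_
        rw [lintegral_const_mul' _ _ ENNReal.ofReal_ne_top]
        by_cases ht : κ t = 0
        · simp [hD, ht]
        · exact mul_le_mul_right (hη t ht) _
    _ = η := by rw [lintegral_mul_const _ hDm, hD1, one_mul]

end Mollification

theorem fderiv_comp_const_sub {d : ℕ} {κ : E d → ℝ} (hκ : ContDiff ℝ ∞ κ) (y z : E d) :
    fderiv ℝ (fun z => κ (y - z)) z = - fderiv ℝ κ (y - z) := by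
  have h1 : HasFDerivAt (fun z => κ (y - z)) ((fderiv ℝ κ (y - z)).comp
      (-ContinuousLinearMap.id ℝ (E d))) z :=
    ((hκ.differentiable (by simp) (y - z)).hasFDerivAt).comp z
      ((hasFDerivAt_id z).const_sub y)
  rw [h1.fderiv]
  ext
  simp

-- Extending w by zero destroys its H¹ regularity across the boundary of S. At a point y whose
-- sampling set stays in S, however, z ↦ κ(y - z) is a test function in S, and the definition of the
-- weak gradient applies to it.
open scoped Convolution in
theorem gradient_convolution_eq {d : ℕ} {S : Set (E d)} (hS : MeasurableSet S)
    {w : E d → ℝ} {G : E d → E d}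
    (hwl : LocallyIntegrable (S.indicator w) volume) (hGl : LocallyIntegrable (S.indicator G) volume)
    (hG : HasWeakGradient S w G) {κ : E d → ℝ} (hκ : ContDiff ℝ ∞ κ) (hκc : HasCompactSupport κ)
    {y : E d} (hy : ∀ t ∈ tsupport κ, y - t ∈ S) :
    gradient (κ ⋆[ContinuousLinearMap.lsmul ℝ ℝ, volume] S.indicator w) y =
      (κ ⋆[ContinuousLinearMap.lsmul ℝ ℝ, volume] S.indicator G) y := by
  have hκ1 : ContDiff ℝ 1 κ := hκ.of_le (by simp)
  refine ext_inner_right ℝ fun e => ?_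
  have hex : ConvolutionExistsAt κ (S.indicator G) y (ContinuousLinearMap.lsmul ℝ ℝ) volume :=
    hκc.convolutionExists_left (ContinuousLinearMap.lsmul ℝ ℝ) hκ.continuous hGl y
  have hdc : HasCompactSupport (fderiv ℝ κ) := hκc.fderiv ℝ
  have hcd : Continuous (fderiv ℝ κ) := hκ1.continuous_fderiv one_ne_zero
  have hex2 : ConvolutionExistsAt (fderiv ℝ κ) (S.indicator w) y
      ((ContinuousLinearMap.lsmul ℝ ℝ).precompL (E d)) volume :=
    hdc.convolutionExists_left _ hcd hwl y
  rw [inner_gradient, (hκc.hasFDerivAt_convolution_left (ContinuousLinearMap.lsmul ℝ ℝ) hκ1 hwl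
    y).fderiv, convolution_def, ContinuousLinearMap.integral_apply hex2]
  have htest : IsTestFunction S fun z => κ (y - z) := by
    have hcs : HasCompactSupport fun z => κ (y - z) :=
      hκc.comp_homeomorph (Homeomorph.subLeft y)
    refine ⟨hκ.comp (contDiff_const.sub contDiff_id), hcs, ?_⟩
    intro z hz
    have : y - z ∈ tsupport κ :=
      tsupport_comp_subset_preimage κ (f := fun z => y - z) (by fun_prop) hz
    simpa using hy _ this
  have key := hG.2.2 _ htest
  have hGi : Integrable fun t => κ t • S.indicator G (y - t) := hex
  have hGi' : Integrable (fun z => κ (y - z) • G z) (volume.restrict S) := by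
    have := (integrable_comp_sub_left (fun t => κ t • S.indicator G (y - t)) y).2 hGi
    simp only [sub_sub_cancel] at this
    refine (integrable_indicator_iff hS).1 ?_
    refine this.congr (Eventually.of_forall fun z => ?_)
    by_cases hz : z ∈ S <;> simp [hz]
  have hwi : Integrable fun t => (((ContinuousLinearMap.lsmul ℝ ℝ).precompL (E d))
      (fderiv ℝ κ t)) (S.indicator w (y - t)) := hex2
  have hgi' : Integrable (fun z => w z • gradient (fun z => κ (y - z)) z) (volume.restrict S) := by
    have h2 := (integrable_comp_sub_left _ y).2 hwi
    simp only [sub_sub_cancel] at h2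
    refine (integrable_indicator_iff hS).1 ?_
    have hcg : Continuous (gradient fun z => κ (y - z)) :=
      continuous_gradient (htest.1.of_le (by simp))
    have e1 : S.indicator (fun z => w z • gradient (fun z => κ (y - z)) z) =
        fun z => S.indicator w z • gradient (fun z => κ (y - z)) z := by
      ext1 z
      by_cases hz : z ∈ S <;> simp [hz]
    rw [e1]
    refine h2.mono (hwl.aestronglyMeasurable.smul hcg.aestronglyMeasurable)
      (Eventually.of_forall fun z => ?_)
    have e2 : (((ContinuousLinearMap.lsmul ℝ ℝ).precompL (E d)) (fderiv ℝ κ (y - z)))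
        (S.indicator w z) = S.indicator w z • fderiv ℝ κ (y - z) := by
      ext e
      simp [mul_comm]
    rw [e2, norm_smul, norm_smul, gradient, LinearIsometryEquiv.norm_map,
      fderiv_comp_const_sub hκ, norm_neg]
  have k2 := congrArg (fun v => ⟪v, e⟫) key
  simp only [inner_neg_left] at k2
  rw [real_inner_comm, ← integral_inner hgi', real_inner_comm, ← integral_inner hGi'] at k2
  have e3 : ⟪(κ ⋆[ContinuousLinearMap.lsmul ℝ ℝ, volume] S.indicator G) y, e⟫ =
      ∫ t, ⟪e, κ t • S.indicator G (y - t)⟫ := by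
    rw [integral_inner hGi, real_inner_comm]
    rfl
  rw [e3]
  rw [← integral_sub_left_eq_self _ volume y, ← integral_sub_left_eq_self (fun t => ⟪e, _⟫) volume y]
  simp only [sub_sub_cancel]
  have k3 : ∀ z, ((((ContinuousLinearMap.lsmul ℝ ℝ).precompL (E d)) (fderiv ℝ κ (y - z)))
      (S.indicator w z)) e = - S.indicator (fun z => ⟪e, w z • gradient (fun z => κ (y - z)) z⟫) z := by
    intro z
    by_cases hz : z ∈ S
    · simp [hz, inner_smul_right, fderiv_comp_const_sub hκ, mul_comm]
    · simp [hz]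
  have k4 : ∀ z, ⟪e, κ (y - z) • S.indicator G z⟫ =
      S.indicator (fun z => ⟪e, κ (y - z) • G z⟫) z := by
    intro z
    by_cases hz : z ∈ S <;> simp [hz]
  simp_rw [k3, k4]
  rw [integral_neg, integral_indicator hS, integral_indicator hS, k2, neg_neg]

open scoped Convolution in
/-- Meyers–Serrin type approximation: if small translates of `W` in directions near `v` stay in
`S`, then functions of `H¹(S)` are limits in `H¹(W)` of smooth functions on the whole space. -/
theorem exists_smooth_tendstoH1 {d : ℕ} {S W : Set (E d)} (hS : MeasurableSet S)
    (hW : MeasurableSet W) (hWS : W ⊆ S) {w : E d → ℝ} {G : E d → E d}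
    (hw : MemLp w 2 (volume.restrict S)) (hGm : MemLp G 2 (volume.restrict S))
    (hG : HasWeakGradient S w G) {v : E d} {ρ : ℝ} (hρ : 0 < ρ)
    (hdir : ∀ y ∈ W, ∀ z ∈ Metric.ball v ρ, ∀ s ∈ Ioc (0 : ℝ) 1, y + s • z ∈ S) :
    ∃ φ : ℕ → E d → ℝ, (∀ k, ContDiff ℝ ∞ (φ k)) ∧ TendstoH1 W φ w G := by
  have hwL : MemLp (S.indicator w) 2 volume := (memLp_indicator_iff_restrict hS).2 hw
  have hGL : MemLp (S.indicator G) 2 volume := (memLp_indicator_iff_restrict hS).2 hGm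
  have hwl : LocallyIntegrable (S.indicator w) volume := hwL.locallyIntegrable (by norm_num)
  have hGl : LocallyIntegrable (S.indicator G) volume := hGL.locallyIntegrable (by norm_num)
  set ε : ℕ → ℝ := fun k => 1 / ((k : ℝ) + 1) with hε
  have hε0 : ∀ k, 0 < ε k := fun k => by positivity
  have hε1 : ∀ k, ε k ≤ 1 := fun k => by
    rw [hε]; simp only
    rw [div_le_one (by positivity)]
    linarith [(Nat.cast_nonneg k : (0 : ℝ) ≤ k)]
  have hεt : Tendsto ε atTop (𝓝 0) := tendsto_one_div_add_atTop_nhds_zero_nat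
  -- The kernel is centred at -ε v, so that the convolution at y samples the points y + ε z with z
  -- close to v, which `hdir` places inside S. The outer radius ε ρ / 2 keeps z within the ball of
  -- radius ρ around v.
  let b : ∀ k, ContDiffBump (-(ε k • v)) := fun k =>
    ⟨ε k * (ρ / 4), ε k * (ρ / 2), by have := hε0 k; positivity,
      by have := hε0 k; nlinarith [mul_pos this hρ]⟩
  set κ : ℕ → E d → ℝ := fun k => (b k).normed volume with hκdef
  have hκs : ∀ k, ContDiff ℝ ∞ (κ k) := fun k => (b k).contDiff_normed
  have hκc : ∀ k, HasCompactSupport (κ k) := fun k => (b k).hasCompactSupport_normed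
  have hκt : ∀ k, tsupport (κ k) = Metric.closedBall (-(ε k • v)) (ε k * (ρ / 2)) := fun k =>
    (b k).tsupport_normed_eq
  have hconv : ∀ {V : Type} [NormedAddCommGroup V] [NormedSpace ℝ V] [CompleteSpace V]
      (h : E d → V), MemLp h 2 volume → Tendsto (fun k => ∫⁻ y,
        ‖(κ k ⋆[ContinuousLinearMap.lsmul ℝ ℝ, volume] h) y - h y‖ₑ ^ 2) atTop (𝓝 0) := by
    intro V _ _ _ h hh
    rw [ENNReal.tendsto_nhds_zero]
    intro η hη
    have h1 := (ENNReal.tendsto_nhds_zero.1 (tendsto_lintegral_translate hh)) η hη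
    obtain ⟨r, hr, hr'⟩ := Metric.eventually_nhds_iff.1 h1
    have h2 : Tendsto (fun k => ε k * (‖v‖ + ρ)) atTop (𝓝 0) := by
      simpa using hεt.mul_const (‖v‖ + ρ)
    filter_upwards [h2.eventually (gt_mem_nhds hr)] with k hk
    refine lintegral_convolution_sub_le (hκs k).continuous (hκc k)
      (fun x => (b k).nonneg_normed x) (b k).integral_normed hh fun t ht => hr' ?_
    have ht' : t ∈ Metric.closedBall (-(ε k • v)) (ε k * (ρ / 2)) :=
      hκt k ▸ subset_tsupport _ ht
    rw [mem_closedBall_iff_norm] at ht'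
    rw [dist_zero_right]
    have e : t = (t - -(ε k • v)) + -(ε k • v) := by abel
    rw [e]
    refine (norm_add_le _ _).trans_lt (lt_of_le_of_lt ?_ hk)
    rw [norm_neg, norm_smul, Real.norm_of_nonneg (hε0 k).le]
    nlinarith [mul_pos (hε0 k) hρ]
  refine ⟨fun k => κ k ⋆[ContinuousLinearMap.lsmul ℝ ℝ, volume] S.indicator w, fun k =>
    (hκc k).contDiff_convolution_left _ (hκs k) hwl, ?_, ?_⟩
  · rw [tendsto_eLpNorm_two_iff]
    refine tendsto_of_tendsto_of_tendsto_of_le_of_le tendsto_const_nhds (hconv _ hwL)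
      (fun k => bot_le) fun k => ?_
    refine le_trans (le_of_eq ?_) (setLIntegral_le_lintegral W _)
    refine setLIntegral_congr_fun hW fun y hy => ?_
    simp only [indicator_of_mem (hWS hy)]
  · rw [tendsto_eLpNorm_two_iff]
    refine tendsto_of_tendsto_of_tendsto_of_le_of_le tendsto_const_nhds (hconv _ hGL)
      (fun k => bot_le) fun k => ?_
    refine le_trans (le_of_eq ?_) (setLIntegral_le_lintegral W _)
    refine setLIntegral_congr_fun hW fun y hy => ?_
    simp only
    rw [gradient_convolution_eq hS hwl hGl hG (hκs k) (hκc k), indicator_of_mem (hWS hy)]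
    intro t ht
    rw [hκt k, mem_closedBall_iff_norm] at ht
    have h3 := hdir y hy (-((ε k)⁻¹ • t)) ?_ (ε k) ⟨hε0 k, hε1 k⟩
    · rwa [smul_neg, smul_inv_smul₀ (hε0 k).ne', ← sub_eq_add_neg] at h3
    · rw [mem_ball_iff_norm]
      have e : -((ε k)⁻¹ • t) - v = -((ε k)⁻¹ • (t - -(ε k • v))) := by
        rw [smul_sub, smul_neg, inv_smul_smul₀ (hε0 k).ne']; abel
      rw [e, norm_neg, norm_smul, norm_inv, Real.norm_of_nonneg (hε0 k).le,
        inv_mul_lt_iff₀ (hε0 k)]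
      nlinarith [mul_pos (hε0 k) hρ]

/-! ### Weak gradients and test functions -/

/-- `weakGrad` is an arbitrary choice; uniqueness makes it interchangeable with any other weak
gradient, in particular with the restriction of the weak gradient on a larger open set. -/
theorem HasWeakGradient.ae_eq {d : ℕ} {S : Set (E d)} (hS : IsOpen S) {w : E d → ℝ}
    {G G' : E d → E d} (h : HasWeakGradient S w G) (h' : HasWeakGradient S w G') :
    G =ᵐ[volume.restrict S] G' := by
  have h1 : ∀ᵐ x, x ∈ S → (G - G') x = 0 := by
    refine hS.ae_eq_zero_of_integral_contDiff_smul_eq_zero (h.2.1.sub h'.2.1) ?_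
    intro φ hφ hφc hφS
    have e1 := h.2.2 φ ⟨hφ, hφc, hφS⟩
    rw [h'.2.2 φ ⟨hφ, hφc, hφS⟩, neg_inj] at e1
    have hi : ∀ {H : E d → E d}, LocallyIntegrableOn H S → IntegrableOn (fun x => φ x • H x) S := by
      intro H hH
      have hk : IntegrableOn H (tsupport φ) := hH.integrableOn_compact_subset hφS hφc
      have h2 : IntegrableOn (fun x => φ x • H x) (tsupport φ) :=
        hk.continuousOn_smul hφ.continuous.continuousOn hφc
      exact h2.of_forall_sdiff_eq_zero hS.measurableSet fun x hx => by
        rw [image_eq_zero_of_notMem_tsupport hx.2, zero_smul]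
    have hz : ∀ x, x ∉ S → φ x • (G - G') x = 0 := fun x hx => by
      rw [image_eq_zero_of_notMem_tsupport (fun h => hx (hφS h)), zero_smul]
    rw [← setIntegral_eq_integral_of_forall_compl_eq_zero hz]
    simp only [Pi.sub_apply, smul_sub]
    rw [integral_sub (hi h.2.1) (hi h'.2.1), e1, sub_self]
  rw [EventuallyEq, ae_restrict_iff' hS.measurableSet]
  filter_upwards [h1] with x hx hxS
  simpa [sub_eq_zero] using hx hxS

theorem hasWeakGradient_weakGrad {d : ℕ} {S : Set (E d)} {w : E d → ℝ}
    (h : ∃ G, HasWeakGradient S w G) : HasWeakGradient S w (weakGrad S w) := by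
  rw [weakGrad, dif_pos h]
  exact h.choose_spec

theorem MemH1.hasWeakGradient {d : ℕ} {S : Set (E d)} {w : E d → ℝ} (h : MemH1 S w) :
    HasWeakGradient S w (weakGrad S w) :=
  hasWeakGradient_weakGrad (h.2.imp fun _ hG => hG.1)

theorem MemH1.memLp_weakGrad {d : ℕ} {S : Set (E d)} (hS : IsOpen S) {w : E d → ℝ}
    (h : MemH1 S w) : MemLp (weakGrad S w) 2 (volume.restrict S) := by
  obtain ⟨G, hG, hGL⟩ := h.2
  exact hGL.ae_eq (hG.ae_eq hS h.hasWeakGradient)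

theorem HasWeakGradient.mono {d : ℕ} {S T : Set (E d)} (hTS : T ⊆ S) {w : E d → ℝ}
    {G : E d → E d} (h : HasWeakGradient S w G) : HasWeakGradient T w G := by
  refine ⟨h.1.mono_set hTS, h.2.1.mono_set hTS, fun φ hφ => ?_⟩
  have key := h.2.2 φ ⟨hφ.1, hφ.2.1, hφ.2.2.trans hTS⟩
  have hz : ∀ x, x ∉ T → φ x = 0 ∧ gradient φ x = 0 := fun x hx => by
    have hx' : x ∉ tsupport φ := fun h => hx (hφ.2.2 h)
    refine ⟨image_eq_zero_of_notMem_tsupport hx', ?_⟩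
    have : fderiv ℝ φ x = 0 := image_eq_zero_of_notMem_tsupport
      (fun h => hx' (tsupport_fderiv_subset ℝ h))
    simp [gradient, this]
  have e : ∀ {H : E d → E d}, (∀ x, x ∉ T → H x = 0) → ∫ x in S, H x = ∫ x in T, H x := by
    intro H hH
    rw [setIntegral_eq_integral_of_forall_compl_eq_zero hH,
      setIntegral_eq_integral_of_forall_compl_eq_zero fun x hx => hH x fun h => hx (hTS h)]
  rwa [e fun x hx => by simp [(hz x hx).2], e fun x hx => by simp [(hz x hx).1]] at key

theorem fderiv_eq_zero_of_notMem_tsupport {d : ℕ} {φ : E d → ℝ} {x : E d} (hx : x ∉ tsupport φ) :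
    fderiv ℝ φ x = 0 :=
  image_eq_zero_of_notMem_tsupport (fun h => hx (tsupport_fderiv_subset ℝ h))

theorem gradient_eq_zero_of_notMem_tsupport {d : ℕ} {φ : E d → ℝ} {x : E d} (hx : x ∉ tsupport φ) :
    gradient φ x = 0 := by
  simp [gradient, fderiv_eq_zero_of_notMem_tsupport hx]

theorem IsTestFunction.integrable_mul {d : ℕ} {φ : E d → ℝ} {S : Set (E d)}
    (hφ : IsTestFunction S φ) {g : E d → ℝ} (hg : Continuous g) :
    Integrable fun x => φ x * g x :=
  (hφ.1.continuous.mul hg).integrable_of_hasCompactSupport hφ.2.1.mul_right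

theorem IsTestFunction.continuous_fderiv_apply {d : ℕ} {φ : E d → ℝ} (hφ : ContDiff ℝ ∞ φ)
    (e : E d) : Continuous fun x => fderiv ℝ φ x e := by
  have := (hφ.of_le (m := 1) (by simp)).continuous_fderiv one_ne_zero
  fun_prop

theorem IsTestFunction.memLp {d : ℕ} {φ : E d → ℝ} {S : Set (E d)}
    (hφ : IsTestFunction S φ) (μ : Measure (E d)) [IsFiniteMeasureOnCompacts μ] : MemLp φ 2 μ :=
  hφ.1.continuous.memLp_of_hasCompactSupport hφ.2.1

theorem IsTestFunction.memLp_gradient {d : ℕ} {φ : E d → ℝ} {S : Set (E d)}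
    (hφ : IsTestFunction S φ) (μ : Measure (E d)) [IsFiniteMeasureOnCompacts μ] :
    MemLp (gradient φ) 2 μ := by
  refine (continuous_gradient (hφ.1.of_le (by simp))).memLp_of_hasCompactSupport ?_
  exact HasCompactSupport.intro hφ.2.1 fun x hx => gradient_eq_zero_of_notMem_tsupport hx

theorem IsTestFunction.memLp_fderiv {d : ℕ} {φ : E d → ℝ} {S : Set (E d)}
    (hφ : IsTestFunction S φ) (μ : Measure (E d)) [IsFiniteMeasureOnCompacts μ] (e : E d) :
    MemLp (fun x => fderiv ℝ φ x e) 2 μ := by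
  refine (IsTestFunction.continuous_fderiv_apply hφ.1 e).memLp_of_hasCompactSupport ?_
  exact hφ.2.1.fderiv_apply (𝕜 := ℝ) e

theorem inner_gradient' {d : ℕ} (φ : E d → ℝ) (x e : E d) :
    ⟪e, gradient φ x⟫ = fderiv ℝ φ x e := by
  rw [real_inner_comm, inner_gradient]

/-- The defining relation of the weak gradient, in a fixed direction. -/
theorem HasWeakGradient.integral_mul_fderiv {d : ℕ} {S : Set (E d)} {w : E d → ℝ}
    {G : E d → E d} (h : HasWeakGradient S w G) (hw : MemLp w 2 (volume.restrict S))
    (hG : MemLp G 2 (volume.restrict S)) {φ : E d → ℝ} (hφ : IsTestFunction S φ) (e : E d) :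
    ∫ x in S, w x * fderiv ℝ φ x e = - ∫ x in S, φ x * ⟪G x, e⟫ := by
  have hi1 : Integrable (fun x => w x • gradient φ x) (volume.restrict S) :=
    memLp_one_iff_integrable.1 ((hφ.memLp_gradient (volume.restrict S)).smul hw)
  have hi2 : Integrable (fun x => φ x • G x) (volume.restrict S) :=
    memLp_one_iff_integrable.1 (hG.smul (hφ.memLp (volume.restrict S)))
  have k := congrArg (fun v => ⟪v, e⟫) (h.2.2 φ hφ)
  simp only [inner_neg_left] at k
  rw [real_inner_comm, ← integral_inner hi1, real_inner_comm, ← integral_inner hi2] at k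
  simpa only [inner_smul_right, inner_gradient', real_inner_comm e] using k

theorem hasWeakGradient_of_isTestFunction {d : ℕ} (S : Set (E d)) {R : Set (E d)}
    {u : E d → ℝ} (hu : IsTestFunction R u) : HasWeakGradient S u (gradient u) := by
  refine ⟨hu.1.continuous.locallyIntegrable.locallyIntegrableOn _,
    (continuous_gradient (hu.1.of_le (by simp))).locallyIntegrable.locallyIntegrableOn _,
    fun φ hφ => ?_⟩
  have hi1 : Integrable (fun x => u x • gradient φ x) :=
    memLp_one_iff_integrable.1 ((hφ.memLp_gradient volume).smul (hu.memLp volume))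
  have hi2 : Integrable (fun x => φ x • gradient u x) :=
    memLp_one_iff_integrable.1 ((hu.memLp_gradient volume).smul (hφ.memLp volume))
  rw [setIntegral_eq_integral_of_forall_compl_eq_zero fun x hx => by
      rw [gradient_eq_zero_of_notMem_tsupport fun h => hx (hφ.2.2 h), smul_zero],
    setIntegral_eq_integral_of_forall_compl_eq_zero fun x hx => by
      rw [image_eq_zero_of_notMem_tsupport fun h => hx (hφ.2.2 h), zero_smul]]
  refine ext_inner_left ℝ fun e => ?_
  rw [inner_neg_right, ← integral_inner hi1, ← integral_inner hi2]
  have hu1 := IsTestFunction.continuous_fderiv_apply hu.1 e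
  have hφ1 := IsTestFunction.continuous_fderiv_apply hφ.1 e
  have := integral_mul_fderiv_eq_neg_fderiv_mul_of_integrable (μ := (volume : Measure (E d)))
    (f := u) (g := φ) (v := e)
    (by simpa only [mul_comm] using hφ.integrable_mul hu1) (hu.integrable_mul hφ1)
    (hu.integrable_mul hφ.1.continuous) (fun x _ => hu.1.differentiable (by simp) x)
    (fun x _ => hφ.1.differentiable (by simp) x)
  simp only [inner_smul_right, inner_gradient']
  rw [this]
  simp only [mul_comm]

/-- Makes test functions admissible in the weak formulation, with their classical gradient; the
approximating sequence is constant. -/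
theorem IsTestFunction.memH10 {d : ℕ} {S : Set (E d)} (hS : IsOpen S) {φ : E d → ℝ}
    (hφ : IsTestFunction S φ) :
    MemH10 S φ ∧ weakGrad S φ =ᵐ[volume.restrict S] gradient φ := by
  have hg := hasWeakGradient_of_isTestFunction S hφ
  have h1 : MemH1 S φ := ⟨hφ.memLp _, _, hg, hφ.memLp_gradient _⟩
  have hae := h1.hasWeakGradient.ae_eq hS hg
  refine ⟨⟨h1, fun _ => φ, fun _ => hφ, ?_, ?_⟩, hae⟩
  · simp
  · have : eLpNorm (fun x => gradient φ x - weakGrad S φ x) 2 (volume.restrict S) = 0 := by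
      rw [← eLpNorm_zero (p := 2) (μ := volume.restrict S) (α := E d) (ε := E d)]
      refine eLpNorm_congr_ae ?_
      filter_upwards [hae] with x hx
      simp [hx]
    simp [this]

theorem tendsto_integral_mul_of_tendsto_eLpNorm {α : Type*} [MeasurableSpace α] {μ : Measure α}
    {f : ℕ → α → ℝ} {g b : α → ℝ} (hf : ∀ k, MemLp (f k) 2 μ) (hg : MemLp g 2 μ) (hb : MemLp b 2 μ)
    (h : Tendsto (fun k => eLpNorm (fun x => f k x - g x) 2 μ) atTop (𝓝 0)) :
    Tendsto (fun k => ∫ x, f k x * b x ∂μ) atTop (𝓝 (∫ x, g x * b x ∂μ)) := by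
  refine tendsto_integral_of_L1' _ (hg.integrable_mul hb).1
    (Eventually.of_forall fun k => (hf k).integrable_mul hb) ?_
  have h1 : ∀ k, eLpNorm ((fun x => f k x * b x) - fun x => g x * b x) 1 μ ≤
      eLpNorm (fun x => f k x - g x) 2 μ * eLpNorm b 2 μ := by
    intro k
    have := eLpNorm_smul_le_mul_eLpNorm (p := 2) (q := 2) (r := 1) hb.1 ((hf k).sub hg).1
    refine le_trans (le_of_eq ?_) this
    congr 1
    ext x
    simp [sub_mul]
  refine tendsto_of_tendsto_of_tendsto_of_le_of_le tendsto_const_nhds ?_ (fun _ => bot_le) h1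
  have := ENNReal.Tendsto.mul_const h (Or.inr hb.eLpNorm_lt_top.ne)
  simpa using this

/-! ### Entering a polytope from its closure -/

theorem IsPolyhedron.convex {d : ℕ} {P : Set (E d)} (hP : IsPolyhedron P) : Convex ℝ P := by
  obtain ⟨s, rfl⟩ := hP
  simp only [ofPred_forall]
  exact convex_iInter₂ fun p _ => convex_halfSpace_le (innerSL ℝ p.1).isLinear _

theorem IsPolyhedron.isClosed {d : ℕ} {P : Set (E d)} (hP : IsPolyhedron P) : IsClosed P := by
  obtain ⟨s, rfl⟩ := hP
  simp only [ofPred_forall]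
  exact isClosed_biInter fun p _ => isClosed_le (by fun_prop) continuous_const

theorem IsPolytope.isOpen {d : ℕ} {S : Set (E d)} (hS : IsPolytope S) : IsOpen S := by
  obtain ⟨-, Q, -, -, rfl⟩ := hS
  exact isOpen_interior

/-- A set `A` from which one can enter the open set `S` along the directions close to a fixed
vector, staying for a short while in a set `W` which has the same property. -/
def IsInwardPiece {d : ℕ} (S A : Set (E d)) : Prop :=
  MeasurableSet A ∧ ∃ (W : Set (E d)) (v : E d) (δ ρ : ℝ), MeasurableSet W ∧ W ⊆ S ∧ 0 < δ ∧
    0 < ρ ∧ (∀ y ∈ A, ∀ s ∈ Ioo 0 δ, y + s • v ∈ W) ∧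
    ∀ y ∈ W, ∀ z ∈ Metric.ball v ρ, ∀ s ∈ Ioc (0 : ℝ) 1, y + s • z ∈ S

/-- A convex set is star-shaped about each ball it contains. From y within 2r of p, a vector z
within r of x₀ - p leads to a point within 3r of x₀, hence to an interior point; by convexity the
whole segment, except possibly y, is interior. -/
theorem isInwardPiece_inter_ball {d : ℕ} {S P : Set (E d)} (hP : Convex ℝ P)
    (hPm : MeasurableSet P) (hPS : interior P ⊆ S) {x₀ : E d} {r : ℝ} (hr : 0 < r)
    (hx₀ : Metric.ball x₀ (3 * r) ⊆ P) (p : E d) : IsInwardPiece S (P ∩ Metric.ball p r) := by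
  have hint : Metric.ball x₀ (3 * r) ⊆ interior P := interior_maximal hx₀ Metric.isOpen_ball
  have key : ∀ y ∈ P, y ∈ Metric.ball p (2 * r) → ∀ z ∈ Metric.ball (x₀ - p) r,
      ∀ s ∈ Ioc (0 : ℝ) 1, y + s • z ∈ interior P := by
    intro y hy hyp z hz s hs
    have h1 : y + z ∈ interior P := by
      refine hint ?_
      rw [mem_ball_iff_norm] at hyp hz ⊢
      have e : y + z - x₀ = (y - p) + (z - (x₀ - p)) := by abel
      rw [e]
      refine (norm_add_le _ _).trans_lt ?_
      linarith
    have h2 := hP.combo_self_interior_mem_interior hy h1 (a := 1 - s) (b := s) (by linarith [hs.2])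
      hs.1 (by ring)
    convert h2 using 1
    module
  -- Short enough for a segment starting in the ball of radius r around p to remain in the ball of
  -- radius 2r, where the cone of directions is still usable.
  set δ : ℝ := min 1 (r / (‖x₀ - p‖ + 1)) with hδ
  have hv0 : 0 < ‖x₀ - p‖ + 1 := by positivity
  refine ⟨hPm.inter measurableSet_ball, interior P ∩ Metric.ball p (2 * r), x₀ - p, δ, r,
    isOpen_interior.measurableSet.inter measurableSet_ball, inter_subset_left.trans hPS,
    lt_min one_pos (by positivity), hr, ?_, ?_⟩
  · rintro y ⟨hy, hyp⟩ s ⟨hs0, hs1⟩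
    refine ⟨key y hy (Metric.ball_subset_ball (by linarith) hyp) _ (Metric.mem_ball_self hr) s
      ⟨hs0, hs1.le.trans (min_le_left _ _)⟩, ?_⟩
    rw [mem_ball_iff_norm] at hyp ⊢
    have e : y + s • (x₀ - p) - p = (y - p) + s • (x₀ - p) := by abel
    have h3 : s * (‖x₀ - p‖ + 1) < r := by
      rw [← lt_div_iff₀ hv0]
      exact hs1.trans_le (min_le_right _ _)
    rw [e]
    refine (norm_add_le _ _).trans_lt ?_
    rw [norm_smul, Real.norm_of_nonneg hs0.le]
    linarith
  · rintro y ⟨hy, hyp⟩ z hz s hs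
    exact hPS (key y (interior_subset hy) hyp z hz s hs)

theorem interior_sUnion_eq_empty {X : Type*} [TopologicalSpace X] {Q : Set (Set X)}
    (hQ : Q.Finite) (hc : ∀ P ∈ Q, IsClosed P) (he : ∀ P ∈ Q, interior P = ∅) :
    interior (⋃₀ Q) = ∅ := by
  induction Q, hQ using Set.Finite.induction_on with
  | empty => simp
  | @insert P Q _ _ ih =>
    rw [sUnion_insert, interior_union_isClosed_of_interior_empty (hc P (mem_insert _ _))
      (ih (fun R hR => hc R (mem_insert_of_mem _ hR)) fun R hR => he R (mem_insert_of_mem _ hR))]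
    exact he P (mem_insert _ _)

/-- Polyhedra with empty interior can be discarded: a point of S outside all the others would be
interior to a finite union of closed sets with empty interior. Each remaining polyhedron is convex
with interior points, and a finite cover of the compact closure of S by small balls cuts it into
inward pieces. -/
theorem IsPolytope.exists_inwardPieces {d : ℕ} {S : Set (E d)} (hS : IsPolytope S) :
    ∃ 𝒜 : Set (Set (E d)), 𝒜.Finite ∧ closure S ⊆ ⋃₀ 𝒜 ∧ ∀ A ∈ 𝒜, IsInwardPiece S A := by
  obtain ⟨hb, Q, hQ, hQp, hSQ⟩ := hS
  set Q' := {P ∈ Q | (interior P).Nonempty}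
  have hQ' : Q'.Finite := hQ.subset (sep_subset _ _)
  have hcl : IsClosed (⋃₀ Q') := sUnion_eq_biUnion ▸ hQ'.isClosed_biUnion fun P hP => (hQp P hP.1).isClosed
  have hcov : closure S ⊆ ⋃₀ Q' := by
    refine closure_minimal (fun x hx => ?_) hcl
    by_contra hxU
    have hN := interior_sUnion_eq_empty (Q := Q \ Q') (hQ.subset sdiff_subset)
      (fun P hP => (hQp P hP.1).isClosed) fun P hP => by
        by_contra h
        exact hP.2 ⟨hP.1, nonempty_iff_ne_empty.2 h⟩
    have hSo : IsOpen S := hSQ ▸ isOpen_interior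
    have : x ∈ interior (⋃₀ (Q \ Q')) := by
      refine interior_maximal ?_ (hSo.inter hcl.isOpen_compl) ⟨hx, hxU⟩
      rintro y ⟨hy, hyU⟩
      rw [hSQ] at hy
      obtain ⟨P, hP, hyP⟩ := interior_subset hy
      exact ⟨P, ⟨hP, fun h => hyU ⟨P, h, hyP⟩⟩, hyP⟩
    rw [hN] at this
    exact this
  have hP : ∀ P ∈ Q', ∃ 𝒜 : Set (Set (E d)), 𝒜.Finite ∧ P ∩ closure S ⊆ ⋃₀ 𝒜 ∧
      ∀ A ∈ 𝒜, IsInwardPiece S A := by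
    intro P hP
    obtain ⟨x₀, hx₀⟩ := hP.2
    obtain ⟨r, hr, hball⟩ := Metric.isOpen_iff.1 isOpen_interior x₀ hx₀
    obtain ⟨t, ht, htc⟩ := Metric.totallyBounded_iff.1 (Metric.isCompact_of_isClosed_isBounded
      isClosed_closure hb.closure).totallyBounded (r / 3)
      (by positivity)
    refine ⟨(fun p => P ∩ Metric.ball p (r / 3)) '' t, ht.image _, ?_, ?_⟩
    · rintro y ⟨hyP, hyS⟩
      obtain ⟨p, hp, hyp⟩ := mem_iUnion₂.1 (htc hyS)
      exact ⟨_, mem_image_of_mem _ hp, hyP, hyp⟩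
    · rintro _ ⟨p, -, rfl⟩
      refine isInwardPiece_inter_ball (hQp P hP.1).convex (hQp P hP.1).isClosed.measurableSet ?_
        (by positivity) (x₀ := x₀) ?_ p
      · rw [hSQ]
        exact interior_mono (subset_sUnion_of_mem hP.1)
      · rw [mul_div_cancel₀ _ (by norm_num)]
        exact hball.trans interior_subset
  choose! 𝒜 h𝒜 using hP
  refine ⟨⋃ P ∈ Q', 𝒜 P, hQ'.biUnion fun P hP => (h𝒜 P hP).1, fun y hy => ?_, fun A hA => ?_⟩
  · obtain ⟨P, hP, hyP⟩ := hcov hy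
    obtain ⟨A, hA, hyA⟩ := (h𝒜 P hP).2.1 ⟨hyP, hy⟩
    exact ⟨A, mem_biUnion hP hA, hyA⟩
  · obtain ⟨P, hP, hAP⟩ := mem_iUnion₂.1 hA
    exact (h𝒜 P hP).2.2 A hAP

/-! ### Faces -/

/-- `F` is a relatively open subset of `∂S`, contained in a hyperplane orthogonal to the unit
vector `n`, and `S` lies locally on the side of `F` opposite to `n`. -/
structure IsFlatFace {d : ℕ} (S F : Set (E d)) (n : E d) (c : ℝ) : Prop where
  norm_eq : ‖n‖ = 1
  isBounded : Bornology.IsBounded F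
  measurableSet : MeasurableSet F
  subset_hyperplane : F ⊆ hyperplane n c
  mem_nhdsWithin : ∀ x ∈ F, F ∈ 𝓝[hyperplane n c] x
  side : ∀ x ∈ F, ∃ r > 0, ∀ y ∈ Metric.ball x r, y ∈ S ↔ ⟪n, y - x⟫ < 0

/-- Near x the set S is an open half-space, so its frontier there lies in the bounding hyperplane.
-/
theorem inner_sub_eq_zero_of_mem_frontier {d : ℕ} {S : Set (E d)} (hS : IsOpen S) {n x y : E d}
    {r : ℝ} (h : ∀ y ∈ Metric.ball x r, y ∈ S ↔ ⟪n, y - x⟫ < 0) (hy : y ∈ Metric.ball x r)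
    (hyS : y ∈ frontier S) : ⟪n, y - x⟫ = 0 := by
  rw [hS.frontier_eq] at hyS
  refine le_antisymm ?_ (not_lt.1 fun hlt => hyS.2 ((h y hy).2 hlt))
  by_contra! hlt
  have ho : IsOpen (Metric.ball x r ∩ {y | 0 < ⟪n, y - x⟫}) :=
    Metric.isOpen_ball.inter (isOpen_lt continuous_const (by fun_prop))
  obtain ⟨z, ⟨hz, hz2⟩, hzS⟩ := mem_closure_iff.1 hyS.1 _ ho ⟨hy, hlt⟩
  exact absurd ((h z hz).1 hzS) (not_lt.2 (le_of_lt hz2))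

/-- Two facts are extracted from the polyhedral description: the hyperplane carrying F is orthogonal
to n, and the relative boundary of F lies in finitely many codimension-two planes. -/
theorem isFlatFace_of_isHyperplanarPolytope {d : ℕ} {S F : Set (E d)} (hS : IsOpen S)
    (hF : IsHyperplanarPolytope F) (hne : F.Nonempty) (hFS : F ⊆ frontier S) {n : E d}
    (hn : ‖n‖ = 1)
    (hside : ∀ x ∈ F, ∃ r > 0, ∀ y ∈ Metric.ball x r, y ∈ S ↔ ⟪n, y - x⟫ < 0) :
    ∃ c, IsFlatFace S F n c ∧ ∃ 𝓛 : Set (E d × ℝ), 𝓛.Finite ∧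
      (∀ p ∈ 𝓛, ‖p.1‖ = 1 ∧ ⟪n, p.1⟫ = 0) ∧
      closure F \ F ⊆ ⋃ p ∈ 𝓛, hyperplane n c ∩ hyperplane p.1 p.2 := by
  obtain ⟨hb, a, c, Q, ha, hQ, hQp, hFe⟩ := hF
  -- Exhibits F as the trace of an open set on the hyperplane, hence measurable and relatively open.
  have hFe' : F = hyperplane a c ∩ interior (⋃₀ Q ∪ (hyperplane a c)ᶜ) := by
    rw [hFe]
    ext x
    refine and_congr_right fun hx => ?_
    rw [mem_interior_iff_mem_nhds, mem_nhdsWithin_iff_eventually, ← eventually_mem_set]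
    refine eventually_congr (Eventually.of_forall fun y => ?_)
    simp [hyperplane, or_iff_not_imp_right]
  have hFn : ∀ x ∈ F, F ∈ 𝓝[hyperplane a c] x := fun x hx => by
    rw [hFe'] at hx ⊢
    exact inter_mem self_mem_nhdsWithin (mem_nhdsWithin_of_mem_nhds (isOpen_interior.mem_nhds hx.2))
  have haa : ⟪a, a⟫ = 1 := by simp [ha]
  have hnn : ⟪n, n⟫ = 1 := by simp [hn]
  -- Let w be the component of n orthogonal to a. A small displacement along w stays in F, hence in
  -- the frontier of S, which near x is orthogonal to n. So ⟪n, w⟫ = 0, and w = 0.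
  have hpar : n = ⟪a, n⟫ • a := by
    obtain ⟨x, hx⟩ := hne
    set w := n - ⟪a, n⟫ • a with hw
    have haw : ⟪a, w⟫ = 0 := by rw [hw, inner_sub_right, inner_smul_right, haa]; ring
    obtain ⟨r, hr, hball⟩ := hside x hx
    have hl : Tendsto (fun t : ℝ => x + t • w) (𝓝 0) (𝓝[hyperplane a c] x) := by
      refine tendsto_nhdsWithin_iff.2 ⟨?_, Eventually.of_forall fun t => ?_⟩
      · have : Continuous fun t : ℝ => x + t • w := by fun_prop
        simpa using this.tendsto 0
      · have hxa : ⟪a, x⟫ = c := by rw [hFe] at hx; exact hx.1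
        simp [hyperplane, inner_add_right, inner_smul_right, haw, hxa]
    have h1 : ∀ᶠ t in 𝓝 (0 : ℝ), x + t • w ∈ F := hl (hFn x hx)
    have h2 : ∀ᶠ t in 𝓝 (0 : ℝ), x + t • w ∈ Metric.ball x r :=
      (hl.mono_right nhdsWithin_le_nhds) (Metric.ball_mem_nhds x hr)
    obtain ⟨t, ⟨ht1, ht2⟩, ht0⟩ :=
      (((h1.and h2).filter_mono nhdsWithin_le_nhds).and
        (eventually_mem_nhdsWithin (s := {0}ᶜ))).exists
    have h3 := inner_sub_eq_zero_of_mem_frontier hS hball ht2 (hFS ht1)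
    rw [add_sub_cancel_left, inner_smul_right] at h3
    have h4 : ⟪n, w⟫ = 0 := (mul_eq_zero.1 h3).resolve_left ht0
    have h5 : ⟪w, w⟫ = 0 := by
      conv_lhs => rw [hw]
      rw [← hw, inner_sub_left, inner_smul_left, h4, haw]
      simp
    rw [inner_self_eq_zero] at h5
    exact sub_eq_zero.1 (hw ▸ h5)
  set t := ⟪a, n⟫ with ht
  have ht2 : t * t = 1 := by
    rw [hpar, inner_smul_left, inner_smul_right, haa] at hnn
    simpa using hnn
  have hH : hyperplane n (t * c) = hyperplane a c := by
    have ht0 : t ≠ 0 := by rintro h; rw [h] at ht2; simp at ht2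
    ext y
    simp only [hyperplane, mem_ofPred_eq]
    rw [hpar, inner_smul_left]
    simp [ht0]
  have hF0 : F ⊆ hyperplane a c := by rw [hFe']; exact inter_subset_left
  refine ⟨t * c, ⟨hn, hb, ?_, hH ▸ hF0, hH ▸ hFn, hside⟩, ?_⟩
  · rw [hFe']
    exact (measurableSet_hyperplane a c).inter isOpen_interior.measurableSet
  have hQ2 : ∀ P ∈ Q, ∃ s : Finset (E d × ℝ), P = {x | ∀ p ∈ s, ⟪p.1, x⟫ ≤ p.2} := hQp
  choose! s hs using hQ2
  -- The tangential part of the normal of a constraint. On `hyperplane a c` the constraint reads ⟪β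
  -- p, y⟫ ≤ p.2 - ⟪a, p.1⟫ c; it cuts the hyperplane only if β p ≠ 0, and is then normalized.
  set β : E d × ℝ → E d := fun p => p.1 - ⟪a, p.1⟫ • a
  refine ⟨⋃ P ∈ Q, (fun p => (‖β p‖⁻¹ • β p, ‖β p‖⁻¹ * (p.2 - ⟪a, p.1⟫ * c))) ''
    {p ∈ (s P : Set (E d × ℝ)) | β p ≠ 0}, hQ.biUnion fun P _ =>
      ((s P).finite_toSet.subset (sep_subset _ _)).image _, ?_, ?_⟩
  · intro q hq
    obtain ⟨P, hP, p, hp, rfl⟩ := mem_iUnion₂.1 hq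
    refine ⟨by simp [norm_smul, hp.2], ?_⟩
    rw [hpar]
    simp only [β, inner_smul_left, inner_smul_right, inner_sub_right, haa]
    ring
  · rintro x ⟨hxc, hxF⟩
    have hHc : IsClosed (hyperplane a c) := isClosed_eq (by fun_prop) continuous_const
    have hxH : x ∈ hyperplane a c := closure_minimal hF0 hHc hxc
    have hFQ : F ⊆ ⋃₀ Q := fun y hy => by
      rw [hFe] at hy
      exact mem_of_mem_nhdsWithin hy.1 hy.2
    have hxQ : x ∈ ⋃₀ Q := closure_minimal hFQ
      (sUnion_eq_biUnion ▸ hQ.isClosed_biUnion fun P hP => (hQp P hP).isClosed) hxc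
    obtain ⟨P, hP, hxP⟩ := hxQ
    have hxs : ∀ p ∈ s P, ⟪p.1, x⟫ ≤ p.2 := by rw [hs P hP] at hxP; exact hxP
    -- If all constraints of P with β p ≠ 0 were strict at x, they would persist nearby while the
    -- others are constant on the hyperplane; P would then be a relative neighbourhood of x, forcing
    -- x ∈ F.
    have hex : ∃ p ∈ s P, β p ≠ 0 ∧ ⟪p.1, x⟫ = p.2 := by
      by_contra! hcon
      refine hxF ?_
      rw [hFe]
      refine ⟨hxH, mem_of_superset (x := P) ?_ (subset_sUnion_of_mem hP)⟩
      rw [hs P hP]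
      have : ∀ p ∈ s P, ∀ᶠ y in 𝓝[hyperplane a c] x, ⟪p.1, y⟫ ≤ p.2 := by
        intro p hp
        by_cases hβ : β p = 0
        · filter_upwards [self_mem_nhdsWithin] with y hy
          have e : p.1 = ⟪a, p.1⟫ • a := sub_eq_zero.1 hβ
          have e2 : ∀ y ∈ hyperplane a c, ⟪p.1, y⟫ = ⟪a, p.1⟫ * c := fun y hy => by
            rw [e, inner_smul_left, show ⟪a, y⟫ = c from hy, ← e]; simp
          rw [e2 y hy, ← e2 x hxH]
          exact hxs p hp
        · have hlt := lt_of_le_of_ne (hxs p hp) (hcon p hp hβ)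
          have hc : Continuous fun y : E d => ⟪p.1, y⟫ := by fun_prop
          exact ((hc.tendsto x).eventually (gt_mem_nhds hlt)).filter_mono nhdsWithin_le_nhds
            |>.mono fun y hy => le_of_lt hy
      exact (Filter.eventually_all_finset (s P)).2 this
    obtain ⟨p, hp, hβ, hpx⟩ := hex
    refine mem_biUnion (mem_biUnion hP (mem_image_of_mem _ ⟨hp, hβ⟩)) ⟨hH ▸ hxH, ?_⟩
    have hxa : ⟪a, x⟫ = c := hxH
    simp [hyperplane, β, inner_smul_left, inner_sub_left, hpx, hxa]

/-! ### Traces on flat faces -/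

theorem memLp_restrict_of_isBounded {d : ℕ} {μ : Measure (E d)} {A : Set (E d)}
    (hA : MeasurableSet A) (hb : Bornology.IsBounded A) (hμ : μ A < ⊤) {F : Type*}
    [NormedAddCommGroup F] {φ : E d → F} (hφ : Continuous φ) (p : ℝ≥0∞) :
    MemLp φ p (μ.restrict A) := by
  have : IsFiniteMeasure (μ.restrict A) := ⟨by simpa using hμ⟩
  obtain ⟨C, hC⟩ := (Metric.isCompact_of_isClosed_isBounded isClosed_closure
    hb.closure).exists_bound_of_continuousOn hφ.continuousOn
  exact MemLp.of_bound hφ.aestronglyMeasurable C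
    ((ae_restrict_mem hA).mono fun x hx => hC x (subset_closure hx))

theorem lintegral_enorm_sub_sq_le {α F : Type*} [MeasurableSpace α] {μ : Measure α}
    [NormedAddCommGroup F] {f g w : α → F} (hf : AEStronglyMeasurable f μ)
    (hw : AEStronglyMeasurable w μ) :
    ∫⁻ x, ‖f x - g x‖ₑ ^ 2 ∂μ ≤
      2 * ((∫⁻ x, ‖f x - w x‖ₑ ^ 2 ∂μ) + ∫⁻ x, ‖g x - w x‖ₑ ^ 2 ∂μ) := by
  have hm : AEMeasurable (fun x => ‖f x - w x‖ₑ ^ 2) μ := (hf.sub hw).enorm.pow_const 2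
  rw [← lintegral_add_left' hm, ← lintegral_const_mul' _ _ (by simp)]
  refine lintegral_mono fun x => ?_
  rw [mul_add]
  refine le_trans (pow_le_pow_left' ?_ 2) (ennreal_add_sq_le _ _)
  have : f x - g x = (f x - w x) - (g x - w x) := by abel
  rw [this]
  exact enorm_sub_le

/-- The squared distance in `H¹(W)` between `φ` and a function `w` with gradient `G`. -/
noncomputable def distH1Sq {d : ℕ} (W : Set (E d)) (φ w : E d → ℝ) (G : E d → E d) : ℝ≥0∞ :=
  (∫⁻ x in W, ‖φ x - w x‖ₑ ^ 2) + ∫⁻ x in W, ‖gradient φ x - G x‖ₑ ^ 2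

theorem distH1Sq_mono {d : ℕ} {W W' : Set (E d)} (h : W ⊆ W') (φ w : E d → ℝ) (G : E d → E d) :
    distH1Sq W φ w G ≤ distH1Sq W' φ w G :=
  add_le_add (lintegral_mono_set h) (lintegral_mono_set h)

theorem TendstoH1.tendsto_distH1Sq {d : ℕ} {W : Set (E d)} {φ : ℕ → E d → ℝ} {w : E d → ℝ}
    {G : E d → E d} (h : TendstoH1 W φ w G) :
    Tendsto (fun k => distH1Sq W (φ k) w G) atTop (𝓝 0) := by
  simpa [distH1Sq] using
    (tendsto_eLpNorm_two_iff.1 h.1).add (tendsto_eLpNorm_two_iff.1 h.2)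

theorem gradient_sub' {d : ℕ} {φ ψ : E d → ℝ} (hφ : ContDiff ℝ ∞ φ) (hψ : ContDiff ℝ ∞ ψ)
    (x : E d) : gradient (fun x => φ x - ψ x) x = gradient φ x - gradient ψ x := by
  simp only [gradient]
  rw [fderiv_fun_sub (hφ.differentiable (by simp) x) (hψ.differentiable (by simp) x), map_sub]

/-- The trace inequality for φ - ψ, followed by the triangle inequality through w. It serves both to
show that one approximating sequence has Cauchy traces and that two sequences have the same limit.
-/
theorem exists_lintegral_trace_sub_le {d : ℕ} {n v : E d} (hn : ‖n‖ = 1) (hv : ⟪n, v⟫ ≠ 0) {δ : ℝ}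
    (hδ : 0 < δ) : ∃ C : ℝ≥0∞, C ≠ ⊤ ∧ ∀ (c : ℝ) (φ ψ w : E d → ℝ) (G : E d → E d)
      (A W : Set (E d)), ContDiff ℝ ∞ φ → ContDiff ℝ ∞ ψ →
      AEStronglyMeasurable w (volume.restrict W) → AEStronglyMeasurable G (volume.restrict W) →
      MeasurableSet A → MeasurableSet W → A ⊆ hyperplane n c →
      (∀ y ∈ A, ∀ s ∈ Ioo 0 δ, y + s • v ∈ W) →
      ∫⁻ y in A, ‖φ y - ψ y‖ₑ ^ 2 ∂μHE[d - 1] ≤ C * (distH1Sq W φ w G + distH1Sq W ψ w G) := by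
  obtain ⟨C, hC, h⟩ := exists_lintegral_trace_le hn hv hδ
  refine ⟨C * 2, ENNReal.mul_ne_top hC (by simp), ?_⟩
  intro c φ ψ w G A W hφ hψ hw hG hA hW hAH hAW
  refine (h c (fun x => φ x - ψ x) A W ((hφ.sub hψ).of_le (by simp)) hA hW hAH hAW).trans ?_
  rw [mul_assoc]
  gcongr
  simp only [gradient_sub' hφ hψ]
  refine (add_le_add (lintegral_enorm_sub_sq_le hφ.continuous.aestronglyMeasurable hw)
    (lintegral_enorm_sub_sq_le
      (continuous_gradient (hφ.of_le (by simp))).aestronglyMeasurable hG)).trans (le_of_eq ?_)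
  simp only [distH1Sq]
  ring

theorem exists_tendsto_eLpNorm_of_cauchy {α : Type*} [MeasurableSpace α] {μ : Measure α}
    {f : ℕ → α → ℝ} (hf : ∀ k, MemLp (f k) 2 μ) {b : ℕ → ℝ≥0∞} (hb : Tendsto b atTop (𝓝 0))
    (h : ∀ k l, ∫⁻ x, ‖f k x - f l x‖ₑ ^ 2 ∂μ ≤ b k + b l) :
    ∃ g, MemLp g 2 μ ∧ Tendsto (fun k => eLpNorm (fun x => f k x - g x) 2 μ) atTop (𝓝 0) := by
  have hc : CauchySeq fun k => (hf k).toLp (f k) := by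
    rw [EMetric.cauchySeq_iff]
    intro ε hε
    have hε2 : 0 < ε ^ 2 / 2 := by
      simp [ENNReal.div_pos_iff, hε.ne']
    obtain ⟨N, hN⟩ := eventually_atTop.1 (hb.eventually (gt_mem_nhds hε2))
    refine ⟨N, fun m hm n hn => ?_⟩
    rw [Lp.edist_toLp_toLp]
    have h1 : eLpNorm (f m - f n) 2 μ ^ 2 < ε ^ 2 := by
      rw [eLpNorm_two_sq]
      refine (h m n).trans_lt ?_
      calc b m + b n < ε ^ 2 / 2 + ε ^ 2 / 2 := ENNReal.add_lt_add (hN m hm) (hN n hn)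
        _ = ε ^ 2 := ENNReal.add_halves _
    exact lt_of_pow_lt_pow_left' 2 h1
  obtain ⟨g, hg⟩ := cauchySeq_tendsto_of_complete hc
  refine ⟨g, Lp.memLp g, ?_⟩
  have h2 := (Lp.tendsto_Lp_iff_tendsto_eLpNorm' _ _).1 hg
  refine h2.congr fun k => eLpNorm_congr_ae ?_
  filter_upwards [(hf k).coeFn_toLp] with x hx
  simp [hx]

/-- `g` is the trace of `w` on the subset `B` of `∂S`, tested against all the smooth
approximations of `w` in the intersections of `S` with balls. -/
def IsStrongTrace {d : ℕ} (S B : Set (E d)) (w g : E d → ℝ) : Prop :=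
  MemLp g 2 ((μHE[d - 1] : Measure (E d)).restrict B) ∧
    ∀ (x : E d) (r : ℝ) (φ : ℕ → E d → ℝ), (∀ k, ContDiff ℝ ∞ (φ k)) →
      TendstoH1 (S ∩ Metric.ball x r) φ w (weakGrad S w) → ∀ r' < r,
      Tendsto (fun k => ∫⁻ y in B ∩ Metric.ball x r', ‖φ k y - g y‖ₑ ^ 2 ∂μHE[d - 1]) atTop (𝓝 0)

/-- On the overlap only g₁ is kept, so the two traces never need to be compared. -/
theorem IsStrongTrace.union {d : ℕ} {S B₁ B₂ : Set (E d)} (h₁ : MeasurableSet B₁)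
    (h₂ : MeasurableSet B₂) {w g₁ g₂ : E d → ℝ} (hg₁ : IsStrongTrace S B₁ w g₁)
    (hg₂ : IsStrongTrace S B₂ w g₂) : ∃ g, IsStrongTrace S (B₁ ∪ B₂) w g := by
  classical
  refine ⟨B₁.piecewise g₁ g₂, ?_, ?_⟩
  · refine MemLp.piecewise h₁ ?_ ?_
    · refine hg₁.1.mono_measure ?_
      rw [Measure.restrict_restrict h₁]
      exact Measure.restrict_mono inter_subset_left le_rfl
    · refine hg₂.1.mono_measure ?_
      rw [Measure.restrict_restrict h₁.compl]
      exact Measure.restrict_mono (fun x hx => hx.2.resolve_left hx.1) le_rfl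
  · intro x r φ hφ hφt r' hr'
    have t := (hg₁.2 x r φ hφ hφt r' hr').add (hg₂.2 x r φ hφ hφt r' hr')
    rw [add_zero] at t
    refine tendsto_of_tendsto_of_tendsto_of_le_of_le tendsto_const_nhds t (fun _ => bot_le)
      fun k => ?_
    have hsub : (B₁ ∪ B₂) ∩ Metric.ball x r' ⊆
        (B₁ ∩ Metric.ball x r') ∪ ((B₂ \ B₁) ∩ Metric.ball x r') := by
      rintro y ⟨hy, hyb⟩
      by_cases hy1 : y ∈ B₁
      · exact Or.inl ⟨hy1, hyb⟩
      · exact Or.inr ⟨⟨hy.resolve_left hy1, hy1⟩, hyb⟩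
    refine (lintegral_mono_set hsub).trans ((lintegral_union_le _ _ _).trans (add_le_add ?_ ?_))
    · refine le_of_eq (setLIntegral_congr_fun (h₁.inter measurableSet_ball) fun y hy => ?_)
      simp only [piecewise_eq_of_mem _ _ _ hy.1]
    · refine le_trans (le_of_eq (setLIntegral_congr_fun ((h₂.diff h₁).inter measurableSet_ball)
        fun y hy => ?_)) (lintegral_mono_set (inter_subset_inter_left _ sdiff_subset))
      simp only [piecewise_eq_of_notMem _ _ _ hy.1.2]

/-- Transversality is automatic: a direction that enters S from a point of the face is strictly
opposed to the normal. -/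
theorem IsFlatFace.inner_neg {d : ℕ} {S F : Set (E d)} {n : E d} {c : ℝ}
    (hF : IsFlatFace S F n c) {x v : E d} (hx : x ∈ F) {δ : ℝ} (hδ : 0 < δ)
    (hv : ∀ s ∈ Ioo 0 δ, x + s • v ∈ S) : ⟪n, v⟫ < 0 := by
  obtain ⟨r, hr, hside⟩ := hF.side x hx
  have hc : Continuous fun s : ℝ => x + s • v := by fun_prop
  have h1 : ∀ᶠ s in 𝓝 (0 : ℝ), x + s • v ∈ Metric.ball x r := by
    have := hc.tendsto 0
    rw [zero_smul, add_zero] at this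
    exact this (Metric.ball_mem_nhds x hr)
  obtain ⟨s, hs1, hs2⟩ := ((h1.filter_mono nhdsWithin_le_nhds).and
    (Ioo_mem_nhdsGT hδ)).exists
  have h2 := (hside _ hs1).1 (hv s hs2)
  rw [add_sub_cancel_left, inner_smul_right] at h2
  by_contra! h3
  exact absurd h2 (not_lt.2 (mul_nonneg hs2.1.le h3))

/-- Mollified approximations of w in `W` have Cauchy restrictions to the piece, by the trace
inequality along the entering segments; g is their limit. Any other approximation in S ∩ ball is
compared with them along shorter segments. -/
theorem IsFlatFace.exists_isStrongTrace_inter {d : ℕ} {S F A : Set (E d)} {n : E d} {c : ℝ}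
    (hS : IsOpen S) (hF : IsFlatFace S F n c) (hA : IsInwardPiece S A) {w : E d → ℝ}
    (hw : MemH1 S w) : ∃ g, IsStrongTrace S (F ∩ A) w g := by
  obtain ⟨hAm, W, v, δ, ρ, hWm, hWS, hδ, hρ, hAW, hdir⟩ := hA
  obtain hemp | ⟨x₀, hx₀F, hx₀A⟩ := (F ∩ A).eq_empty_or_nonempty
  · rw [hemp]
    exact ⟨0, by simp, fun x r φ _ _ r' _ => by simp⟩
  have hn := hF.norm_eq
  have hv : ⟪n, v⟫ ≠ 0 := (hF.inner_neg hx₀F hδ fun s hs => hWS (hAW x₀ hx₀A s hs)).ne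
  have hGL := hw.memLp_weakGrad hS
  obtain ⟨φ, hφ, hφt⟩ := exists_smooth_tendstoH1 hS.measurableSet hWm hWS hw.1 hGL
    hw.hasWeakGradient hρ hdir
  have hB : MeasurableSet (F ∩ A) := hF.measurableSet.inter hAm
  have hBH : F ∩ A ⊆ hyperplane n c := inter_subset_left.trans hF.subset_hyperplane
  have hBb : Bornology.IsBounded (F ∩ A) := hF.isBounded.subset inter_subset_left
  have hBμ := euclideanHausdorffMeasure_hyperplane_lt_top hn c hBb hBH
  have hwm : ∀ {U : Set (E d)}, U ⊆ S → AEStronglyMeasurable w (volume.restrict U) ∧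
      AEStronglyMeasurable (weakGrad S w) (volume.restrict U) := fun hU =>
    ⟨hw.1.1.mono_measure (Measure.restrict_mono hU le_rfl),
      hGL.1.mono_measure (Measure.restrict_mono hU le_rfl)⟩
  have hφd := hφt.tendsto_distH1Sq
  obtain ⟨g, hg, hgt⟩ : ∃ g, MemLp g 2 ((μHE[d - 1] : Measure (E d)).restrict (F ∩ A)) ∧
      Tendsto (fun k => eLpNorm (fun x => φ k x - g x) 2
        ((μHE[d - 1] : Measure (E d)).restrict (F ∩ A))) atTop (𝓝 0) := by
    obtain ⟨C, hC, hCle⟩ := exists_lintegral_trace_sub_le hn hv hδ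
    refine exists_tendsto_eLpNorm_of_cauchy
      (fun k => memLp_restrict_of_isBounded hB hBb hBμ (hφ k).continuous 2)
      (b := fun k => C * distH1Sq W (φ k) w (weakGrad S w)) ?_ fun k l => ?_
    · simpa using ENNReal.Tendsto.const_mul hφd (Or.inr hC)
    · rw [← mul_add]
      exact hCle c _ _ _ _ _ _ (hφ k) (hφ l) (hwm hWS).1 (hwm hWS).2 hB hWm hBH
        fun y hy => hAW y hy.2
  refine ⟨g, hg, fun x r ψ hψ hψt r' hr' => ?_⟩
  rw [tendsto_eLpNorm_two_iff] at hgt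
  -- Segments of this duration starting in the ball of radius r' stay in the ball of radius r, where
  -- the ψ k are known to converge; hence the strict inequality r' < r in `IsStrongTrace`.
  set δ' := min δ ((r - r') / (‖v‖ + 1))
  have hv0 : 0 < ‖v‖ + 1 := by positivity
  have hδ' : 0 < δ' := lt_min hδ (div_pos (by linarith) hv0)
  obtain ⟨C, hC, hCle⟩ := exists_lintegral_trace_sub_le hn hv hδ'
  have hψd := hψt.tendsto_distH1Sq
  have hbound : ∀ k, ∫⁻ y in F ∩ A ∩ Metric.ball x r', ‖ψ k y - g y‖ₑ ^ 2 ∂μHE[d - 1] ≤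
      2 * (C * (distH1Sq (S ∩ Metric.ball x r) (ψ k) w (weakGrad S w) +
        distH1Sq W (φ k) w (weakGrad S w)) +
        ∫⁻ y in F ∩ A, ‖φ k y - g y‖ₑ ^ 2 ∂μHE[d - 1]) := by
    intro k
    refine (lintegral_enorm_sub_sq_le (w := φ k) (hψ k).continuous.aestronglyMeasurable
      (hφ k).continuous.aestronglyMeasurable).trans ?_
    refine mul_le_mul_right (add_le_add ?_ ?_) _
    · refine (hCle c (ψ k) (φ k) w (weakGrad S w) (F ∩ A ∩ Metric.ball x r')
        (W ∩ Metric.ball x r) (hψ k) (hφ k) (hwm (inter_subset_left.trans hWS)).1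
        (hwm (inter_subset_left.trans hWS)).2 (hB.inter measurableSet_ball)
        (hWm.inter measurableSet_ball) (inter_subset_left.trans hBH) ?_).trans ?_
      · rintro y ⟨⟨-, hyA⟩, hyb⟩ s hs
        refine ⟨hAW y hyA s ⟨hs.1, hs.2.trans_le (min_le_left _ _)⟩, ?_⟩
        rw [mem_ball_iff_norm] at hyb ⊢
        have h3 : s * (‖v‖ + 1) < r - r' := by
          rw [← lt_div_iff₀ hv0]
          exact hs.2.trans_le (min_le_right _ _)
        rw [add_sub_right_comm]
        refine (norm_add_le _ _).trans_lt ?_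
        rw [norm_smul, Real.norm_of_nonneg hs.1.le]
        linarith [hs.1]
      · gcongr
        · exact distH1Sq_mono (inter_subset_inter_left _ hWS) _ _ _
        · exact distH1Sq_mono inter_subset_left _ _ _
    · refine (lintegral_mono_set inter_subset_left).trans (le_of_eq ?_)
      exact lintegral_congr fun y => by rw [← enorm_neg, neg_sub]
  refine tendsto_of_tendsto_of_tendsto_of_le_of_le tendsto_const_nhds ?_ (fun _ => bot_le) hbound
  have t1 := ENNReal.Tendsto.const_mul (hψd.add hφd) (Or.inr hC)
  have t2 := ENNReal.Tendsto.const_mul (a := 2) (t1.add hgt) (Or.inr (by simp))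
  simpa using t2

/-- Near x the set S is a half-space, entered along every direction close to -n. The vector -(r/4) n
and the tolerance r/4 give displacements shorter than r/2, which do not leave the ball where `side`
holds. -/
theorem IsFlatFace.exists_smooth_tendstoH1_inter_ball {d : ℕ} {S F : Set (E d)} {n : E d} {c : ℝ}
    (hS : IsOpen S) (hF : IsFlatFace S F n c) {w : E d → ℝ} (hw : MemH1 S w) {x : E d}
    (hx : x ∈ F) : ∃ r > 0, ∃ φ : ℕ → E d → ℝ, (∀ k, ContDiff ℝ ∞ (φ k)) ∧
      TendstoH1 (S ∩ Metric.ball x r) φ w (weakGrad S w) := by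
  obtain ⟨r, hr, hside⟩ := hF.side x hx
  refine ⟨r / 2, by positivity, ?_⟩
  refine exists_smooth_tendstoH1 hS.measurableSet (hS.measurableSet.inter measurableSet_ball)
    inter_subset_left hw.1 (hw.memLp_weakGrad hS) hw.hasWeakGradient (v := -((r / 4) • n))
    (ρ := r / 4) (by positivity) ?_
  rintro y ⟨hyS, hyb⟩ z hz s hs
  rw [mem_ball_iff_norm] at hyb hz
  have hv : ‖-((r / 4) • n)‖ = r / 4 := by
    rw [norm_neg, norm_smul, hF.norm_eq, Real.norm_of_nonneg (by positivity), mul_one]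
  have hzn : ‖z‖ < r / 2 := by
    have : z = (z - -((r / 4) • n)) + -((r / 4) • n) := by abel
    rw [this]
    refine (norm_add_le _ _).trans_lt ?_
    linarith
  have hzi : ⟪n, z⟫ < 0 := by
    have h1 := real_inner_le_norm n (z - -((r / 4) • n))
    rw [hF.norm_eq, one_mul, inner_sub_right, inner_neg_right, inner_smul_right,
      real_inner_self_eq_norm_sq, hF.norm_eq] at h1
    linarith
  have hyx : y ∈ Metric.ball x r := by rw [mem_ball_iff_norm]; linarith
  refine (hside _ ?_).2 ?_
  · rw [mem_ball_iff_norm, add_sub_right_comm]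
    refine (norm_add_le _ _).trans_lt ?_
    rw [norm_smul, Real.norm_of_nonneg hs.1.le]
    nlinarith [hs.2, norm_nonneg z]
  · rw [add_sub_right_comm, inner_add_right, inner_smul_right]
    have := (hside y hyx).1 hyS
    nlinarith [hs.1]

/-- Strong traces on the pieces are glued over a finite cover of F by inward pieces. Being tested
against every approximation, the result is in particular the limit of the one available near each
point of F, after halving the radius. -/
theorem IsFlatFace.exists_isTrace {d : ℕ} {S F : Set (E d)} {n : E d} {c : ℝ}
    (hS : IsPolytope S) (hF : IsFlatFace S F n c) (hFS : F ⊆ frontier S) {w : E d → ℝ}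
    (hw : MemH1 S w) : ∃ g, IsTrace S F w g := by
  obtain ⟨𝒜, h𝒜, hcov, hp⟩ := hS.exists_inwardPieces
  have key : ∃ g, IsStrongTrace S (⋃ A ∈ 𝒜, F ∩ A) w g := by
    clear hcov
    induction 𝒜, h𝒜 using Set.Finite.induction_on with
    | empty =>
      refine ⟨0, by simp, fun x r φ _ _ r' _ => by simp⟩
    | @insert A 𝒜 _ hfin ih =>
      obtain ⟨g₁, hg₁⟩ := hF.exists_isStrongTrace_inter hS.isOpen (hp A (mem_insert _ _)) hw
      obtain ⟨g₂, hg₂⟩ := ih fun B hB => hp B (mem_insert_of_mem _ hB)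
      rw [biUnion_insert]
      refine hg₁.union (hF.measurableSet.inter (hp A (mem_insert _ _)).1)
        (hfin.measurableSet_biUnion fun B hB =>
          hF.measurableSet.inter (hp B (mem_insert_of_mem _ hB)).1) hg₂
  have hFu : (⋃ A ∈ 𝒜, F ∩ A) = F := by
    refine subset_antisymm (iUnion₂_subset fun A _ => inter_subset_left) fun x hx => ?_
    obtain ⟨A, hA, hxA⟩ := hcov (frontier_subset_closure (hFS hx))
    exact mem_biUnion hA ⟨hx, hxA⟩
  rw [hFu] at key
  obtain ⟨g, hg⟩ := key
  refine ⟨g, hg.1, fun x hx => ?_⟩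
  obtain ⟨r, hr, φ, hφ, hφt⟩ := hF.exists_smooth_tendstoH1_inter_ball hS.isOpen hw hx
  refine ⟨r / 2, by positivity, φ, hφ, ⟨?_, ?_⟩, ?_⟩
  · refine tendsto_of_tendsto_of_tendsto_of_le_of_le tendsto_const_nhds hφt.1 (fun _ => bot_le)
      fun k => eLpNorm_mono_measure _ (Measure.restrict_mono ?_ le_rfl)
    exact inter_subset_inter_right _ (Metric.ball_subset_ball (by linarith))
  · refine tendsto_of_tendsto_of_tendsto_of_le_of_le tendsto_const_nhds hφt.2 (fun _ => bot_le)
      fun k => eLpNorm_mono_measure _ (Measure.restrict_mono ?_ le_rfl)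
    exact inter_subset_inter_right _ (Metric.ball_subset_ball (by linarith))
  · rw [tendsto_eLpNorm_two_iff]
    exact hg.2 x r φ hφ hφt _ (by linarith)

theorem isTrace_trace {d : ℕ} {S F : Set (E d)} {w : E d → ℝ} (h : ∃ g, IsTrace S F w g) :
    IsTrace S F w (trace S F w) := by
  rw [trace, dif_pos h]
  exact h.choose_spec

/-! ### Local Green formula at a face -/

/-- Green's formula for functions localized near a point of a flat part of the boundary. -/
theorem IsFlatFace.exists_green {d : ℕ} {S F : Set (E d)} {n : E d} {c : ℝ}
    (hS : IsOpen S) (hF : IsFlatFace S F n c) {w g : E d → ℝ} (hw : MemH1 S w)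
    (hg : IsTrace S F w g) {x : E d} (hx : x ∈ F) :
    ∃ r > 0, ∀ ψ, IsTestFunction (Metric.ball x r) ψ → ∀ e,
      (∫ y in S, w y * fderiv ℝ ψ y e) + ∫ y in S, ψ y * ⟪weakGrad S w y, e⟫ =
        ⟪n, e⟫ * ∫ y in F, g y * ψ y ∂μHE[d - 1] := by
  have hn := hF.norm_eq
  obtain ⟨r₁, hr₁, hside⟩ := hF.side x hx
  obtain ⟨r₂, hr₂, hFr⟩ := Metric.mem_nhdsWithin_iff.1 (hF.mem_nhdsWithin x hx)
  obtain ⟨r₃, hr₃, φ, hφ, hφt, hφg⟩ := hg.approx x hx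
  set r := min r₁ (min r₂ r₃)
  have hr : 0 < r := lt_min hr₁ (lt_min hr₂ hr₃)
  have hb₁ : Metric.ball x r ⊆ Metric.ball x r₁ := Metric.ball_subset_ball (min_le_left _ _)
  have hb₂ : Metric.ball x r ⊆ Metric.ball x r₂ :=
    Metric.ball_subset_ball ((min_le_right _ _).trans (min_le_left _ _))
  have hb₃ : Metric.ball x r ⊆ Metric.ball x r₃ :=
    Metric.ball_subset_ball ((min_le_right _ _).trans (min_le_right _ _))
  refine ⟨r, hr, fun ψ hψ e => ?_⟩
  set B := Metric.ball x r
  have hBm : MeasurableSet B := measurableSet_ball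
  have hxc : ⟪n, x⟫ = c := hF.subset_hyperplane hx
  have hGL := hw.memLp_weakGrad hS
  have hψ0 : ∀ y, y ∉ B → ψ y = 0 := fun y hy =>
    image_eq_zero_of_notMem_tsupport fun h => hy (hψ.2.2 h)
  have hψ1 : ∀ y, y ∉ B → fderiv ℝ ψ y = 0 := fun y hy =>
    fderiv_eq_zero_of_notMem_tsupport fun h => hy (hψ.2.2 h)
  have hvol : ∀ {U : Set (E d)} {f : E d → ℝ}, MeasurableSet U → (∀ y, y ∉ B → f y = 0) →
      ∫ y in U, f y = ∫ y in U ∩ B, f y := fun {U f} hU hf =>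
    setIntegral_eq_of_subset_of_forall_sdiff_eq_zero hU inter_subset_left
      fun y hy => hf y fun h => hy.2 ⟨hy.1, h⟩
  have hsurf : ∀ {U : Set (E d)} {f : E d → ℝ}, MeasurableSet U → (∀ y, y ∉ B → f y = 0) →
      ∫ y in U, f y ∂μHE[d - 1] = ∫ y in U ∩ B, f y ∂μHE[d - 1] := fun {U f} hU hf =>
    setIntegral_eq_of_subset_of_forall_sdiff_eq_zero hU inter_subset_left
      fun y hy => hf y fun h => hy.2 ⟨hy.1, h⟩
  have hSB : {y : E d | ⟪n, y⟫ < c} ∩ B = S ∩ B := by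
    ext y
    refine and_congr_left fun hy => ?_
    rw [hside y (hb₁ hy), inner_sub_right, hxc, sub_neg]
    rfl
  have hFB : hyperplane n c ∩ B = F ∩ B :=
    subset_antisymm (fun y hy => ⟨hFr ⟨hb₂ hy.2, hy.1⟩, hy.2⟩)
      (inter_subset_inter_left _ hF.subset_hyperplane)
  have hSBm : MeasurableSet (S ∩ B) := hS.measurableSet.inter hBm
  have hSBb : Bornology.IsBounded (S ∩ B) := Metric.isBounded_ball.subset inter_subset_right
  have hSBv : volume (S ∩ B) < ⊤ := (measure_mono inter_subset_right).trans_lt measure_ball_lt_top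
  have hFBm : MeasurableSet (F ∩ B) := hF.measurableSet.inter hBm
  have hFBb : Bornology.IsBounded (F ∩ B) := Metric.isBounded_ball.subset inter_subset_right
  have hFBv := euclideanHausdorffMeasure_hyperplane_lt_top hn c hFBb
    (inter_subset_left.trans hF.subset_hyperplane)
  have hw2 : MemLp w 2 (volume.restrict (S ∩ B)) :=
    hw.1.mono_measure (Measure.restrict_mono inter_subset_left le_rfl)
  have hG2 : MemLp (fun y => ⟪weakGrad S w y, e⟫) 2 (volume.restrict (S ∩ B)) :=
    (hGL.mono_measure (Measure.restrict_mono inter_subset_left le_rfl)).inner_const e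
  have hψd := IsTestFunction.continuous_fderiv_apply hψ.1 e
  have hφd := fun k => IsTestFunction.continuous_fderiv_apply (hφ k) e
  have ml : ∀ {f : E d → ℝ}, Continuous f → MemLp f 2 (volume.restrict (S ∩ B)) := fun hf =>
    memLp_restrict_of_isBounded hSBm hSBb hSBv hf 2
  have ms : ∀ {f : E d → ℝ}, Continuous f →
      MemLp f 2 ((μHE[d - 1] : Measure (E d)).restrict (F ∩ B)) := fun hf =>
    memLp_restrict_of_isBounded hFBm hFBb hFBv hf 2
  -- The half-space formula for the product φ k * ψ. On the support of ψ, S coincides with the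
  -- half-space and F with the hyperplane, so everything can be written over S ∩ B and F ∩ B before
  -- passing to the limit.
  have key : ∀ k, (∫ y in S ∩ B, φ k y * fderiv ℝ ψ y e) + ∫ y in S ∩ B, fderiv ℝ (φ k) y e * ψ y =
      ⟪n, e⟫ * ∫ y in F ∩ B, φ k y * ψ y ∂μHE[d - 1] := by
    intro k
    have i1 : Integrable (fun y => φ k y * fderiv ℝ ψ y e) (volume.restrict (S ∩ B)) :=
      (ml (hφ k).continuous).integrable_mul (ml hψd)
    have i2 : Integrable (fun y => fderiv ℝ (φ k) y e * ψ y) (volume.restrict (S ∩ B)) :=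
      (ml (hφd k)).integrable_mul (ml hψ.1.continuous)
    have h1 := integral_halfSpace_fderiv hn c (χ := fun y => φ k y * ψ y)
      (((hφ k).mul hψ.1).of_le (by simp)) hψ.2.1.mul_left e
    have h2 : ∀ y, fderiv ℝ (fun y => φ k y * ψ y) y e =
        φ k y * fderiv ℝ ψ y e + fderiv ℝ (φ k) y e * ψ y := by
      intro y
      rw [fderiv_fun_mul ((hφ k).differentiable (by simp) y) (hψ.1.differentiable (by simp) y)]
      simp [mul_comm]
    simp_rw [h2] at h1
    rw [hvol (measurableSet_lt (by fun_prop) measurable_const) fun y hy => by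
        simp [hψ0 y hy, hψ1 y hy], hsurf (measurableSet_hyperplane n c) fun y hy => by
        simp [hψ0 y hy], hSB, hFB, integral_add i1 i2] at h1
    exact h1
  have t1 : Tendsto (fun k => ∫ y in S ∩ B, φ k y * fderiv ℝ ψ y e) atTop
      (𝓝 (∫ y in S ∩ B, w y * fderiv ℝ ψ y e)) := by
    refine tendsto_integral_mul_of_tendsto_eLpNorm (fun k => ml (hφ k).continuous) hw2 (ml hψd) ?_
    exact tendsto_of_tendsto_of_tendsto_of_le_of_le tendsto_const_nhds hφt.1 (fun _ => bot_le)
      fun k => eLpNorm_mono_measure _ (Measure.restrict_mono (inter_subset_inter_right _ hb₃) le_rfl)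
  have t2 : Tendsto (fun k => ∫ y in S ∩ B, fderiv ℝ (φ k) y e * ψ y) atTop
      (𝓝 (∫ y in S ∩ B, ⟪weakGrad S w y, e⟫ * ψ y)) := by
    refine tendsto_integral_mul_of_tendsto_eLpNorm (fun k => ml (hφd k)) hG2 (ml hψ.1.continuous) ?_
    have hle : ∀ k, eLpNorm (fun y => fderiv ℝ (φ k) y e - ⟪weakGrad S w y, e⟫) 2
        (volume.restrict (S ∩ B)) ≤ ENNReal.ofReal ‖e‖ *
        eLpNorm (fun y => gradient (φ k) y - weakGrad S w y) 2
          (volume.restrict (S ∩ Metric.ball x r₃)) := by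
      intro k
      refine le_trans ?_ (mul_le_mul_right (eLpNorm_mono_measure _
        (Measure.restrict_mono (inter_subset_inter_right _ hb₃) le_rfl)) _)
      refine eLpNorm_le_mul_eLpNorm_of_ae_le_mul (Eventually.of_forall fun y => ?_) 2
      rw [← inner_gradient, ← inner_sub_left, mul_comm]
      exact norm_inner_le_norm _ _
    refine tendsto_of_tendsto_of_tendsto_of_le_of_le tendsto_const_nhds ?_ (fun _ => bot_le) hle
    have := ENNReal.Tendsto.const_mul (a := ENNReal.ofReal ‖e‖) hφt.2
      (Or.inr ENNReal.ofReal_ne_top)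
    rwa [mul_zero] at this
  have t3 : Tendsto (fun k => ∫ y in F ∩ B, φ k y * ψ y ∂μHE[d - 1]) atTop
      (𝓝 (∫ y in F ∩ B, g y * ψ y ∂μHE[d - 1])) := by
    refine tendsto_integral_mul_of_tendsto_eLpNorm (fun k => ms (hφ k).continuous)
      (hg.memLp.mono_measure (Measure.restrict_mono inter_subset_left le_rfl))
      (ms hψ.1.continuous) ?_
    exact tendsto_of_tendsto_of_tendsto_of_le_of_le tendsto_const_nhds hφg (fun _ => bot_le)
      fun k => eLpNorm_mono_measure _ (Measure.restrict_mono (inter_subset_inter_right _ hb₃) le_rfl)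
  have t4 := tendsto_nhds_unique ((t1.add t2).congr key) (t3.const_mul ⟪n, e⟫)
  rw [hvol hS.measurableSet fun y hy => by simp [hψ1 y hy],
    hvol hS.measurableSet fun y hy => by simp [hψ0 y hy],
    hsurf hF.measurableSet fun y hy => by simp [hψ0 y hy], ← t4]
  simp only [mul_comm]

/-! ### Cutoffs around codimension-two planes -/

/-- Smooth cutoff functions vanishing near `Z` and converging to `1` elsewhere, with gradients
bounded in `L²`. -/
structure IsCutoffSeq {d : ℕ} (Z : Set (E d)) (R : ℝ) (Θ : ℕ → E d → ℝ) : Prop where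
  contDiff : ∀ m, ContDiff ℝ ∞ (Θ m)
  nonneg : ∀ m x, 0 ≤ Θ m x
  le_one : ∀ m x, Θ m x ≤ 1
  eventually_zero : ∀ m, ∀ x ∈ Z, Θ m =ᶠ[𝓝 x] 0
  eventually_one : ∀ x ∉ Z, ∀ᶠ m in atTop, Θ m =ᶠ[𝓝 x] 1
  gradient_le : ∃ C : ℝ≥0∞, C ≠ ⊤ ∧ ∀ m, ∫⁻ x in Metric.ball 0 R, ‖gradient (Θ m) x‖ₑ ^ 2 ≤ C

/-- In an orthonormal basis extending {a, b}, the set fits in a box with two sides of length 2h and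
all others of length 2R. The quadratic rate in h is what codimension two provides. -/
theorem exists_volume_inter_slabs_le {d : ℕ} {a b : E d} (ha : ‖a‖ = 1) (hb : ‖b‖ = 1)
    (hab : ⟪a, b⟫ = 0) (R : ℝ) : ∃ C : ℝ≥0∞, C ≠ ⊤ ∧ ∀ c e h : ℝ,
      volume (Metric.ball 0 R ∩ {x : E d | |⟪a, x⟫ - c| ≤ h ∧ |⟪b, x⟫ - e| ≤ h}) ≤
        C * ENNReal.ofReal (2 * h) ^ 2 := by
  classical
  have hne : a ≠ b := by
    rintro rfl
    simp [ha] at hab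
  have ho : Orthonormal ℝ ((↑) : ({a, b} : Set (E d)) → E d) := by
    rw [orthonormal_subtype_iff_ite]
    rintro v (rfl | rfl) w (rfl | rfl)
    · simp [ha]
    · simp [hne, hab]
    · rw [real_inner_comm]
      simp [hne.symm, hab]
    · simp [hb]
  obtain ⟨u, β, hu, hβ⟩ := ho.exists_orthonormalBasis_extension
  let i₀ : u := ⟨a, hu (by simp)⟩
  let i₁ : u := ⟨b, hu (by simp)⟩
  have hi : i₁ ≠ i₀ := fun h => hne (congrArg Subtype.val h).symm
  refine ⟨∏ _i ∈ (Finset.univ.erase i₀).erase i₁, ENNReal.ofReal (2 * R),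
    ENNReal.prod_ne_top fun _ _ => ENNReal.ofReal_ne_top, fun c e h => ?_⟩
  let I : u → Set ℝ := fun i => if i = i₀ then Icc (c - h) (c + h) else
    if i = i₁ then Icc (e - h) (e + h) else Icc (-R) R
  have hp : MeasurePreserving (fun x : E d => WithLp.ofLp (β.repr x)) volume volume :=
    (PiLp.volume_preserving_ofLp u).comp β.measurePreserving_repr
  have hIm : MeasurableSet (univ.pi I) := by
    refine MeasurableSet.univ_pi fun i => ?_
    simp only [I]
    split_ifs <;> exact measurableSet_Icc
  have hsub : Metric.ball 0 R ∩ {x : E d | |⟪a, x⟫ - c| ≤ h ∧ |⟪b, x⟫ - e| ≤ h} ⊆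
      (fun x : E d => WithLp.ofLp (β.repr x)) ⁻¹' (univ.pi I) := by
    rintro x ⟨hxR, hxa, hxb⟩ i -
    have hβi : ∀ i : u, β.repr x i = ⟪(i : E d), x⟫ := fun i => by
      rw [β.repr_apply_apply, hβ]
    simp only [I, hβi]
    split_ifs with h0 h1
    · subst h0
      have := abs_le.1 hxa
      exact ⟨by linarith, by linarith⟩
    · subst h1
      have := abs_le.1 hxb
      exact ⟨by linarith, by linarith⟩
    · have h2 : |⟪(i : E d), x⟫| ≤ ‖(i : E d)‖ * ‖x‖ := abs_real_inner_le_norm _ _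
      have h3 : ‖(i : E d)‖ = 1 := by
        have := β.norm_eq_one i
        rwa [hβ] at this
      rw [mem_ball_zero_iff] at hxR
      rw [h3, one_mul] at h2
      exact abs_le.1 (h2.trans hxR.le)
  refine (measure_mono hsub).trans ?_
  rw [hp.measure_preimage hIm.nullMeasurableSet, volume_pi_pi,
    ← Finset.mul_prod_erase _ _ (Finset.mem_univ i₀),
    ← Finset.mul_prod_erase _ _ (Finset.mem_erase.2 ⟨hi, Finset.mem_univ i₁⟩)]
  have e0 : volume (I i₀) = ENNReal.ofReal (2 * h) := by
    simp only [I, if_true, Real.volume_Icc]; congr 1; ring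
  have e1 : volume (I i₁) = ENNReal.ofReal (2 * h) := by
    simp only [I, if_neg hi, if_true, Real.volume_Icc]; congr 1; ring
  have e2 : ∏ i ∈ (Finset.univ.erase i₀).erase i₁, volume (I i) =
      ∏ _i ∈ (Finset.univ.erase i₀).erase i₁, ENNReal.ofReal (2 * R) := by
    refine Finset.prod_congr rfl fun i hi' => ?_
    simp only [Finset.mem_erase, Finset.mem_univ, and_true] at hi'
    simp only [I, if_neg hi'.1, if_neg hi'.2, Real.volume_Icc]; congr 1; ring
  rw [e0, e1, e2]
  exact le_of_eq (by ring)

theorem exists_deriv_smoothTransition_le : ∃ K : ℝ, 0 ≤ K ∧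
    ∀ t, |deriv Real.smoothTransition t| ≤ K := by
  have hc : Continuous (deriv Real.smoothTransition) :=
    (Real.smoothTransition.contDiff (n := 1)).continuous_deriv le_rfl
  obtain ⟨K, hK⟩ := (isCompact_Icc (a := (0 : ℝ)) (b := 1)).exists_bound_of_continuousOn
    hc.continuousOn
  refine ⟨max K 0, le_max_right _ _, fun t => ?_⟩
  by_cases ht : t ∈ Icc (0 : ℝ) 1
  · exact (hK t ht).trans (le_max_left _ _)
  · have : deriv Real.smoothTransition t = 0 := by
      rw [mem_Icc, not_and_or, not_le, not_le] at ht
      obtain ht | ht := ht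
      · have : Real.smoothTransition =ᶠ[𝓝 t] fun _ => 0 :=
          (gt_mem_nhds ht).mono fun s hs => Real.smoothTransition.zero_of_nonpos (le_of_lt hs)
        rw [this.deriv_eq, deriv_const]
      · have : Real.smoothTransition =ᶠ[𝓝 t] fun _ => 1 :=
          (lt_mem_nhds ht).mono fun s hs => Real.smoothTransition.one_of_one_le (le_of_lt hs)
        rw [this.deriv_eq, deriv_const]
    rw [this, abs_zero]
    exact le_max_right _ _

/-- With q the squared distance to the plane, the cutoff passes from 0 to 1 at distances of order
1/M. Its gradient is of order M on a tube of volume of order 1/M², so its energy is bounded. It need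
not tend to zero. -/
theorem exists_isCutoffSeq_inter_hyperplane {d : ℕ} {a b : E d} (ha : ‖a‖ = 1) (hb : ‖b‖ = 1)
    (hab : ⟪a, b⟫ = 0) (c e R : ℝ) :
    ∃ Θ, IsCutoffSeq (hyperplane a c ∩ hyperplane b e) R Θ := by
  obtain ⟨K, hK0, hK⟩ := exists_deriv_smoothTransition_le
  obtain ⟨C, hC, hvol⟩ := exists_volume_inter_slabs_le ha hb hab R
  set q : E d → ℝ := fun x => (⟪a, x⟫ - c) ^ 2 + (⟪b, x⟫ - e) ^ 2 with hq
  have hin : ∀ v : E d, ContDiff ℝ ∞ fun x => ⟪v, x⟫ := fun v => (innerSL ℝ v).contDiff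
  have hqs : ContDiff ℝ ∞ q :=
    (((hin a).sub contDiff_const).pow 2).add (((hin b).sub contDiff_const).pow 2)
  have hqc : Continuous q := hqs.continuous
  set M : ℕ → ℝ := fun m => (m : ℝ) + 1 with hM
  have hM0 : ∀ m, 0 < M m := fun m => by positivity
  set p : ℕ → E d → ℝ := fun m x => M m ^ 2 * q x - 1 with hp
  have hps : ∀ m, ContDiff ℝ ∞ (p m) := fun m => (contDiff_const.mul hqs).sub contDiff_const
  set Θ : ℕ → E d → ℝ := fun m x => Real.smoothTransition (p m x) with hΘ
  have hzero : ∀ m x, p m x < 0 → Θ m =ᶠ[𝓝 x] 0 := fun m x hx =>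
    ((hps m).continuous.tendsto x |>.eventually (gt_mem_nhds hx)).mono fun y hy =>
      Real.smoothTransition.zero_of_nonpos (le_of_lt hy)
  have hone : ∀ m x, 1 < p m x → Θ m =ᶠ[𝓝 x] 1 := fun m x hx =>
    ((hps m).continuous.tendsto x |>.eventually (lt_mem_nhds hx)).mono fun y hy =>
      Real.smoothTransition.one_of_one_le (le_of_lt hy)
  have hqZ : ∀ x, x ∉ hyperplane a c ∩ hyperplane b e → 0 < q x := by
    intro x hx
    refine lt_of_le_of_ne (by positivity) fun h0 => hx ?_
    have h1 : (⟪a, x⟫ - c) ^ 2 = 0 := by nlinarith [sq_nonneg (⟪a, x⟫ - c), sq_nonneg (⟪b, x⟫ - e)]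
    have h2 : (⟪b, x⟫ - e) ^ 2 = 0 := by nlinarith [sq_nonneg (⟪a, x⟫ - c), sq_nonneg (⟪b, x⟫ - e)]
    exact ⟨sub_eq_zero.1 (pow_eq_zero_iff two_ne_zero |>.1 h1),
      sub_eq_zero.1 (pow_eq_zero_iff two_ne_zero |>.1 h2)⟩
  -- Outside N m one has M² q > 4, so `p m` exceeds 1 and the cutoff is locally constant.
  set N : ℕ → Set (E d) := fun m => {x | |⟪a, x⟫ - c| ≤ 2 / M m ∧ |⟪b, x⟫ - e| ≤ 2 / M m} with hN
  have hNm : ∀ m, MeasurableSet (N m) := fun m =>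
    (measurableSet_le (f := fun x => |⟪a, x⟫ - c|) (by fun_prop) measurable_const).inter
      (measurableSet_le (f := fun x => |⟪b, x⟫ - e|) (by fun_prop) measurable_const)
  have hgrad : ∀ m x, ‖gradient (Θ m) x‖ₑ ^ 2 ≤
      (N m).indicator (fun _ => ENNReal.ofReal (8 * K * M m) ^ 2) x := by
    intro m x
    by_cases hx : x ∈ N m
    · rw [indicator_of_mem hx]
      refine pow_le_pow_left' ?_ 2
      rw [← ofReal_norm]
      refine ENNReal.ofReal_le_ofReal ?_
      have hd : HasFDerivAt (Θ m) (deriv Real.smoothTransition (p m x) • (M m ^ 2 •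
          ((2 * (⟪a, x⟫ - c)) • innerSL ℝ a + (2 * (⟪b, x⟫ - e)) • innerSL ℝ b))) x := by
        have hl : ∀ (v : E d) (t : ℝ), HasFDerivAt (fun x => (⟪v, x⟫ - t) ^ 2)
            ((2 * (⟪v, x⟫ - t)) • innerSL ℝ v) x := by
          intro v t
          have := (((innerSL ℝ v).hasFDerivAt (x := x)).sub_const t).pow 2
          simpa using this
        have h1 : HasFDerivAt (p m) (M m ^ 2 •
            ((2 * (⟪a, x⟫ - c)) • innerSL ℝ a + (2 * (⟪b, x⟫ - e)) • innerSL ℝ b)) x :=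
          (((hl a c).add (hl b e)).const_mul (M m ^ 2)).sub_const 1
        have h2 : HasDerivAt Real.smoothTransition (deriv Real.smoothTransition (p m x)) (p m x) :=
          ((Real.smoothTransition.contDiff (n := 1)).differentiable one_ne_zero _).hasDerivAt
        exact h2.comp_hasFDerivAt x h1
      rw [gradient, LinearIsometryEquiv.norm_map, hd.fderiv, norm_smul, norm_smul,
        Real.norm_of_nonneg (sq_nonneg (M m))]
      have h3 : ‖(2 * (⟪a, x⟫ - c)) • innerSL ℝ a + (2 * (⟪b, x⟫ - e)) • innerSL ℝ b‖ ≤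
          8 / M m := by
        refine (norm_add_le _ _).trans ?_
        rw [norm_smul, norm_smul, innerSL_apply_norm, innerSL_apply_norm, ha, hb, norm_mul, norm_mul]
        simp only [Real.norm_eq_abs, mul_one, abs_two]
        have := hx.1
        have := hx.2
        have : 8 / M m = 2 * (2 / M m) + 2 * (2 / M m) := by ring
        linarith
      calc _ ≤ K * (M m ^ 2 * (8 / M m)) := by
            gcongr
            exact hK _
        _ = 8 * K * M m := by field_simp [(hM0 m).ne']
    · rw [indicator_of_notMem hx]
      have : Θ m =ᶠ[𝓝 x] 1 := by
        refine hone m x ?_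
        have hMq : 2 < M m ^ 2 * q x := by
          simp only [hN, mem_ofPred_eq, not_and_or, not_le] at hx
          have aux : ∀ t : ℝ, 2 / M m < |t| → 4 < M m ^ 2 * t ^ 2 := by
            intro t ht
            rw [div_lt_iff₀ (hM0 m)] at ht
            rw [← sq_abs t]
            nlinarith [hM0 m, abs_nonneg t]
          simp only [hq]
          obtain h | h := hx
          · nlinarith [aux _ h, mul_nonneg (sq_nonneg (M m)) (sq_nonneg (⟪b, x⟫ - e))]
          · nlinarith [aux _ h, mul_nonneg (sq_nonneg (M m)) (sq_nonneg (⟪a, x⟫ - c))]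
        simp only [hp]
        linarith
      have h0 : fderiv ℝ (Θ m) x = 0 := by
        rw [this.fderiv_eq]
        exact fderiv_const_apply 1
      simp [gradient, h0]
  refine ⟨Θ, fun m => Real.smoothTransition.contDiff.comp (hps m), fun m x =>
    Real.smoothTransition.nonneg _, fun m x => Real.smoothTransition.le_one _, ?_, ?_, ?_⟩
  · rintro m x ⟨hxa, hxb⟩
    refine hzero m x ?_
    have hxa' : ⟪a, x⟫ = c := hxa
    have hxb' : ⟪b, x⟫ = e := hxb
    simp [hp, hq, hxa', hxb']
  · intro x hx
    have hqx := hqZ x hx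
    have ht : Tendsto (fun m => p m x) atTop atTop := by
      have h1 : Tendsto M atTop atTop :=
        tendsto_atTop_add_const_right _ _ tendsto_natCast_atTop_atTop
      exact tendsto_atTop_add_const_right _ _
        (((tendsto_pow_atTop two_ne_zero).comp h1).atTop_mul_const hqx)
    exact (ht.eventually_gt_atTop 1).mono fun m hm => hone m x hm
  -- The gradient bound 8 K M times the slab width 2 · (2 / M) is 32 K: the powers of M cancel.
  · refine ⟨C * ENNReal.ofReal (32 * K) ^ 2, ENNReal.mul_ne_top hC (by finiteness), fun m => ?_⟩
    refine (lintegral_mono (hgrad m)).trans ?_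
    rw [lintegral_indicator (hNm m), lintegral_const, Measure.restrict_apply MeasurableSet.univ,
      univ_inter, Measure.restrict_apply (hNm m), inter_comm]
    refine (mul_le_mul_right (hvol c e (2 / M m)) _).trans (le_of_eq ?_)
    rw [mul_comm, mul_assoc, ← mul_pow, ← ENNReal.ofReal_mul (by have := hM0 m; positivity)]
    congr 3
    have := (hM0 m).ne'
    field_simp
    ring

theorem IsCutoffSeq.mul {d : ℕ} {Z₁ Z₂ : Set (E d)} {R : ℝ} {Θ₁ Θ₂ : ℕ → E d → ℝ}
    (h₁ : IsCutoffSeq Z₁ R Θ₁) (h₂ : IsCutoffSeq Z₂ R Θ₂) :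
    IsCutoffSeq (Z₁ ∪ Z₂) R fun m x => Θ₁ m x * Θ₂ m x := by
  obtain ⟨C₁, hC₁, hg₁⟩ := h₁.gradient_le
  obtain ⟨C₂, hC₂, hg₂⟩ := h₂.gradient_le
  refine ⟨fun m => (h₁.contDiff m).mul (h₂.contDiff m), fun m x => mul_nonneg (h₁.nonneg m x)
    (h₂.nonneg m x), fun m x => mul_le_one₀ (h₁.le_one m x) (h₂.nonneg m x) (h₂.le_one m x),
    ?_, ?_, 2 * (C₁ + C₂), by finiteness, fun m => ?_⟩
  · rintro m x (hx | hx)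
    · filter_upwards [h₁.eventually_zero m x hx] with y hy
      simp [hy]
    · filter_upwards [h₂.eventually_zero m x hx] with y hy
      simp [hy]
  · intro x hx
    rw [mem_union, not_or] at hx
    filter_upwards [h₁.eventually_one x hx.1, h₂.eventually_one x hx.2] with m h1 h2
    filter_upwards [h1, h2] with y hy1 hy2
    simp [hy1, hy2]
  · have hle : ∀ x, ‖gradient (fun x => Θ₁ m x * Θ₂ m x) x‖ₑ ^ 2 ≤
        2 * (‖gradient (Θ₁ m) x‖ₑ ^ 2 + ‖gradient (Θ₂ m) x‖ₑ ^ 2) := by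
      intro x
      have h1 : ‖gradient (fun x => Θ₁ m x * Θ₂ m x) x‖ₑ ≤
          ‖gradient (Θ₁ m) x‖ₑ + ‖gradient (Θ₂ m) x‖ₑ := by
        rw [← ofReal_norm, ← ofReal_norm, ← ofReal_norm,
          ← ENNReal.ofReal_add (norm_nonneg _) (norm_nonneg _)]
        refine ENNReal.ofReal_le_ofReal ?_
        simp only [gradient, LinearIsometryEquiv.norm_map]
        rw [fderiv_fun_mul ((h₁.contDiff m).differentiable (by simp) x)
          ((h₂.contDiff m).differentiable (by simp) x), add_comm]
        have hb : ∀ {t : ℝ}, 0 ≤ t → t ≤ 1 → ∀ L : E d →L[ℝ] ℝ, ‖t • L‖ ≤ ‖L‖ := by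
          intro t h0 h1 L
          rw [norm_smul, Real.norm_of_nonneg h0]
          exact mul_le_of_le_one_left (norm_nonneg _) h1
        exact (norm_add_le _ _).trans (add_le_add (hb (h₂.nonneg m x) (h₂.le_one m x) _)
          (hb (h₁.nonneg m x) (h₁.le_one m x) _))
      refine (pow_le_pow_left' h1 2).trans ?_
      rw [mul_add]
      exact ennreal_add_sq_le _ _
    refine (lintegral_mono hle).trans ?_
    have hm : Measurable fun x => ‖gradient (Θ₁ m) x‖ₑ ^ 2 :=
      (continuous_gradient ((h₁.contDiff m).of_le (by simp))).enorm.measurable.pow_const 2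
    rw [lintegral_const_mul' _ _ (by simp), lintegral_add_left hm]
    gcongr
    · exact hg₁ m
    · exact hg₂ m

theorem exists_isCutoffSeq {d : ℕ} (R : ℝ) {ℒ : Set ((E d × ℝ) × (E d × ℝ))} (hℒ : ℒ.Finite)
    (h : ∀ p ∈ ℒ, ‖p.1.1‖ = 1 ∧ ‖p.2.1‖ = 1 ∧ ⟪p.1.1, p.2.1⟫ = 0) :
    ∃ Θ, IsCutoffSeq (⋃ p ∈ ℒ, hyperplane p.1.1 p.1.2 ∩ hyperplane p.2.1 p.2.2) R Θ := by
  induction ℒ, hℒ using Set.Finite.induction_on with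
  | empty =>
    refine ⟨fun _ _ => 1, fun m => contDiff_const, fun m x => zero_le_one, fun m x => le_rfl,
      by simp, fun x _ => Eventually.of_forall fun m => EventuallyEq.rfl, 0, by simp, fun m => ?_⟩
    simp [gradient]
  | @insert p ℒ _ _ ih =>
    obtain ⟨Θ₂, h₂⟩ := ih fun q hq => h q (mem_insert_of_mem _ hq)
    obtain ⟨h1, h2, h3⟩ := h p (mem_insert _ _)
    obtain ⟨Θ₁, h₁⟩ := exists_isCutoffSeq_inter_hyperplane h1 h2 h3 p.1.2 p.2.2 R
    rw [biUnion_insert]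
    exact ⟨_, h₁.mul h₂⟩

/-! ### Green's formula and the divergence theorem on a polytope -/

/-- The open polytope `S` has the flat faces `face k`, `k ∈ s`, with outward unit normals `n k`. -/
structure HasFlatFaces {d : ℕ} {κ : Type*} (S : Set (E d)) (s : Finset κ) (face : κ → Set (E d))
    (n : κ → E d) (c : κ → ℝ) : Prop where
  isPolytope : IsPolytope S
  isFlatFace : ∀ k ∈ s, IsFlatFace S (face k) (n k) (c k)
  subset_frontier : ∀ k ∈ s, face k ⊆ frontier S
  disjoint : ∀ k ∈ s, ∀ l ∈ s, k ≠ l → Disjoint (face k) (face l)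
  frontier_subset : frontier S ⊆ ⋃ k ∈ s, closure (face k)
  skeleton : ∀ k ∈ s, ∃ 𝓛 : Set (E d × ℝ), 𝓛.Finite ∧
      (∀ p ∈ 𝓛, ‖p.1‖ = 1 ∧ ⟪n k, p.1⟫ = 0) ∧
      closure (face k) \ face k ⊆ ⋃ p ∈ 𝓛, hyperplane (n k) (c k) ∩ hyperplane p.1 p.2

/-- The defect in Green's formula on `S` for the test function `ψ`. -/
noncomputable def greenDefect {d : ℕ} {κ : Type*} (S : Set (E d)) (s : Finset κ)
    (face : κ → Set (E d)) (n : κ → E d) (w : E d → ℝ) (g : κ → E d → ℝ) (e : E d)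
    (ψ : E d → ℝ) : ℝ :=
  ((∫ y in S, w y * fderiv ℝ ψ y e) + ∫ y in S, ψ y * ⟪weakGrad S w y, e⟫) -
    ∑ k ∈ s, ⟪n k, e⟫ * ∫ y in face k, g k y * ψ y ∂μHE[d - 1]

namespace HasFlatFaces

variable {d : ℕ} {κ : Type*} {S : Set (E d)} {s : Finset κ} {face : κ → Set (E d)}
  {n : κ → E d} {c : κ → ℝ} {w : E d → ℝ} {g : κ → E d → ℝ}

theorem memLp_of_continuous (h : HasFlatFaces S s face n c) {f : E d → ℝ} (hf : Continuous f) :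
    MemLp f 2 (volume.restrict S) :=
  memLp_restrict_of_isBounded h.isPolytope.isOpen.measurableSet h.isPolytope.1
    h.isPolytope.1.measure_lt_top hf 2

theorem memLp_face_of_continuous (h : HasFlatFaces S s face n c) {k : κ} (hk : k ∈ s)
    {f : E d → ℝ} (hf : Continuous f) :
    MemLp f 2 ((μHE[d - 1] : Measure (E d)).restrict (face k)) :=
  memLp_restrict_of_isBounded (h.isFlatFace k hk).measurableSet (h.isFlatFace k hk).isBounded
    (euclideanHausdorffMeasure_hyperplane_lt_top (h.isFlatFace k hk).norm_eq (c k)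
      (h.isFlatFace k hk).isBounded (h.isFlatFace k hk).subset_hyperplane) hf 2

theorem greenDefect_sub (h : HasFlatFaces S s face n c) (hw : MemH1 S w)
    (hg : ∀ k ∈ s, IsTrace S (face k) w (g k)) (e : E d) {ψ₁ ψ₂ : E d → ℝ}
    (h₁ : ContDiff ℝ ∞ ψ₁) (h₂ : ContDiff ℝ ∞ ψ₂) :
    greenDefect S s face n w g e (fun x => ψ₁ x - ψ₂ x) =
      greenDefect S s face n w g e ψ₁ - greenDefect S s face n w g e ψ₂ := by
  have hGe : MemLp (fun y => ⟪weakGrad S w y, e⟫) 2 (volume.restrict S) :=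
    (hw.memLp_weakGrad h.isPolytope.isOpen).inner_const e
  have hd : ∀ {ψ}, ContDiff ℝ ∞ ψ → Integrable (fun y => w y * fderiv ℝ ψ y e)
      (volume.restrict S) := fun hψ =>
    hw.1.integrable_mul (h.memLp_of_continuous (IsTestFunction.continuous_fderiv_apply hψ e))
  have hv : ∀ {ψ}, ContDiff ℝ ∞ ψ → Integrable (fun y => ψ y * ⟪weakGrad S w y, e⟫)
      (volume.restrict S) := fun hψ => (h.memLp_of_continuous hψ.continuous).integrable_mul hGe
  have hf : ∀ {ψ}, ContDiff ℝ ∞ ψ → ∀ k ∈ s, Integrable (fun y => g k y * ψ y)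
      ((μHE[d - 1] : Measure (E d)).restrict (face k)) := fun hψ k hk =>
    (hg k hk).memLp.integrable_mul (h.memLp_face_of_continuous hk hψ.continuous)
  have e1 : ∀ y, w y * fderiv ℝ (fun x => ψ₁ x - ψ₂ x) y e =
      w y * fderiv ℝ ψ₁ y e - w y * fderiv ℝ ψ₂ y e := by
    intro y
    rw [fderiv_fun_sub (h₁.differentiable (by simp) y) (h₂.differentiable (by simp) y)]
    simp [mul_sub]
  simp only [greenDefect, e1]
  have e3 : ∑ k ∈ s, ⟪n k, e⟫ * ∫ y in face k, g k y * (ψ₁ y - ψ₂ y) ∂μHE[d - 1] =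
      (∑ k ∈ s, ⟪n k, e⟫ * ∫ y in face k, g k y * ψ₁ y ∂μHE[d - 1]) -
        ∑ k ∈ s, ⟪n k, e⟫ * ∫ y in face k, g k y * ψ₂ y ∂μHE[d - 1] := by
    rw [← Finset.sum_sub_distrib]
    refine Finset.sum_congr rfl fun k hk => ?_
    simp only [mul_sub]
    rw [integral_sub (hf h₁ k hk) (hf h₂ k hk), mul_sub]
  rw [e3, integral_sub (hd h₁) (hd h₂)]
  simp only [sub_mul]
  rw [integral_sub (hv h₁) (hv h₂)]
  ring

theorem greenDefect_eq_zero_of_eqOn (h : HasFlatFaces S s face n c) (e : E d) {ψ : E d → ℝ}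
    {U : Set (E d)} (hU : IsOpen U) (hSU : closure S ⊆ U) (hψ : ∀ x ∈ U, ψ x = 0) :
    greenDefect S s face n w g e ψ = 0 := by
  have hd : ∀ x ∈ U, fderiv ℝ ψ x = 0 := fun x hx => by
    have : ψ =ᶠ[𝓝 x] fun _ => 0 := eventually_of_mem (hU.mem_nhds hx) hψ
    rw [this.fderiv_eq, fderiv_const_apply]
  have hSm := h.isPolytope.isOpen.measurableSet
  have hS : S ⊆ U := subset_closure.trans hSU
  have hF : ∀ k ∈ s, face k ⊆ U := fun k hk =>
    (h.subset_frontier k hk).trans (frontier_subset_closure.trans hSU)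
  rw [greenDefect, setIntegral_eq_zero_of_forall_eq_zero fun x hx => by simp [hd x (hS hx)],
    setIntegral_eq_zero_of_forall_eq_zero fun x hx => by simp [hψ x (hS hx)],
    Finset.sum_eq_zero fun k hk => ?_]
  · simp
  · rw [setIntegral_eq_zero_of_forall_eq_zero fun x hx => by simp [hψ x (hF k hk hx)], mul_zero]

theorem mem_or_mem_face_or_mem_skeleton (h : HasFlatFaces S s face n c) {x : E d}
    (hx : x ∈ closure S) :
    x ∈ S ∨ (∃ k ∈ s, x ∈ face k) ∨ ∃ k ∈ s, x ∈ closure (face k) \ face k := by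
  by_cases hxS : x ∈ S
  · exact Or.inl hxS
  · right
    have : x ∈ frontier S := by rw [h.isPolytope.isOpen.frontier_eq]; exact ⟨hx, hxS⟩
    obtain ⟨k, hk, hxk⟩ := mem_iUnion₂.1 (h.frontier_subset this)
    by_cases hxF : x ∈ face k
    · exact Or.inl ⟨k, hk, hxF⟩
    · exact Or.inr ⟨k, hk, hxk, hxF⟩

/-- At an interior point this is the definition of the weak gradient; at a point of a face, the
local Green formula, no other face meeting a small ball; at a skeleton point, ψ itself vanishes. The
free factor η makes the radius independent of the cutoffs already applied to ψ in the covering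
argument. -/
theorem exists_ball_greenDefect_eq_zero (h : HasFlatFaces S s face n c) (hw : MemH1 S w)
    (hg : ∀ k ∈ s, IsTrace S (face k) w (g k)) (e : E d) {ψ : E d → ℝ} (hψ : ContDiff ℝ ∞ ψ)
    (hψ0 : ∀ k ∈ s, ∀ x ∈ closure (face k) \ face k, ψ =ᶠ[𝓝 x] 0) {x : E d} (hx : x ∈ closure S) :
    ∃ r > 0, ∀ χ, IsTestFunction (Metric.ball x r) χ → ∀ η, ContDiff ℝ ∞ η →
      greenDefect S s face n w g e (fun y => χ y * (η y * ψ y)) = 0 := by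
  classical
  have hSo := h.isPolytope.isOpen
  have htest : ∀ {r : ℝ} {χ η : E d → ℝ}, IsTestFunction (Metric.ball x r) χ → ContDiff ℝ ∞ η →
      IsTestFunction (Metric.ball x r) fun y => χ y * (η y * ψ y) := fun hχ hη =>
    ⟨hχ.1.mul (hη.mul hψ), hχ.2.1.mul_right, (tsupport_mul_subset_left).trans hχ.2.2⟩
  obtain hxS | ⟨k, hk, hxk⟩ | ⟨k, hk, hxk⟩ := h.mem_or_mem_face_or_mem_skeleton hx
  · obtain ⟨r, hr, hball⟩ := Metric.isOpen_iff.1 hSo x hxS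
    refine ⟨r, hr, fun χ hχ η hη => ?_⟩
    have ht := htest hχ hη
    have ht' : IsTestFunction S _ := ⟨ht.1, ht.2.1, ht.2.2.trans hball⟩
    rw [greenDefect, hw.hasWeakGradient.integral_mul_fderiv hw.1 (hw.memLp_weakGrad hSo) ht' e,
      neg_add_cancel, zero_sub, neg_eq_zero]
    refine Finset.sum_eq_zero fun k hk => ?_
    rw [setIntegral_eq_zero_of_forall_eq_zero fun y hy => ?_, mul_zero]
    have hyS : y ∉ S := fun hyS => by
      have := h.subset_frontier k hk hy
      rw [hSo.frontier_eq] at this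
      exact this.2 hyS
    have : χ y = 0 := image_eq_zero_of_notMem_tsupport fun hy' => hyS (hball (hχ.2.2 hy'))
    simp [this]
  · have hF := h.isFlatFace k hk
    obtain ⟨r₁, hr₁, hgreen⟩ := hF.exists_green hSo hw (hg k hk) hxk
    obtain ⟨r₂, hr₂, hside⟩ := hF.side x hxk
    obtain ⟨r₃, hr₃, hFr⟩ := Metric.mem_nhdsWithin_iff.1 (hF.mem_nhdsWithin x hxk)
    set r := min r₁ (min r₂ r₃)
    have hb₁ : Metric.ball x r ⊆ Metric.ball x r₁ := Metric.ball_subset_ball (min_le_left _ _)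
    have hb₂ : Metric.ball x r ⊆ Metric.ball x r₂ :=
      Metric.ball_subset_ball ((min_le_right _ _).trans (min_le_left _ _))
    have hb₃ : Metric.ball x r ⊆ Metric.ball x r₃ :=
      Metric.ball_subset_ball ((min_le_right _ _).trans (min_le_right _ _))
    refine ⟨r, lt_min hr₁ (lt_min hr₂ hr₃), fun χ hχ η hη => ?_⟩
    have ht := htest hχ hη
    rw [greenDefect, hgreen _ ⟨ht.1, ht.2.1, ht.2.2.trans hb₁⟩ e, sub_eq_zero]
    symm
    refine Finset.sum_eq_single_of_mem k hk fun l hl hlk => ?_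
    rw [setIntegral_eq_zero_of_forall_eq_zero fun y hy => ?_, mul_zero]
    have hyb : y ∉ Metric.ball x r := fun hyb => by
      have h1 := inner_sub_eq_zero_of_mem_frontier hSo hside (hb₂ hyb)
        (h.subset_frontier l hl hy)
      have h2 : y ∈ face k := by
        refine hFr ⟨hb₃ hyb, ?_⟩
        have hxc : ⟪n k, x⟫ = c k := hF.subset_hyperplane hxk
        rw [inner_sub_right, hxc, sub_eq_zero] at h1
        exact h1
      exact disjoint_left.1 (h.disjoint l hl k hk hlk) hy h2
    have : χ y = 0 := image_eq_zero_of_notMem_tsupport fun hy' => hyb (hχ.2.2 hy')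
    simp [this]
  · obtain ⟨r, hr, hball⟩ := Metric.eventually_nhds_iff_ball.1 (hψ0 k hk x hxk)
    refine ⟨r, hr, fun χ hχ η _ => ?_⟩
    have : (fun y => χ y * (η y * ψ y)) = fun _ => 0 := by
      ext y
      by_cases hy : y ∈ Metric.ball x r
      · have : ψ y = 0 := hball y hy
        simp [this]
      · have : χ y = 0 := image_eq_zero_of_notMem_tsupport fun hy' => hy (hχ.2.2 hy')
        simp [this]
    rw [this]
    exact h.greenDefect_eq_zero_of_eqOn e isOpen_univ (subset_univ _) fun _ _ => rfl

/-- Green's formula for smooth functions vanishing near the relative boundaries of the faces. -/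
theorem greenDefect_eq_zero (h : HasFlatFaces S s face n c) (hw : MemH1 S w)
    (hg : ∀ k ∈ s, IsTrace S (face k) w (g k)) (e : E d) {ψ : E d → ℝ} (hψ : ContDiff ℝ ∞ ψ)
    (hψ0 : ∀ k ∈ s, ∀ x ∈ closure (face k) \ face k, ψ =ᶠ[𝓝 x] 0) :
    greenDefect S s face n w g e ψ = 0 := by
  classical
  have hloc : ∀ x ∈ closure S, _ := fun x hx =>
    h.exists_ball_greenDefect_eq_zero hw hg e hψ hψ0 hx
  choose! r hr hr0 using hloc
  have hK : IsCompact (closure S) :=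
    Metric.isCompact_of_isClosed_isBounded isClosed_closure h.isPolytope.1.closure
  obtain ⟨t, htS, htc⟩ := hK.elim_nhds_subcover (fun x => Metric.ball x (r x / 3))
    fun x hx => Metric.ball_mem_nhds x (by have := hr x hx; positivity)
  have hbump : ∀ x : E d, ∃ χ : E d → ℝ, ContDiff ℝ ∞ χ ∧ (x ∈ closure S →
      IsTestFunction (Metric.ball x (r x)) χ ∧ ∀ y ∈ Metric.ball x (r x / 3), χ y = 1) := by
    intro x
    by_cases hx : x ∈ closure S
    · have hrx := hr x hx
      let b : ContDiffBump x := ⟨r x / 3, r x / 2, by positivity, by linarith⟩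
      refine ⟨b, b.contDiff, fun _ => ⟨⟨b.contDiff, b.hasCompactSupport, ?_⟩, fun y hy => ?_⟩⟩
      · rw [b.tsupport_eq]
        exact Metric.closedBall_subset_ball (by change r x / 2 < r x; linarith)
      · exact b.one_of_mem_closedBall (Metric.ball_subset_closedBall hy)
    · exact ⟨fun _ => 0, contDiff_const, fun h => absurd h hx⟩
  choose χ hχs hχ using hbump
  have hprod : ∀ t : Finset (E d), ContDiff ℝ ∞ fun y => ∏ x ∈ t, (1 - χ x y) := fun t =>
    contDiff_prod fun x _ => contDiff_const.sub (hχs x)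
  -- Replacing ψ by (1 - χ x) ψ does not change the defect, by the local result. After one such step
  -- per ball of the cover, the function vanishes in a neighbourhood of the closure of S.
  have key : ∀ t : Finset (E d), (∀ x ∈ t, x ∈ closure S) →
      greenDefect S s face n w g e (fun y => (∏ x ∈ t, (1 - χ x y)) * ψ y) =
        greenDefect S s face n w g e ψ := by
    intro t
    induction t using Finset.induction_on with
    | empty => simp
    | @insert x t hxt ih =>
      intro ht
      have hx := ht x (Finset.mem_insert_self _ _)
      rw [← ih fun y hy => ht y (Finset.mem_insert_of_mem hy)]
      have e1 : (fun y => (∏ x ∈ insert x t, (1 - χ x y)) * ψ y) = fun y =>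
          (∏ x ∈ t, (1 - χ x y)) * ψ y - χ x y * ((∏ x ∈ t, (1 - χ x y)) * ψ y) := by
        ext y
        rw [Finset.prod_insert hxt]
        ring
      rw [e1, h.greenDefect_sub hw hg e ((hprod t).mul hψ) ((hχs x).mul ((hprod t).mul hψ)),
        hr0 x hx _ (hχ x hx).1 _ (hprod t), sub_zero]
  rw [← key t htS]
  refine h.greenDefect_eq_zero_of_eqOn e (isOpen_biUnion fun x _ => Metric.isOpen_ball) htc
    fun y hy => ?_
  obtain ⟨x, hxt, hyx⟩ := mem_iUnion₂.1 hy
  rw [Finset.prod_eq_zero hxt (by rw [(hχ x (htS x hxt)).2 y hyx, sub_self]), zero_mul]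

end HasFlatFaces

theorem sq_lintegral_mul_le {α : Type*} [MeasurableSpace α] (μ : Measure α) {f g : α → ℝ≥0∞}
    (hf : AEMeasurable f μ) (hg : AEMeasurable g μ) :
    (∫⁻ x, f x * g x ∂μ) ^ 2 ≤ (∫⁻ x, f x ^ 2 ∂μ) * ∫⁻ x, g x ^ 2 ∂μ := by
  have h := ENNReal.lintegral_mul_le_Lp_mul_Lq μ Real.HolderConjugate.two_two hf hg
  calc _ ≤ ((∫⁻ x, f x ^ (2 : ℝ) ∂μ) ^ (1 / 2 : ℝ) * (∫⁻ x, g x ^ (2 : ℝ) ∂μ) ^ (1 / 2 : ℝ)) ^ 2 :=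
        pow_le_pow_left' h 2
    _ = _ := by
      rw [mul_pow, ← ENNReal.rpow_natCast, ← ENNReal.rpow_natCast, ← ENNReal.rpow_mul,
        ← ENNReal.rpow_mul]
      norm_num

/-- The gradients are only bounded in L², but each point off Z eventually leaves the sets where they
are nonzero. The L² mass of w on these sets tends to zero by dominated convergence, and
Cauchy–Schwarz concludes. -/
theorem IsCutoffSeq.tendsto_integral_mul_fderiv {d : ℕ} {Z S : Set (E d)} {R : ℝ}
    {Θ : ℕ → E d → ℝ} (hΘ : IsCutoffSeq Z R Θ) (hZ : volume Z = 0) (hSR : S ⊆ Metric.ball 0 R)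
    {w : E d → ℝ} (hw : MemLp w 2 (volume.restrict S)) (e : E d) :
    Tendsto (fun m => ∫ y in S, w y * fderiv ℝ (Θ m) y e) atTop (𝓝 0) := by
  obtain ⟨C, hC, hle⟩ := hΘ.gradient_le
  set N : ℕ → Set (E d) := fun m => {y | gradient (Θ m) y ≠ 0} with hN
  have hgc : ∀ m, Continuous (gradient (Θ m)) := fun m =>
    continuous_gradient ((hΘ.contDiff m).of_le (by simp))
  have hNm : ∀ m, MeasurableSet (N m) := fun m =>
    ((isClosed_singleton.preimage (hgc m)).isOpen_compl).measurableSet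
  set a : ℕ → ℝ≥0∞ := fun m => ∫⁻ y in S, (N m).indicator (fun y => ‖w y‖ₑ) y ^ 2 with ha
  have ha0 : Tendsto a atTop (𝓝 0) := by
    have hfin : ∫⁻ y in S, ‖w y‖ₑ ^ 2 ≠ ⊤ := by
      rw [← eLpNorm_two_sq]
      exact ENNReal.pow_ne_top hw.eLpNorm_lt_top.ne
    rw [← lintegral_zero (μ := volume.restrict S)]
    refine tendsto_lintegral_of_dominated_convergence' _
      (fun m => (hw.1.enorm.indicator (hNm m)).pow_const 2)
      (fun m => Eventually.of_forall fun y => ?_) hfin ?_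
    · exact pow_le_pow_left' (indicator_le_self _ _ _) 2
    · have : ∀ᵐ y ∂(volume.restrict S), y ∉ Z :=
        ae_restrict_of_ae (measure_eq_zero_iff_ae_notMem.1 hZ)
      filter_upwards [this] with y hy
      refine tendsto_const_nhds.congr' ?_
      filter_upwards [hΘ.eventually_one y hy] with m hm
      have h0 : gradient (Θ m) y = 0 := by
        rw [gradient, hm.fderiv_eq, fderiv_one]
        simp
      simp [hN, h0]
  have hb : ∀ m, ‖∫ y in S, w y * fderiv ℝ (Θ m) y e‖ₑ ^ 2 ≤ ‖e‖ₑ ^ 2 * (a m * C) := by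
    intro m
    have h1 : ‖∫ y in S, w y * fderiv ℝ (Θ m) y e‖ₑ ≤
        ‖e‖ₑ * ∫⁻ y in S, (N m).indicator (fun y => ‖w y‖ₑ) y * ‖gradient (Θ m) y‖ₑ := by
      rw [← lintegral_const_mul' _ _ (by simp)]
      refine (enorm_integral_le_lintegral_enorm _).trans (lintegral_mono fun y => ?_)
      rw [enorm_mul]
      have hle1 : ‖fderiv ℝ (Θ m) y e‖ₑ ≤ ‖gradient (Θ m) y‖ₑ * ‖e‖ₑ := by
        rw [enorm_gradient]
        exact ContinuousLinearMap.le_opENorm _ _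
      by_cases hy : y ∈ N m
      · rw [indicator_of_mem hy]
        calc _ ≤ ‖w y‖ₑ * (‖gradient (Θ m) y‖ₑ * ‖e‖ₑ) := by gcongr
          _ = _ := by ring
      · have : gradient (Θ m) y = 0 := by simpa [hN] using hy
        have h0 : fderiv ℝ (Θ m) y e = 0 := by rw [← inner_gradient, this, inner_zero_left]
        simp [h0]
    refine (pow_le_pow_left' h1 2).trans ?_
    rw [mul_pow]
    gcongr
    refine (sq_lintegral_mul_le _ (hw.1.enorm.indicator (hNm m))
      (hgc m).enorm.measurable.aemeasurable).trans ?_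
    gcongr
    exact (lintegral_mono_set hSR).trans (hle m)
  have ht : Tendsto (fun m => ‖e‖ₑ ^ 2 * (a m * C)) atTop (𝓝 0) := by
    have h1 := ENNReal.Tendsto.mul_const ha0 (Or.inr hC)
    have h2 := ENNReal.Tendsto.const_mul (a := ‖e‖ₑ ^ 2) h1 (Or.inr (by finiteness))
    simpa using h2
  have h2 := tendsto_of_tendsto_of_tendsto_of_le_of_le tendsto_const_nhds ht
    (fun _ => bot_le) hb
  rw [tendsto_zero_iff_enorm_tendsto_zero]
  have h3 := (ENNReal.continuous_rpow_const (y := 1 / 2)).continuousAt.tendsto.comp h2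
  simp only [Function.comp_def, ← ENNReal.rpow_natCast, ← ENNReal.rpow_mul] at h3
  norm_num at h3
  exact h3

/-- The divergence theorem for the weak gradient of a function in `H¹` of a polytope. -/
theorem HasFlatFaces.integral_weakGrad {d : ℕ} {κ : Type*} {S : Set (E d)} {s : Finset κ}
    {face : κ → Set (E d)} {n : κ → E d} {c : κ → ℝ} {w : E d → ℝ} {g : κ → E d → ℝ}
    (h : HasFlatFaces S s face n c) (hw : MemH1 S w)
    (hg : ∀ k ∈ s, IsTrace S (face k) w (g k)) (e : E d) :
    ∫ y in S, ⟪weakGrad S w y, e⟫ = ∑ k ∈ s, ⟪n k, e⟫ * ∫ y in face k, g k y ∂μHE[d - 1] := by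
  have hsk := h.skeleton
  choose! 𝓛 h𝓛f h𝓛 h𝓛s using hsk
  set ℒ : Set ((E d × ℝ) × (E d × ℝ)) :=
    ⋃ k ∈ (s : Set κ), (fun p => ((n k, c k), p)) '' 𝓛 k
  have hℒ : ℒ.Finite := s.finite_toSet.biUnion fun k hk => (h𝓛f k hk).image _
  have hℒ' : ∀ p ∈ ℒ, ‖p.1.1‖ = 1 ∧ ‖p.2.1‖ = 1 ∧ ⟪p.1.1, p.2.1⟫ = 0 := by
    intro q hq
    obtain ⟨k, hk, p, hp, rfl⟩ := mem_iUnion₂.1 hq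
    exact ⟨(h.isFlatFace k hk).norm_eq, h𝓛 k hk p hp⟩
  obtain ⟨R, hR⟩ := h.isPolytope.1.subset_ball 0
  obtain ⟨Θ, hΘ⟩ := exists_isCutoffSeq R hℒ hℒ'
  set Z : Set (E d) := ⋃ p ∈ ℒ, hyperplane p.1.1 p.1.2 ∩ hyperplane p.2.1 p.2.2
  have hskZ : ∀ k ∈ s, closure (face k) \ face k ⊆ Z := by
    intro k hk x hx
    obtain ⟨p, hp, hxp⟩ := mem_iUnion₂.1 (h𝓛s k hk hx)
    exact mem_biUnion (mem_biUnion hk (mem_image_of_mem _ hp)) hxp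
  have hZv : volume Z = 0 := (measure_biUnion_null_iff hℒ.countable).2 fun p hp =>
    measure_mono_null inter_subset_left (volume_hyperplane (hℒ' p hp).1 _)
  have hZμ : (μHE[d - 1] : Measure (E d)) Z = 0 :=
    (measure_biUnion_null_iff hℒ.countable).2 fun p hp =>
      euclideanHausdorffMeasure_inter_hyperplane (hℒ' p hp).1 (hℒ' p hp).2.1 (hℒ' p hp).2.2 _ _
  -- Each cutoff is an admissible test function. It tends to 1 off the skeleton, which is null for
  -- the volume and for the surface measure, while the term containing its gradient disappears in
  -- the limit.
  have hzero : ∀ m, greenDefect S s face n w g e (Θ m) = 0 := fun m =>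
    h.greenDefect_eq_zero hw hg e (hΘ.contDiff m) fun k hk x hx =>
      hΘ.eventually_zero m x (hskZ k hk hx)
  have hSo := h.isPolytope.isOpen
  have hGe : MemLp (fun y => ⟪weakGrad S w y, e⟫) 2 (volume.restrict S) :=
    (hw.memLp_weakGrad hSo).inner_const e
  have h1L : MemLp (fun _ : E d => (1 : ℝ)) 2 (volume.restrict S) :=
    h.memLp_of_continuous continuous_const
  have hGi : Integrable (fun y => ⟪weakGrad S w y, e⟫) (volume.restrict S) := by
    have := h1L.integrable_mul hGe
    simpa [Pi.mul_def] using this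
  have hpt : ∀ y, y ∉ Z → Tendsto (fun m => Θ m y) atTop (𝓝 1) := fun y hy =>
    tendsto_const_nhds.congr' ((hΘ.eventually_one y hy).mono fun m hm => hm.eq_of_nhds.symm)
  have habs : ∀ m y, |Θ m y| ≤ 1 := fun m y => by
    rw [abs_of_nonneg (hΘ.nonneg m y)]
    exact hΘ.le_one m y
  have t1 := hΘ.tendsto_integral_mul_fderiv hZv hR hw.1 e
  have t2 : Tendsto (fun m => ∫ y in S, Θ m y * ⟪weakGrad S w y, e⟫) atTop
      (𝓝 (∫ y in S, ⟪weakGrad S w y, e⟫)) := by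
    refine tendsto_integral_of_dominated_convergence (fun y => |⟪weakGrad S w y, e⟫|)
      (fun m => (hΘ.contDiff m).continuous.aestronglyMeasurable.mul hGi.1) hGi.abs
      (fun m => Eventually.of_forall fun y => ?_) ?_
    · rw [Real.norm_eq_abs, abs_mul]
      exact mul_le_of_le_one_left (abs_nonneg _) (habs m y)
    · have : ∀ᵐ y ∂(volume.restrict S), y ∉ Z :=
        ae_restrict_of_ae (measure_eq_zero_iff_ae_notMem.1 hZv)
      filter_upwards [this] with y hy
      simpa using (hpt y hy).mul_const ⟪weakGrad S w y, e⟫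
  have t3 : ∀ k ∈ s, Tendsto (fun m => ⟪n k, e⟫ * ∫ y in face k, g k y * Θ m y ∂μHE[d - 1]) atTop
      (𝓝 (⟪n k, e⟫ * ∫ y in face k, g k y ∂μHE[d - 1])) := by
    intro k hk
    have hgi : Integrable (g k) ((μHE[d - 1] : Measure (E d)).restrict (face k)) := by
      have := (hg k hk).memLp.integrable_mul
        (h.memLp_face_of_continuous hk (continuous_const (y := (1 : ℝ))))
      simpa [Pi.mul_def] using this
    refine Tendsto.const_mul _ (tendsto_integral_of_dominated_convergence (fun y => |g k y|)
      (fun m => hgi.1.mul (hΘ.contDiff m).continuous.aestronglyMeasurable) hgi.abs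
      (fun m => Eventually.of_forall fun y => ?_) ?_)
    · rw [Real.norm_eq_abs, abs_mul]
      exact mul_le_of_le_one_right (abs_nonneg _) (habs m y)
    · have : ∀ᵐ y ∂((μHE[d - 1] : Measure (E d)).restrict (face k)), y ∉ Z :=
        ae_restrict_of_ae (measure_eq_zero_iff_ae_notMem.1 hZμ)
      filter_upwards [this] with y hy
      simpa using (hpt y hy).const_mul (g k y)
  have t4 := (t1.add t2).sub (tendsto_finsetSum s t3)
  have t5 := tendsto_nhds_unique (tendsto_const_nhds.congr fun m => (hzero m).symm) t4
  linarith

/-! ### The flux A ∇u of an H² function -/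

/-- Expanding over the entries of A, with the i-th component of x written as an inner product with a
basis vector, reduces each flux identity to scalar ones in direction e_i for the components of the
weak gradient. -/
theorem inner_toEuclideanLin_eq_sum {d : ℕ} (A : Matrix (Fin d) (Fin d) ℝ) (v x : E d) :
    ⟪Matrix.toEuclideanLin A v, x⟫ =
      ∑ i, ∑ j, A i j * (v j * ⟪x, EuclideanSpace.single i (1 : ℝ)⟫) := by
  have hx : ∀ i, ⟪x, EuclideanSpace.single i (1 : ℝ)⟫ = x i := fun i => by
    rw [EuclideanSpace.inner_single_right, one_mul, conj_trivial]
  simp only [hx]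
  simp only [PiLp.inner_apply, Matrix.toLpLin_apply, Matrix.mulVec, dotProduct,
    RCLike.inner_apply, conj_trivial]
  refine Finset.sum_congr rfl fun i _ => ?_
  rw [Finset.mul_sum]
  exact Finset.sum_congr rfl fun j _ => by ring

theorem integral_sum_sum_mul {α : Type*} [MeasurableSpace α] {μ : Measure α} {d : ℕ}
    (A : Matrix (Fin d) (Fin d) ℝ) {h : Fin d → Fin d → α → ℝ} (hh : ∀ i j, Integrable (h i j) μ) :
    Integrable (fun x => ∑ i, ∑ j, A i j * h i j x) μ ∧
      ∫ x, ∑ i, ∑ j, A i j * h i j x ∂μ = ∑ i, ∑ j, A i j * ∫ x, h i j x ∂μ := by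
  have h1 : ∀ i j, Integrable (fun x => A i j * h i j x) μ := fun i j => (hh i j).const_mul _
  have h2 : ∀ i, Integrable (fun x => ∑ j, A i j * h i j x) μ := fun i =>
    integrable_finsetSum _ fun j _ => h1 i j
  refine ⟨integrable_finsetSum _ fun i _ => h2 i, ?_⟩
  rw [integral_finsetSum _ fun i _ => h2 i]
  refine Finset.sum_congr rfl fun i _ => ?_
  rw [integral_finsetSum _ fun j _ => h1 i j]
  exact Finset.sum_congr rfl fun j _ => integral_const_mul _ _

/-- The divergence of `A ∇u` in `S`, from the second weak derivatives of `u ∈ H²(S)`. -/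
noncomputable def fluxDiv {d : ℕ} (A : Matrix (Fin d) (Fin d) ℝ) (S : Set (E d)) (u : E d → ℝ)
    (x : E d) : ℝ :=
  ∑ i, ∑ j, A i j * ⟪weakGrad S (fun y => weakGrad S u y j) x, EuclideanSpace.single i (1 : ℝ)⟫

/-- The normal component of the trace of `A ∇u` on `F`. -/
noncomputable def fluxDensity {d : ℕ} (A : Matrix (Fin d) (Fin d) ℝ) (S F : Set (E d)) (u : E d → ℝ)
    (n x : E d) : ℝ :=
  ⟪Matrix.toEuclideanLin A (WithLp.toLp 2 fun i => trace S F (fun y => weakGrad S u y i) x), n⟫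

theorem fluxDensity_eq_sum {d : ℕ} (A : Matrix (Fin d) (Fin d) ℝ) (S F : Set (E d)) (u : E d → ℝ)
    (n x : E d) : fluxDensity A S F u n x = ∑ i, ∑ j, A i j *
      (trace S F (fun y => weakGrad S u y j) x * ⟪n, EuclideanSpace.single i (1 : ℝ)⟫) :=
  inner_toEuclideanLin_eq_sum _ _ _

section

variable {d : ℕ} {S F : Set (E d)} {u : E d → ℝ}

theorem MemH2.memLp_inner (hS : IsOpen S) (hu : MemH2 S u) (i j : Fin d) :
    MemLp (fun x => ⟪weakGrad S (fun y => weakGrad S u y j) x, EuclideanSpace.single i (1 : ℝ)⟫) 2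
      (volume.restrict S) :=
  ((hu.2 j).memLp_weakGrad hS).inner_const _

theorem MemH2.memLp_fluxDiv (hS : IsOpen S) (hu : MemH2 S u) (A : Matrix (Fin d) (Fin d) ℝ) :
    MemLp (fluxDiv A S u) 2 (volume.restrict S) :=
  memLp_finsetSum _ fun i _ => memLp_finsetSum _ fun j _ =>
    (hu.memLp_inner hS i j).const_mul _

theorem inner_gradient_eq_sum (A : Matrix (Fin d) (Fin d) ℝ) (v : E d) (φ : E d → ℝ) (x : E d) :
    ⟪Matrix.toEuclideanLin A v, gradient φ x⟫ =
      ∑ i, ∑ j, A i j * (v j * fderiv ℝ φ x (EuclideanSpace.single i (1 : ℝ))) := by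
  rw [inner_toEuclideanLin_eq_sum]
  simp only [inner_gradient]

theorem MemH2.integrable_mul_fderiv (hu : MemH2 S u) {R : Set (E d)} {φ : E d → ℝ}
    (hφ : IsTestFunction R φ) (i j : Fin d) :
    Integrable (fun x => weakGrad S u x j * fderiv ℝ φ x (EuclideanSpace.single i (1 : ℝ)))
      (volume.restrict S) :=
  (hu.2 j).1.integrable_mul (hφ.memLp_fderiv _ _)

theorem MemH2.integrable_inner (hu : MemH2 S u) (A : Matrix (Fin d) (Fin d) ℝ) {R : Set (E d)}
    {φ : E d → ℝ} (hφ : IsTestFunction R φ) :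
    Integrable (fun x => ⟪Matrix.toEuclideanLin A (weakGrad S u x), gradient φ x⟫)
      (volume.restrict S) := by
  simp only [inner_gradient_eq_sum]
  exact (integral_sum_sum_mul A fun i j => hu.integrable_mul_fderiv hφ i j).1

theorem MemH2.integral_inner_eq (hu : MemH2 S u) (A : Matrix (Fin d) (Fin d) ℝ) {R : Set (E d)}
    {φ : E d → ℝ} (hφ : IsTestFunction R φ) :
    ∫ x in S, ⟪Matrix.toEuclideanLin A (weakGrad S u x), gradient φ x⟫ = ∑ i, ∑ j, A i j *
      ∫ x in S, weakGrad S u x j * fderiv ℝ φ x (EuclideanSpace.single i (1 : ℝ)) := by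
  simp only [inner_gradient_eq_sum]
  exact (integral_sum_sum_mul A fun i j => hu.integrable_mul_fderiv hφ i j).2

theorem MemH2.integral_mul_fluxDiv (hS : IsOpen S) (hu : MemH2 S u)
    (A : Matrix (Fin d) (Fin d) ℝ) {R : Set (E d)} {φ : E d → ℝ} (hφ : IsTestFunction R φ) :
    ∫ x in S, φ x * fluxDiv A S u x = ∑ i, ∑ j, A i j * ∫ x in S, φ x *
      ⟪weakGrad S (fun y => weakGrad S u y j) x, EuclideanSpace.single i (1 : ℝ)⟫ := by
  have hi : ∀ i j, Integrable (fun x => φ x *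
      ⟪weakGrad S (fun y => weakGrad S u y j) x, EuclideanSpace.single i (1 : ℝ)⟫)
      (volume.restrict S) := fun i j =>
    (hφ.memLp (volume.restrict S)).integrable_mul (hu.memLp_inner hS i j)
  refine Eq.trans ?_ (integral_sum_sum_mul A hi).2
  refine integral_congr_ae (Eventually.of_forall fun x => ?_)
  simp only [fluxDiv, Finset.mul_sum]
  exact Finset.sum_congr rfl fun i _ => Finset.sum_congr rfl fun j _ => by ring

theorem MemH2.integral_inner_gradient (hS : IsOpen S) (hu : MemH2 S u)
    (A : Matrix (Fin d) (Fin d) ℝ) {φ : E d → ℝ} (hφ : IsTestFunction S φ) :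
    ∫ x in S, ⟪Matrix.toEuclideanLin A (weakGrad S u x), gradient φ x⟫ =
      - ∫ x in S, φ x * fluxDiv A S u x := by
  rw [hu.integral_inner_eq A hφ, hu.integral_mul_fluxDiv hS A hφ, ← Finset.sum_neg_distrib]
  refine Finset.sum_congr rfl fun i _ => ?_
  rw [← Finset.sum_neg_distrib]
  refine Finset.sum_congr rfl fun j _ => ?_
  rw [(hu.2 j).hasWeakGradient.integral_mul_fderiv (hu.2 j).1 ((hu.2 j).memLp_weakGrad hS) hφ,
    mul_neg]

theorem MemH2.memLp_trace_mul (htr : ∀ j, IsTrace S F (fun y => weakGrad S u y j)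
      (trace S F fun y => weakGrad S u y j)) (n : E d) (i j : Fin d) :
    MemLp (fun x => trace S F (fun y => weakGrad S u y j) x *
      ⟪n, EuclideanSpace.single i (1 : ℝ)⟫) 2 ((μHE[d - 1] : Measure (E d)).restrict F) := by
  simpa only [mul_comm] using (htr j).memLp.const_mul ⟪n, EuclideanSpace.single i (1 : ℝ)⟫

theorem memLp_fluxDensity (A : Matrix (Fin d) (Fin d) ℝ)
    (htr : ∀ j, IsTrace S F (fun y => weakGrad S u y j)
      (trace S F fun y => weakGrad S u y j)) (n : E d) :
    MemLp (fluxDensity A S F u n) 2 ((μHE[d - 1] : Measure (E d)).restrict F) := by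
  have : fluxDensity A S F u n = fun x => ∑ i, ∑ j, A i j *
      (trace S F (fun y => weakGrad S u y j) x * ⟪n, EuclideanSpace.single i (1 : ℝ)⟫) :=
    funext fun x => fluxDensity_eq_sum _ _ _ _ _ _
  rw [this]
  exact memLp_finsetSum _ fun i _ => memLp_finsetSum _ fun j _ =>
    (MemH2.memLp_trace_mul htr n i j).const_mul _

/-- Green's formula for the flux `A ∇u`, localized near a point of a face. -/
theorem MemH2.exists_green {n : E d} {c : ℝ} (hS : IsOpen S)
    (hF : IsFlatFace S F n c) (hu : MemH2 S u) (A : Matrix (Fin d) (Fin d) ℝ)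
    (htr : ∀ j, IsTrace S F (fun y => weakGrad S u y j)
      (trace S F fun y => weakGrad S u y j)) {x : E d} (hx : x ∈ F) :
    ∃ r > 0, ∀ φ, IsTestFunction (Metric.ball x r) φ →
      (∫ y in S, ⟪Matrix.toEuclideanLin A (weakGrad S u y), gradient φ y⟫) +
        ∫ y in S, φ y * fluxDiv A S u y = ∫ y in F, φ y * fluxDensity A S F u n y ∂μHE[d - 1] := by
  choose r hr hgreen using fun j => hF.exists_green hS (hu.2 j) (htr j) hx
  obtain ⟨r₀, hr₀, hle⟩ : ∃ r₀ > 0, ∀ j, r₀ ≤ r j := by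
    have : ∀ᶠ t in 𝓝[>] (0 : ℝ), (∀ j, t ≤ r j) ∧ 0 < t :=
      (eventually_all.2 fun j => ((ge_mem_nhds (hr j)).filter_mono nhdsWithin_le_nhds)).and
        self_mem_nhdsWithin
    obtain ⟨t, ht, ht0⟩ := this.exists
    exact ⟨t, ht0, ht⟩
  refine ⟨r₀, hr₀, fun φ hφ => ?_⟩
  have hφj : ∀ j, IsTestFunction (Metric.ball x (r j)) φ := fun j =>
    ⟨hφ.1, hφ.2.1, hφ.2.2.trans (Metric.ball_subset_ball (hle j))⟩
  have hFμ := euclideanHausdorffMeasure_hyperplane_lt_top hF.norm_eq c hF.isBounded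
    hF.subset_hyperplane
  have hφF : MemLp φ 2 ((μHE[d - 1] : Measure (E d)).restrict F) :=
    memLp_restrict_of_isBounded hF.measurableSet hF.isBounded hFμ hφ.1.continuous 2
  have hR : ∫ y in F, φ y * fluxDensity A S F u n y ∂μHE[d - 1] = ∑ i, ∑ j, A i j *
      ∫ y in F, φ y * (trace S F (fun y => weakGrad S u y j) y *
        ⟪n, EuclideanSpace.single i (1 : ℝ)⟫) ∂μHE[d - 1] := by
    have hi : ∀ i j, Integrable (fun y => φ y * (trace S F (fun y => weakGrad S u y j) y *
        ⟪n, EuclideanSpace.single i (1 : ℝ)⟫)) ((μHE[d - 1] : Measure (E d)).restrict F) :=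
      fun i j => hφF.integrable_mul (MemH2.memLp_trace_mul htr n i j)
    refine Eq.trans ?_ (integral_sum_sum_mul A hi).2
    refine integral_congr_ae (Eventually.of_forall fun x => ?_)
    simp only [fluxDensity_eq_sum, Finset.mul_sum]
    exact Finset.sum_congr rfl fun i _ => Finset.sum_congr rfl fun j _ => by ring
  rw [hR, hu.integral_inner_eq A hφ, hu.integral_mul_fluxDiv hS A hφ, ← Finset.sum_add_distrib]
  refine Finset.sum_congr rfl fun i _ => ?_
  rw [← Finset.sum_add_distrib]
  refine Finset.sum_congr rfl fun j _ => ?_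
  rw [← mul_add, hgreen j φ (hφj j), ← integral_const_mul]
  congr 2
  ext y
  ring

/-- The scalar divergence theorem applied to each component of the weak gradient in each basis
direction, recombined with the coefficients A i j. -/
theorem HasFlatFaces.integral_fluxDiv {κ : Type*} {s : Finset κ}
    {face : κ → Set (E d)} {n : κ → E d} {c : κ → ℝ} (h : HasFlatFaces S s face n c)
    (hu : MemH2 S u) (A : Matrix (Fin d) (Fin d) ℝ)
    (htr : ∀ k ∈ s, ∀ j, IsTrace S (face k) (fun y => weakGrad S u y j)
      (trace S (face k) fun y => weakGrad S u y j)) :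
    ∫ y in S, fluxDiv A S u y = ∑ k ∈ s, ∫ y in face k,
      fluxDensity A S (face k) u (n k) y ∂μHE[d - 1] := by
  have hSo := h.isPolytope.isOpen
  have hint : ∀ {f : E d → ℝ}, MemLp f 2 (volume.restrict S) → Integrable f (volume.restrict S) := by
    intro f hf
    have := hf.integrable_mul (h.memLp_of_continuous (continuous_const (y := (1 : ℝ))))
    simpa [Pi.mul_def] using this
  have hintF : ∀ k ∈ s, ∀ {f : E d → ℝ},
      MemLp f 2 ((μHE[d - 1] : Measure (E d)).restrict (face k)) →
      Integrable f ((μHE[d - 1] : Measure (E d)).restrict (face k)) := by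
    intro k hk f hf
    have := hf.integrable_mul (h.memLp_face_of_continuous hk (continuous_const (y := (1 : ℝ))))
    simpa [Pi.mul_def] using this
  have e1 : ∫ y in S, fluxDiv A S u y = ∑ i, ∑ j, A i j * ∑ k ∈ s,
      ⟪n k, EuclideanSpace.single i (1 : ℝ)⟫ *
        ∫ y in face k, trace S (face k) (fun y => weakGrad S u y j) y ∂μHE[d - 1] := by
    simp only [fluxDiv]
    rw [(integral_sum_sum_mul A fun i j => hint (hu.memLp_inner hSo i j)).2]
    refine Finset.sum_congr rfl fun i _ => Finset.sum_congr rfl fun j _ => ?_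
    rw [h.integral_weakGrad (hu.2 j) (g := fun k => trace S (face k) fun y => weakGrad S u y j)
      (fun k hk => htr k hk j)]
  have e2 : ∀ k ∈ s, ∫ y in face k, fluxDensity A S (face k) u (n k) y ∂μHE[d - 1] =
      ∑ i, ∑ j, A i j * (⟪n k, EuclideanSpace.single i (1 : ℝ)⟫ *
        ∫ y in face k, trace S (face k) (fun y => weakGrad S u y j) y ∂μHE[d - 1]) := by
    intro k hk
    simp only [fluxDensity_eq_sum]
    rw [(integral_sum_sum_mul A fun i j =>
      hintF k hk (MemH2.memLp_trace_mul (htr k hk) (n k) i j)).2]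
    refine Finset.sum_congr rfl fun i _ => Finset.sum_congr rfl fun j _ => ?_
    congr 1
    rw [integral_mul_const]
    exact mul_comm _ _
  rw [e1, Finset.sum_congr rfl e2, Finset.sum_comm (s := s)]
  refine Finset.sum_congr rfl fun i _ => ?_
  rw [Finset.sum_comm (s := s)]
  refine Finset.sum_congr rfl fun j _ => ?_
  rw [Finset.mul_sum]

end

/-! ### Mesh cells as polytopes with flat faces -/

namespace PolytopalMesh

variable {d : ℕ} {Ω : Set (E d)} {𝒯 ℱ : Type*} [Fintype ℱ]

theorem mem_facesOf {M : PolytopalMesh Ω 𝒯 ℱ} {T : 𝒯} {F : ℱ} :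
    F ∈ M.facesOf T ↔ M.face F ⊆ frontier (M.cell T) := by
  classical
  simp [facesOf]

theorem exists_hasFlatFaces (M : PolytopalMesh Ω 𝒯 ℱ) (T : 𝒯) :
    ∃ c, HasFlatFaces (M.cell T) (M.facesOf T) M.face (M.normal T) c := by
  have hp := M.cells.polytope T
  have h : ∀ F ∈ M.facesOf T, _ := fun F hF =>
    isFlatFace_of_isHyperplanarPolytope hp.isOpen (M.face_polytope F) (M.face_nonempty F)
      (mem_facesOf.1 hF) (M.norm_normal T F (mem_facesOf.1 hF))
      (M.normal_outward T F (mem_facesOf.1 hF))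
  choose! c hc using h
  refine ⟨c, hp, fun F hF => (hc F hF).1, fun F hF => mem_facesOf.1 hF,
    fun F _ F' _ hne => M.face_disjoint hne, ?_, fun F hF => (hc F hF).2⟩
  rw [M.frontier_cell T]
  refine iUnion₂_subset fun F hF => ?_
  exact subset_biUnion_of_mem (u := fun F => closure (M.face F)) (mem_facesOf.2 hF)

theorem isTrace_trace (M : PolytopalMesh Ω 𝒯 ℱ) {T : 𝒯} {F : ℱ} (hF : F ∈ M.facesOf T)
    {w : E d → ℝ} (hw : MemH1 (M.cell T) w) :
    IsTrace (M.cell T) (M.face F) w (trace (M.cell T) (M.face F) w) := by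
  obtain ⟨c, hc⟩ := M.exists_hasFlatFaces T
  exact HybridFV.isTrace_trace
    ((hc.isFlatFace F hF).exists_isTrace hc.isPolytope (hc.subset_frontier F hF) hw)

theorem faceMeasure_pos (M : PolytopalMesh Ω 𝒯 ℱ) {T : 𝒯} {F : ℱ} (hF : F ∈ M.facesOf T) :
    0 < M.faceMeasure F := by
  obtain ⟨c, hc⟩ := M.exists_hasFlatFaces T
  have hf := hc.isFlatFace F hF
  obtain ⟨x, hx⟩ := M.face_nonempty F
  obtain ⟨r, hr, hball⟩ := Metric.mem_nhdsWithin_iff.1 (hf.mem_nhdsWithin x hx)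
  have hxc : ⟪M.normal T F, x⟫ = c F := hf.subset_hyperplane hx
  refine ENNReal.toReal_pos ?_
    (euclideanHausdorffMeasure_hyperplane_lt_top hf.norm_eq (c F) hf.isBounded
      hf.subset_hyperplane).ne
  refine ((euclideanHausdorffMeasure_hyperplane_pos (x := x) hf.norm_eq hr).trans_le
    (measure_mono ?_)).ne'
  rw [hxc, inter_comm]
  exact hball

end PolytopalMesh

/-! ### The weak solution in the cells and across interfaces -/

section WeakSolution

variable {d : ℕ} {Ω : Set (E d)} {K : E d → Matrix (Fin d) (Fin d) ℝ} {f u : E d → ℝ}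

theorem IsWeakSolution.integral_inner_gradient (hΩ : IsOpen Ω) (hu : IsWeakSolution Ω K f u)
    {φ : E d → ℝ} (hφ : IsTestFunction Ω φ) :
    ∫ x in Ω, ⟪Matrix.toEuclideanLin (K x) (weakGrad Ω u x), gradient φ x⟫ =
      ∫ x in Ω, f x * φ x := by
  obtain ⟨h1, h2⟩ := hφ.memH10 hΩ
  rw [← hu.2 φ h1]
  refine integral_congr_ae ?_
  filter_upwards [h2] with x hx
  rw [hx]

theorem IsWeakSolution.ae_weakGrad_eq (hu : IsWeakSolution Ω K f u) {S : Set (E d)}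
    (hS : IsOpen S) (hSΩ : S ⊆ Ω) (huS : MemH1 S u) :
    weakGrad Ω u =ᵐ[volume.restrict S] weakGrad S u :=
  (hu.1.1.hasWeakGradient.mono hSΩ).ae_eq hS huS.hasWeakGradient

theorem IsWeakSolution.ae_inner_eq (hu : IsWeakSolution Ω K f u) {S : Set (E d)}
    (hS : IsOpen S) (hSΩ : S ⊆ Ω) (huS : MemH1 S u) {A : Matrix (Fin d) (Fin d) ℝ}
    (hA : ∀ x ∈ S, K x = A) (φ : E d → ℝ) :
    (fun x => ⟪Matrix.toEuclideanLin (K x) (weakGrad Ω u x), gradient φ x⟫)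
      =ᵐ[volume.restrict S]
      fun x => ⟪Matrix.toEuclideanLin A (weakGrad S u x), gradient φ x⟫ := by
  filter_upwards [hu.ae_weakGrad_eq hS hSΩ huS, ae_restrict_mem hS.measurableSet] with x hx hxS
  rw [hx, hA x hxS]

/-- Test functions supported in S are admissible on Ω, and there the two weak gradients agree;
integrating by parts in S puts the equation in strong form by the fundamental lemma of the calculus
of variations. -/
theorem IsWeakSolution.fluxDiv_ae_eq (hΩ : IsOpen Ω) (hu : IsWeakSolution Ω K f u)
    (hf : MemLp f 2 (volume.restrict Ω)) {S : Set (E d)}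
    (hS : IsOpen S) (hSΩ : S ⊆ Ω) (huS : MemH2 S u) {A : Matrix (Fin d) (Fin d) ℝ}
    (hA : ∀ x ∈ S, K x = A) :
    fluxDiv A S u =ᵐ[volume.restrict S] fun x => - f x := by
  have hfS : MemLp f 2 (volume.restrict S) := hf.mono_measure (Measure.restrict_mono hSΩ le_rfl)
  have hDS := huS.memLp_fluxDiv hS A
  have h1 : ∀ᵐ x, x ∈ S → fluxDiv A S u x + f x = 0 := by
    refine hS.ae_eq_zero_of_integral_contDiff_smul_eq_zero ?_ ?_
    · have hl : LocallyIntegrable (fun x => fluxDiv A S u x + f x) (volume.restrict S) :=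
        (hDS.add hfS).locallyIntegrable (by norm_num)
      exact locallyIntegrableOn_of_locallyIntegrable_restrict hl
    · intro φ hφs hφc hφS
      have hφ : IsTestFunction S φ := ⟨hφs, hφc, hφS⟩
      have hφΩ : IsTestFunction Ω φ := ⟨hφs, hφc, hφS.trans hSΩ⟩
      have hz : ∀ x, x ∉ S → φ x = 0 ∧ gradient φ x = 0 := fun x hx =>
        ⟨image_eq_zero_of_notMem_tsupport fun h => hx (hφS h),
          gradient_eq_zero_of_notMem_tsupport fun h => hx (hφS h)⟩
      have k := hu.integral_inner_gradient hΩ hφΩ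
      rw [setIntegral_eq_of_subset_of_forall_sdiff_eq_zero hΩ.measurableSet hSΩ
          (fun x hx => by rw [(hz x hx.2).2, inner_zero_right]),
        setIntegral_eq_of_subset_of_forall_sdiff_eq_zero hΩ.measurableSet hSΩ
          (fun x hx => by rw [(hz x hx.2).1, mul_zero]),
        integral_congr_ae (hu.ae_inner_eq hS hSΩ huS.1 hA φ),
        huS.integral_inner_gradient hS A hφ] at k
      rw [← setIntegral_eq_integral_of_forall_compl_eq_zero (s := S) fun x hx => by
        rw [(hz x hx).1, zero_smul]]
      have i1 : Integrable (fun x => φ x * fluxDiv A S u x) (volume.restrict S) :=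
        (hφ.memLp _).integrable_mul hDS
      have i2 : Integrable (fun x => f x * φ x) (volume.restrict S) :=
        hfS.integrable_mul (hφ.memLp _)
      have e : ∀ x, φ x • (fluxDiv A S u x + f x) = φ x * fluxDiv A S u x + f x * φ x := fun x => by
        rw [smul_eq_mul]; ring
      simp only [e]
      rw [integral_add i1 i2, ← k]
      ring
  rw [EventuallyEq, ae_restrict_iff' hS.measurableSet]
  filter_upwards [h1] with x hx hxS
  linarith [hx hxS]

end WeakSolution

/-- Otherwise a small step along -(n + n') from x would enter both half-spaces, hence both S and S'.
-/
theorem eq_neg_of_disjoint {d : ℕ} {S S' : Set (E d)} {n n' x : E d} {r r' : ℝ}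
    (hn : ‖n‖ = 1) (hn' : ‖n'‖ = 1) (hr : 0 < r) (hr' : 0 < r')
    (h : ∀ y ∈ Metric.ball x r, y ∈ S ↔ ⟪n, y - x⟫ < 0)
    (h' : ∀ y ∈ Metric.ball x r', y ∈ S' ↔ ⟪n', y - x⟫ < 0) (hd : Disjoint S S') : n' = -n := by
  by_contra hne
  have hv : 0 < ‖n + n'‖ := norm_pos_iff.2 fun h0 => hne (eq_neg_of_add_eq_zero_right h0)
  have e1 : ⟪n, n + n'⟫ = ‖n + n'‖ ^ 2 / 2 := by
    rw [norm_add_sq_real, inner_add_right, real_inner_self_eq_norm_sq, hn, hn']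
    ring
  have e2 : ⟪n', n + n'⟫ = ‖n + n'‖ ^ 2 / 2 := by
    rw [norm_add_sq_real, inner_add_right, real_inner_self_eq_norm_sq, hn, hn',
      real_inner_comm n n']
    ring
  have hc : Continuous fun t : ℝ => x - t • (n + n') := by fun_prop
  have ht : ∀ᶠ t in 𝓝[>] (0 : ℝ), x - t • (n + n') ∈ Metric.ball x (min r r') ∧ 0 < t :=
    (((hc.tendsto' 0 x (by simp)).mono_left nhdsWithin_le_nhds).eventually
      (Metric.ball_mem_nhds x (lt_min hr hr'))).and self_mem_nhdsWithin
  obtain ⟨t, htb, ht0⟩ := ht.exists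
  have e : x - t • (n + n') - x = -(t • (n + n')) := by abel
  refine disjoint_left.1 hd
    ((h _ (Metric.ball_subset_ball (min_le_left _ _) htb)).2 ?_)
    ((h' _ (Metric.ball_subset_ball (min_le_right _ _) htb)).2 ?_)
  · rw [e, inner_neg_right, inner_smul_right, e1]
    have : 0 < t * (‖n + n'‖ ^ 2 / 2) := by positivity
    linarith
  · rw [e, inner_neg_right, inner_smul_right, e2]
    have : 0 < t * (‖n + n'‖ ^ 2 / 2) := by positivity
    linarith

section

variable {d : ℕ} {Ω : Set (E d)} {K : E d → Matrix (Fin d) (Fin d) ℝ} {f u : E d → ℝ}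

/-- Test the weak formulation with φ supported near x and split Ω into the two sides. Green's
formula on each side produces the face terms; the volume terms cancel by the strong form of the
equation, so the sum of the normal fluxes is orthogonal to every such φ. -/
theorem IsWeakSolution.exists_ball_fluxDensity_add_eq_zero (hΩ : IsOpen Ω)
    (hu : IsWeakSolution Ω K f u) (hf : MemLp f 2 (volume.restrict Ω)) {S S' F : Set (E d)}
    (hS : IsOpen S) (hS' : IsOpen S') (hSΩ : S ⊆ Ω) (hSΩ' : S' ⊆ Ω) (hSS' : Disjoint S S')
    (huS : MemH2 S u) (huS' : MemH2 S' u) {A A' : Matrix (Fin d) (Fin d) ℝ}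
    (hA : ∀ x ∈ S, K x = A) (hA' : ∀ x ∈ S', K x = A') {n n' : E d} {c c' : ℝ}
    (hF : IsFlatFace S F n c) (hF' : IsFlatFace S' F n' c')
    (htr : ∀ j, IsTrace S F (fun y => weakGrad S u y j) (trace S F fun y => weakGrad S u y j))
    (htr' : ∀ j, IsTrace S' F (fun y => weakGrad S' u y j)
      (trace S' F fun y => weakGrad S' u y j)) {x : E d} (hx : x ∈ F) (hxΩ : x ∈ Ω) :
    ∃ R > 0, ∀ᵐ y ∂(μHE[d - 1] : Measure (E d)).restrict F, y ∈ Metric.ball x R →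
      fluxDensity A S F u n y + fluxDensity A' S' F u n' y = 0 := by
  obtain ⟨r, hr, hgreen⟩ := huS.exists_green hS hF A htr hx
  obtain ⟨r', hr', hgreen'⟩ := huS'.exists_green hS' hF' A' htr' hx
  obtain ⟨ρ, hρ, hside⟩ := hF.side x hx
  obtain ⟨ρ', hρ', hside'⟩ := hF'.side x hx
  obtain ⟨δ, hδ, hball⟩ := Metric.isOpen_iff.1 hΩ x hxΩ
  have hnn : n' = -n := eq_neg_of_disjoint hF.norm_eq hF'.norm_eq hρ hρ' hside hside' hSS'
  obtain ⟨R, hR, hRr, hRr', hRρ, hRρ', hRδ⟩ :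
      ∃ R > 0, R ≤ r ∧ R ≤ r' ∧ R ≤ ρ ∧ R ≤ ρ' ∧ R ≤ δ :=
    ⟨min r (min r' (min ρ (min ρ' δ))), by positivity, by simp, by simp, by simp, by simp, by simp⟩
  -- The fundamental lemma is used in the ambient ball for the surface measure restricted to F, so
  -- test functions of the whole space suffice.
  refine ⟨R, hR, Metric.isOpen_ball.ae_eq_zero_of_integral_contDiff_smul_eq_zero ?_ ?_⟩
  all_goals
    have hFμ := euclideanHausdorffMeasure_hyperplane_lt_top hF.norm_eq c hF.isBounded
      hF.subset_hyperplane
    have : IsFiniteMeasure ((μHE[d - 1] : Measure (E d)).restrict F) := ⟨by simpa using hFμ⟩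
    have hq := memLp_fluxDensity A htr n
    have hq' := memLp_fluxDensity A' htr' n'
  · exact ((hq.add hq').locallyIntegrable (by norm_num)).locallyIntegrableOn _
  intro φ hφs hφc hφB
  have hφ : ∀ {U : Set (E d)}, Metric.ball x R ⊆ U → IsTestFunction U φ := fun hU =>
    ⟨hφs, hφc, hφB.trans hU⟩
  have hφF : MemLp φ 2 ((μHE[d - 1] : Measure (E d)).restrict F) :=
    memLp_restrict_of_isBounded hF.measurableSet hF.isBounded hFμ hφs.continuous 2
  have hz : ∀ y, y ∉ Metric.ball x R → φ y = 0 ∧ gradient φ y = 0 := fun y hy =>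
    ⟨image_eq_zero_of_notMem_tsupport fun h => hy (hφB h),
      gradient_eq_zero_of_notMem_tsupport fun h => hy (hφB h)⟩
  -- As n' = -n, a point of the ball in neither S nor S' satisfies both opposite inequalities and
  -- lies on the hyperplane of F, which has zero volume.
  have hsplit : ∀ {h : E d → ℝ}, (∀ y, y ∉ Metric.ball x R → h y = 0) →
      IntegrableOn h S → IntegrableOn h S' →
      ∫ y in Ω, h y = (∫ y in S, h y) + ∫ y in S', h y := by
    intro h h0 hi hi'
    rw [← setIntegral_union hSS' hS'.measurableSet hi hi']
    refine setIntegral_eq_of_subset_of_ae_sdiff_eq_zero hΩ.measurableSet.nullMeasurableSet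
      (union_subset hSΩ hSΩ') ?_
    filter_upwards [measure_eq_zero_iff_ae_notMem.1 (volume_hyperplane hF.norm_eq c)] with y hy hyS
    refine h0 y fun hyB => hy ?_
    have h1 := mt (hside y (Metric.ball_subset_ball hRρ hyB)).2 fun h => hyS.2 (Or.inl h)
    have h2 := mt (hside' y (Metric.ball_subset_ball hRρ' hyB)).2 fun h => hyS.2 (Or.inr h)
    rw [hnn, inner_neg_left] at h2
    have hxc : ⟪n, x⟫ = c := hF.subset_hyperplane hx
    rw [inner_sub_right] at h1 h2
    show ⟪n, y⟫ = c
    linarith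
  have hweak := hu.integral_inner_gradient hΩ (hφ ((Metric.ball_subset_ball hRδ).trans hball))
  have hcell : ∀ {U : Set (E d)} {B : Matrix (Fin d) (Fin d) ℝ}, IsOpen U → U ⊆ Ω → MemH2 U u →
      (∀ x ∈ U, K x = B) →
      IntegrableOn (fun y => ⟪Matrix.toEuclideanLin (K y) (weakGrad Ω u y), gradient φ y⟫) U ∧
      IntegrableOn (fun y => f y * φ y) U ∧
      ∫ y in U, ⟪Matrix.toEuclideanLin (K y) (weakGrad Ω u y), gradient φ y⟫ =
        ∫ y in U, ⟪Matrix.toEuclideanLin B (weakGrad U u y), gradient φ y⟫ ∧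
      ∫ y in U, φ y * fluxDiv B U u y = - ∫ y in U, f y * φ y := by
    intro U B hU hUΩ huU hB
    have hae := hu.ae_inner_eq hU hUΩ huU.1 hB φ
    refine ⟨(huU.integrable_inner B (hφ subset_rfl)).congr hae.symm,
      (hf.mono_measure (Measure.restrict_mono hUΩ le_rfl)).integrable_mul
        ((hφ subset_rfl).memLp _), integral_congr_ae hae, ?_⟩
    rw [← integral_neg]
    refine integral_congr_ae ?_
    filter_upwards [hu.fluxDiv_ae_eq hΩ hf hU hUΩ huU hB] with y hy
    rw [hy]
    ring
  obtain ⟨a1, a2, a3, a4⟩ := hcell hS hSΩ huS hA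
  obtain ⟨b1, b2, b3, b4⟩ := hcell hS' hSΩ' huS' hA'
  rw [hsplit (fun y hy => by rw [(hz y hy).2, inner_zero_right]) a1 b1,
    hsplit (fun y hy => by rw [(hz y hy).1, mul_zero]) a2 b2, a3, b3] at hweak
  have g1 := hgreen φ (hφ (Metric.ball_subset_ball hRr))
  have g2 := hgreen' φ (hφ (Metric.ball_subset_ball hRr'))
  rw [a4] at g1
  rw [b4] at g2
  have i1 : IntegrableOn (fun y => φ y * fluxDensity A S F u n y) F μHE[d - 1] :=
    hφF.integrable_mul hq
  have i2 : IntegrableOn (fun y => φ y * fluxDensity A' S' F u n' y) F μHE[d - 1] :=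
    hφF.integrable_mul hq'
  simp only [smul_eq_mul, mul_add]
  rw [integral_add i1 i2, ← g1, ← g2]
  linarith

/-- The normal component of the flux `K ∇u` is continuous across an interface. -/
theorem IsWeakSolution.fluxDensity_add_ae_eq_zero (hΩ : IsOpen Ω)
    (hu : IsWeakSolution Ω K f u) (hf : MemLp f 2 (volume.restrict Ω)) {S S' F : Set (E d)}
    (hS : IsOpen S) (hS' : IsOpen S') (hSΩ : S ⊆ Ω) (hSΩ' : S' ⊆ Ω) (hSS' : Disjoint S S')
    (huS : MemH2 S u) (huS' : MemH2 S' u) {A A' : Matrix (Fin d) (Fin d) ℝ}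
    (hA : ∀ x ∈ S, K x = A) (hA' : ∀ x ∈ S', K x = A') {n n' : E d} {c c' : ℝ}
    (hF : IsFlatFace S F n c) (hF' : IsFlatFace S' F n' c')
    (htr : ∀ j, IsTrace S F (fun y => weakGrad S u y j) (trace S F fun y => weakGrad S u y j))
    (htr' : ∀ j, IsTrace S' F (fun y => weakGrad S' u y j)
      (trace S' F fun y => weakGrad S' u y j)) (hFΩ : F ⊆ Ω) :
    ∀ᵐ y ∂(μHE[d - 1] : Measure (E d)).restrict F,
      fluxDensity A S F u n y + fluxDensity A' S' F u n' y = 0 := by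
  rw [ae_restrict_iff' hF.measurableSet, ae_iff]
  refine measure_null_of_locally_null _ fun x hx => ?_
  obtain ⟨hxF, -⟩ := Classical.not_imp.1 hx
  obtain ⟨R, hR, h⟩ := hu.exists_ball_fluxDensity_add_eq_zero hΩ hf hS hS' hSΩ hSΩ' hSS' huS huS'
    hA hA' hF hF' htr htr' hxF (hFΩ hxF)
  rw [ae_restrict_iff' hF.measurableSet, ae_iff] at h
  refine ⟨_, ?_, h⟩
  filter_upwards [mem_nhdsWithin_of_mem_nhds (Metric.ball_mem_nhds x hR), self_mem_nhdsWithin]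
    with y hyB hy hcontra
  exact hy fun hyF => hcontra hyF hyB

end

/-! ### Positive eigenvalues, exact fluxes and the discrete energy estimate -/

/-- The infimum is an actual eigenvalue, and ellipticity at a unit eigenvector bounds it below by a.
The condition d ≥ 1 makes the spectrum nonempty; for d = 0 the infimum would take the default value
0. -/
theorem minEigenvalue_pos {d : ℕ} (hd : 1 ≤ d) {A : Matrix (Fin d) (Fin d) ℝ} (hA : A.IsSymm)
    {a : ℝ} (ha : 0 < a)
    (hell : ∀ ξ : E d, a * ‖ξ‖ ^ 2 ≤ ⟪Matrix.toEuclideanLin A ξ, ξ⟫) : 0 < minEigenvalue A := by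
  have hH : A.IsHermitian := by
    rw [Matrix.IsHermitian, Matrix.conjTranspose_eq_transpose_of_trivial]
    exact hA
  have : Nonempty (Fin d) := ⟨⟨0, hd⟩⟩
  rw [minEigenvalue, hH.spectrum_real_eq_range_eigenvalues]
  obtain ⟨i, hi⟩ := (range_nonempty hH.eigenvalues).csInf_mem (finite_range _)
  rw [← hi]
  have h1 := hell (hH.eigenvectorBasis i)
  have h2 : Matrix.toEuclideanLin A (hH.eigenvectorBasis i) =
      hH.eigenvalues i • hH.eigenvectorBasis i := by
    ext j
    simpa [Matrix.toLpLin_apply] using congrFun (hH.mulVec_eigenvectorBasis i) j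
  rw [h2, inner_smul_left, real_inner_self_eq_norm_sq, hH.eigenvectorBasis.norm_eq_one] at h1
  simp only [one_pow, mul_one, conj_trivial] at h1
  linarith

namespace PolytopalMesh

section

variable {d : ℕ} {Ω : Set (E d)} {𝒯 ℱ : Type*} [Fintype ℱ] {K : E d → Matrix (Fin d) (Fin d) ℝ}
  {KT : 𝒯 → Matrix (Fin d) (Fin d) ℝ} {f u : E d → ℝ}

theorem sum_diffusiveFlux (M : PolytopalMesh Ω 𝒯 ℱ) (hΩ : IsOpen Ω)
    (hKT : ∀ T, ∀ x ∈ M.cell T, K x = KT T) (hf : MemLp f 2 (volume.restrict Ω))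
    (hu : IsWeakSolution Ω K f u) (hu2 : ∀ T, MemH2 (M.cell T) u) (T : 𝒯) :
    ∑ F ∈ M.facesOf T, M.diffusiveFlux KT u T F = - ∫ x in M.cell T, f x := by
  obtain ⟨c, hc⟩ := M.exists_hasFlatFaces T
  rw [← integral_neg, ← integral_congr_ae (hu.fluxDiv_ae_eq hΩ hf hc.isPolytope.isOpen
    (M.cells.subset T) (hu2 T) (hKT T)), hc.integral_fluxDiv (hu2 T) (KT T)
    fun F hF j => M.isTrace_trace hF ((hu2 T).2 j)]
  rfl

theorem diffusiveFlux_add_diffusiveFlux (M : PolytopalMesh Ω 𝒯 ℱ) (hΩ : IsOpen Ω)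
    (hKT : ∀ T, ∀ x ∈ M.cell T, K x = KT T) (hf : MemLp f 2 (volume.restrict Ω))
    (hu : IsWeakSolution Ω K f u) (hu2 : ∀ T, MemH2 (M.cell T) u) {F : ℱ} {T T' : 𝒯} (hne : T ≠ T')
    (hF : F ∈ M.facesOf T) (hF' : F ∈ M.facesOf T') :
    M.diffusiveFlux KT u T F + M.diffusiveFlux KT u T' F = 0 := by
  -- A boundary face belongs to a single cell, so a face of two cells is internal.
  have hFΩ : M.face F ⊆ Ω := by
    rcases M.internal_or_boundary F with h | ⟨-, h⟩
    · exact h.1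
    · exact absurd (h.unique (mem_facesOf.1 hF) (mem_facesOf.1 hF')) hne
  obtain ⟨c, hc⟩ := M.exists_hasFlatFaces T
  obtain ⟨c', hc'⟩ := M.exists_hasFlatFaces T'
  have hface := hc.isFlatFace F hF
  have htr := fun j => M.isTrace_trace hF ((hu2 T).2 j)
  have htr' := fun j => M.isTrace_trace hF' ((hu2 T').2 j)
  have hFμ := euclideanHausdorffMeasure_hyperplane_lt_top hface.norm_eq (c F) hface.isBounded
    hface.subset_hyperplane
  have : IsFiniteMeasure ((μHE[d - 1] : Measure (E d)).restrict (M.face F)) := ⟨by simpa using hFμ⟩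
  have h := hu.fluxDensity_add_ae_eq_zero hΩ hf hc.isPolytope.isOpen hc'.isPolytope.isOpen
    (M.cells.subset T) (M.cells.subset T') (M.cells.disjoint hne) (hu2 T) (hu2 T') (hKT T)
    (hKT T') hface (hc'.isFlatFace F hF') htr htr' hFΩ
  have h0 := integral_eq_zero_of_ae h
  rwa [integral_add ((memLp_fluxDensity _ htr _).integrable (by norm_num))
    ((memLp_fluxDensity _ htr' _).integrable (by norm_num))] at h0

end

variable {d : ℕ} {Ω : Set (E d)} {𝒯 ℱ : Type*} [Fintype 𝒯] [Fintype ℱ]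

/-- Regroup by faces: the two contributions to an internal face cancel by conservativity, and the
unknown vanishes on a boundary face. -/
theorem sum_mul_faceVal_eq_zero (M : PolytopalMesh Ω 𝒯 ℱ) {a : 𝒯 → ℱ → ℝ}
    (ha : ∀ F T T', T ≠ T' → F ∈ M.facesOf T → F ∈ M.facesOf T' → a T F + a T' F = 0) (v : M.X) :
    ∑ T, ∑ F ∈ M.facesOf T, a T F * faceVal v F = 0 := by
  classical
  rw [Finset.sum_comm' (t' := Finset.univ)
    (s' := fun F => Finset.univ.filter fun T => F ∈ M.facesOf T) (by simp)]
  refine Finset.sum_eq_zero fun F _ => ?_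
  rcases M.internal_or_boundary F with ⟨-, T, T', hne, h⟩ | ⟨hb, -⟩
  · have hs : (Finset.univ.filter fun S => F ∈ M.facesOf S) = {T, T'} := by
      ext S
      simp [mem_facesOf, h]
    rw [hs, Finset.sum_pair hne, ← add_mul, ha F T T' hne (mem_facesOf.2 ((h T).2 (Or.inl rfl)))
      (mem_facesOf.2 ((h T').2 (Or.inr rfl))), zero_mul]
  · have : faceVal v F = 0 := v.2 F hb
    simp [this]

/-- The discrete energy estimate: the error is controlled by the consistency error of the numerical
fluxes with respect to conservative fluxes `D` in balance with the same source. -/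
theorem discNorm_sub_le (M : PolytopalMesh Ω 𝒯 ℱ) {xT : 𝒯 → E d}
    {KT : 𝒯 → Matrix (Fin d) (Fin d) ℝ} (hKT : ∀ T, 0 < minEigenvalue (KT T))
    (hdTF : ∀ T, ∀ F ∈ M.facesOf T, 0 < M.orthDist xT T F)
    (Fl : 𝒯 → ℱ → M.X →ₗ[ℝ] ℝ) {γ : ℝ} (hγ : 0 < γ) (hcoer : M.IsCoercive xT KT Fl γ)
    {f : E d → ℝ} {D : 𝒯 → ℱ → ℝ}
    (hDc : ∀ F T T', T ≠ T' → F ∈ M.facesOf T → F ∈ M.facesOf T' → D T F + D T' F = 0)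
    (hDb : ∀ T, ∑ F ∈ M.facesOf T, D T F = - ∫ x in M.cell T, f x)
    {uh : M.X} (huh : M.IsFVSolution Fl f uh) (v : M.X) :
    M.discNorm xT KT (uh - v) ≤
      γ⁻¹ * Real.sqrt (∑ T, (minEigenvalue (KT T))⁻¹ *
        ∑ F ∈ M.facesOf T, M.orthDist xT T F / M.faceMeasure F * (D T F + Fl T F v) ^ 2) := by
  set e := uh - v with he
  set δ : 𝒯 → ℱ → ℝ := fun T F => cellVal e T - faceVal e F with hδ
  set W : ℝ := ∑ T, ∑ F ∈ M.facesOf T, (D T F + Fl T F v) * δ T F with hW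
  set Q : ℝ := ∑ T, (minEigenvalue (KT T))⁻¹ *
    ∑ F ∈ M.facesOf T, M.orthDist xT T F / M.faceMeasure F * (D T F + Fl T F v) ^ 2 with hQ
  set N : ℝ := ∑ T, minEigenvalue (KT T) * M.seminormSq xT T e with hN
  have hm : ∀ T, ∀ F ∈ M.facesOf T, 0 < M.faceMeasure F := fun T F hF => M.faceMeasure_pos hF
  have hN0 : 0 ≤ N := Finset.sum_nonneg fun T _ => mul_nonneg (hKT T).le
    (Finset.sum_nonneg fun F hF => mul_nonneg (mul_pos (hm T F hF) (hdTF T F hF)).le (sq_nonneg _))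
  -- The sums `Fl T F uh + D T F` are orthogonal to cell values by balance (h1) and to face values
  -- by conservativity (h2), so the coercivity form at e reduces to minus the consistency term.
  have hcoer' : γ * N ≤ - W := by
    have h := hcoer e
    rw [discNorm, Real.sq_sqrt hN0] at h
    refine h.trans_eq ?_
    have h1 : ∑ T, ∑ F ∈ M.facesOf T, (Fl T F uh + D T F) * cellVal e T = 0 := by
      refine Finset.sum_eq_zero fun T _ => ?_
      rw [← Finset.sum_mul, Finset.sum_add_distrib, huh.balance, hDb, add_neg_cancel, zero_mul]
    have h2 : ∑ T, ∑ F ∈ M.facesOf T, (Fl T F uh + D T F) * faceVal e F = 0 := by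
      refine M.sum_mul_faceVal_eq_zero (a := fun T F => Fl T F uh + D T F)
        (fun F T T' hne hF hF' => ?_) e
      linarith [huh.conservative F T T' hne hF hF', hDc F T T' hne hF hF']
    calc ∑ T, ∑ F ∈ M.facesOf T, Fl T F e * (cellVal e T - faceVal e F)
        = ∑ T, ∑ F ∈ M.facesOf T, ((Fl T F uh + D T F) * cellVal e T -
            (Fl T F uh + D T F) * faceVal e F - (D T F + Fl T F v) * δ T F) := by
          refine Finset.sum_congr rfl fun T _ => Finset.sum_congr rfl fun F _ => ?_
          rw [he, map_sub, ← he, hδ]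
          ring
      _ = - W := by
          simp only [Finset.sum_sub_distrib]
          rw [h1, h2, sub_zero, zero_sub]
  -- Cauchy–Schwarz over pairs (cell, face of the cell). The weights of Q and N are inverse to each
  -- other, once the factor 1 / d_TF² of the seminorm is included, so the pointwise condition is an
  -- equality.
  have hCS : W ^ 2 ≤ Q * N := by
    have hQ' : Q = ∑ p ∈ Finset.univ.sigma M.facesOf, (minEigenvalue (KT p.1))⁻¹ *
        (M.orthDist xT p.1 p.2 / M.faceMeasure p.2 * (D p.1 p.2 + Fl p.1 p.2 v) ^ 2) := by
      simp only [hQ, Finset.mul_sum, Finset.sum_sigma]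
    have hN' : N = ∑ p ∈ Finset.univ.sigma M.facesOf, minEigenvalue (KT p.1) *
        (M.faceMeasure p.2 * M.orthDist xT p.1 p.2 * (δ p.1 p.2 / M.orthDist xT p.1 p.2) ^ 2) := by
      simp only [hN, seminormSq, Finset.mul_sum, Finset.sum_sigma, hδ]
    have hW' : W = ∑ p ∈ Finset.univ.sigma M.facesOf, (D p.1 p.2 + Fl p.1 p.2 v) * δ p.1 p.2 := by
      simp only [hW, Finset.sum_sigma]
    rw [hQ', hN', hW']
    refine Finset.sum_sq_le_sum_mul_sum_of_sq_le_mul _ (fun p hp => ?_) (fun p hp => ?_)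
      fun p hp => ?_
    all_goals
      have h1 := hKT p.1
      have h2 := hdTF p.1 p.2 (Finset.mem_sigma.1 hp).2
      have h3 := hm p.1 p.2 (Finset.mem_sigma.1 hp).2
    · positivity
    · positivity
    · refine le_of_eq ?_
      field_simp
  rw [discNorm]
  change √N ≤ γ⁻¹ * √Q
  -- The estimate is obtained by dividing by √N, so a zero error is treated apart.
  rcases hN0.eq_or_lt with h | h
  · rw [← h, Real.sqrt_zero]
    positivity
  have hsN : 0 < √N := Real.sqrt_pos.2 h
  have hWle : - W ≤ √Q * √N := by
    refine (neg_le_abs W).trans ?_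
    rw [← Real.sqrt_mul' _ hN0]
    exact Real.abs_le_sqrt hCS
  rw [inv_mul_eq_div, le_div_iff₀ hγ]
  refine le_of_mul_le_mul_right ?_ hsN
  calc √N * γ * √N = γ * (√N * √N) := by ring
    _ = γ * N := by rw [Real.mul_self_sqrt hN0]
    _ ≤ √Q * √N := hcoer'.trans hWle

end PolytopalMesh

end HybridFV

theorem theorem3p4 {d : ℕ} (hd : 1 ≤ d)
    -- the domain
    {Ω : Set (E d)} (hΩ : IsPolytope Ω) (hΩc : IsConnected Ω)
    -- the diffusion field, piecewise constant on a polytopal partition of the domain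
    {ι : Type*} [Finite ι] {P : ι → Set (E d)} (hP : IsPolytopalPartition Ω P)
    {K : E d → Matrix (Fin d) (Fin d) ℝ} (hK : IsDiffusionField Ω P K)
    -- a mesh compliant with the partition, with the value of the diffusion in each cell
    {𝒯 ℱ : Type*} [Fintype 𝒯] [Fintype ℱ] (M : PolytopalMesh Ω 𝒯 ℱ)
    (hM : ∀ T, ∃ i, M.cell T ⊆ P i)
    {KT : 𝒯 → Matrix (Fin d) (Fin d) ℝ} (hKT : ∀ T, ∀ x ∈ M.cell T, K x = KT T)
    -- the points of the cells and faces
    {xT : 𝒯 → E d} (hxT : ∀ T, xT T ∈ M.cell T)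
    {xF : ℱ → E d} (hxF : ∀ F, xF F ∈ closure (M.face F))
    (hdTF : ∀ T, ∀ F ∈ M.facesOf T, 0 < M.orthDist xT T F)
    -- the numerical fluxes
    (Fl : 𝒯 → ℱ → M.X →ₗ[ℝ] ℝ) {γ : ℝ} (hγ : 0 < γ) (hcoer : M.IsCoercive xT KT Fl γ)
    -- the exact solution
    {f : E d → ℝ} (hf : MemLp f 2 (volume.restrict Ω))
    {u : E d → ℝ} (hu : IsWeakSolution Ω K f u)
    (huc : ContinuousOn u (closure Ω)) (hu2 : ∀ T, MemH2 (M.cell T) u)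
    -- the discrete solution
    {uh : M.X} (huh : M.IsFVSolution Fl f uh) :
    M.discNorm xT KT (uh - M.interp xT xF u) ≤
      γ⁻¹ * Real.sqrt (∑ T, (minEigenvalue (KT T))⁻¹ *
        ∑ F ∈ M.facesOf T, M.orthDist xT T F / M.faceMeasure F *
          (M.diffusiveFlux KT u T F + Fl T F (M.interp xT xF u)) ^ 2) := by
  have hΩo : IsOpen Ω := hΩ.isOpen
  obtain ⟨a, ha, b, hell⟩ := hK.elliptic
  have hpos : ∀ T, 0 < minEigenvalue (KT T) := fun T => by
    have hx := M.cells.subset T (hxT T)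
    rw [← hKT T _ (hxT T)]
    exact minEigenvalue_pos hd (hK.symm _ hx) ha fun ξ => (hell _ hx ξ).1
  have key := M.discNorm_sub_le hpos hdTF Fl hγ hcoer (D := M.diffusiveFlux KT u)
    (fun F T T' hne hF hF' => M.diffusiveFlux_add_diffusiveFlux hΩo hKT hf hu hu2 hne hF hF')
    (M.sum_diffusiveFlux hΩo hKT hf hu hu2) huh
    (M.interp xT xF u)
  exact key
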